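/- Let $\mathbb D$ be the open unit disc, $H(\mathbb D)$ the space of analytic functions on $\mathbb D$, and $dA=\frac{dx\,dy}{\pi}$. Let $v:\mathbb D\to(0,\infty)$ be a radial weight ($v$ is integrable over $\mathbb D$ and $v(z)=v(|z|)$), put $\widehat v(r)=\int_r^1 v(s)\,ds$, and suppose that $v\in\widehat{\mathcal D}$, i.e. $\sup_{0<r<1}\widehat v(r)/\widehat v\big(\tfrac{1+r}{2}\big)<\infty$, and that $$M_1(v)=\sup_{0<r<1}\Big(\int_r^1\frac{\widehat v(s)}{(1-s)^2}\,ds\Big)^{1/2}\Big(\int_0^r\frac{ds}{\widehat v(s)}\Big)^{1/2}<\infty,$$ $$M_2(v)=\sup_{0<r<1}\Big(\int_0^r\frac{\widehat v(s)}{(1-s)^4}\,ds\Big)^{1/2}\Big(\int_r^1\frac{(1-s)^2}{\widehat v(s)}\,ds\Big)^{1/2}<\infty.$$ Let $\mathcal D_v$ be the space of $f\in H(\mathbb D)$ with $\|f\|_{\mathcal D_v}^2=|f(0)|^2+\int_{\mathbb D}|f'(z)|^2v(z)\,dA(z)<\infty$, and let $B(2,\infty)$ be the space of $g\in H(\mathbb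 D)$ with $$\|g\|_{B(2,\infty)}=|g(0)|+\sup_{0<r<1}(1-r)^{1/2}M_2(r,g')<\infty,\qquad M_2(r,h)=\Big(\frac1{2\pi}\int_{-\pi}^{\pi}|h(re^{i\theta})|^2\,d\theta\Big)^{1/2}.$$ For $g\in H(\mathbb D)$ and $f\in\mathcal D_v$ let $\mathcal H_g(f)(z)=\int_0^1 f(t)\,g'(tz)\,dt$, $z\in\mathbb D$. Then: (a) For all $g\in H(\mathbb D)$ and $f\in\mathcal D_v$ this integral converges absolutely for every $z\in\mathbb D$, and $\mathcal H_g(f)\in H(\mathbb D)$. (b) For every $g\in H(\mathbb D)$, $\mathcal H_g$ is a bounded operator from $\mathcal D_v$ to $\mathcal D_v$ if and only if $g\in B(2,\infty)$. (c) There are constants $0<c\le C<\infty$, depending only on $v$, such that for every $g\in H(\mathbb D)$ $$c\,\|g-g(0)\|_{B(2,\infty)}\le\|\mathcal H_g\|\le C\,\|g-g(0)\|_{B(2,\infty)},$$ where $\|\mathcal H_g\|=\sup\{\|\mathcal H_g(f)\|_{\mathcal D_v}: f\in\mathcal D_v,\ \|f\|_{\mathcal D_v}\le1\}\in[0,\infty]$,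 and both norms may be infinite. -/

import Mathlib

open scoped ENNReal NNReal

noncomputable section

namespace HilbertOp

/-- The open unit disc. -/
def unitDisc : Set ℂ := Metric.ball (0 : ℂ) 1

/-- The class `H(𝔻)` of analytic functions on the unit disc
(values outside the disc are irrelevant everywhere below). -/
def IsHol (f : ℂ → ℂ) : Prop := DifferentiableOn ℂ f unitDisc

/-- A radial weight on the disc: positive, integrable over the disc, `v z = v |z|`. -/
structure IsRadialWeight (v : ℂ → ℝ) : Prop where
  pos : ∀ z ∈ unitDisc, 0 < v z
  integrable : MeasureTheory.IntegrableOn v unitDisc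
  radial : ∀ z ∈ unitDisc, v z = v (‖z‖ : ℂ)

/-- The tail integral `∫_r^1 v(s) ds`. -/
def vhat (v : ℂ → ℝ) (r : ℝ) : ℝ≥0∞ :=
  ∫⁻ s in Set.Ioo r 1, ENNReal.ofReal (v (s : ℂ))

/-- The class of radial weights whose tail integral is doubling:
`sup_{0<r<1} vhat r / vhat ((1+r)/2) < ∞`. -/
structure IsDoubling (v : ℂ → ℝ) : Prop extends IsRadialWeight v where
  doubling : (⨆ r ∈ Set.Ioo (0 : ℝ) 1, vhat v r / vhat v ((1 + r) / 2)) < ∞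

/-- First Muckenhoupt-type constant `M₁(v)`. -/
def muckenhoupt₁ (v : ℂ → ℝ) : ℝ≥0∞ :=
  ⨆ r ∈ Set.Ioo (0 : ℝ) 1,
    (∫⁻ s in Set.Ioo r 1, vhat v s / ENNReal.ofReal ((1 - s) ^ 2)) ^ (1 / 2 : ℝ) *
      (∫⁻ s in Set.Ioo 0 r, 1 / vhat v s) ^ (1 / 2 : ℝ)

/-- Second Muckenhoupt-type constant `M₂(v)`. -/
def muckenhoupt₂ (v : ℂ → ℝ) : ℝ≥0∞ :=
  ⨆ r ∈ Set.Ioo (0 : ℝ) 1,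
    (∫⁻ s in Set.Ioo 0 r, vhat v s / ENNReal.ofReal ((1 - s) ^ 4)) ^ (1 / 2 : ℝ) *
      (∫⁻ s in Set.Ioo r 1, ENNReal.ofReal ((1 - s) ^ 2) / vhat v s) ^ (1 / 2 : ℝ)

/-- Normalized area measure `dx dy / π` on the disc. -/
def areaMeasure : MeasureTheory.Measure ℂ :=
  ENNReal.ofReal (1 / Real.pi) • MeasureTheory.volume.restrict unitDisc

/-- The Dirichlet-type norm `(|f(0)|² + ∫_𝔻 |f'|² v dA)^{1/2}`, with values in `[0,∞]`. -/
def dirichletNorm (v : ℂ → ℝ) (f : ℂ → ℂ) : ℝ≥0∞ :=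
  (‖f 0‖ₑ ^ 2 + ∫⁻ z, ‖deriv f z‖ₑ ^ 2 * ENNReal.ofReal (v z) ∂areaMeasure) ^ (1 / 2 : ℝ)

/-- The Dirichlet-type space `D_v`. -/
def dirichletSpace (v : ℂ → ℝ) : Set (ℂ → ℂ) :=
  {f | IsHol f ∧ dirichletNorm v f < ∞}

/-- The generalized Hilbert operator `H_g f (z) = ∫_0^1 f(t) g'(tz) dt`. -/
def genHilbert (g f : ℂ → ℂ) (z : ℂ) : ℂ :=
  ∫ t in (0 : ℝ)..1, f (t : ℂ) * deriv g ((t : ℂ) * z)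

/-- `H_g` is a bounded operator from `D_v` into itself. -/
def IsBoundedHilbert (v : ℂ → ℝ) (g : ℂ → ℂ) : Prop :=
  ∃ C : ℝ≥0, ∀ f ∈ dirichletSpace v, genHilbert g f ∈ dirichletSpace v ∧
    dirichletNorm v (genHilbert g f) ≤ C * dirichletNorm v f

/-- The operator norm of `H_g` on `D_v`: supremum over the closed unit ball (possibly `∞`). -/
def hilbertNorm (v : ℂ → ℝ) (g : ℂ → ℂ) : ℝ≥0∞ :=
  ⨆ f ∈ {f | f ∈ dirichletSpace v ∧ dirichletNorm v f ≤ 1}, dirichletNorm v (genHilbert g f)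

/-- The integral mean `M₂(r,f)` of order two over the circle of radius `r`. -/
def integralMean (r : ℝ) (f : ℂ → ℂ) : ℝ≥0∞ :=
  (ENNReal.ofReal (1 / (2 * Real.pi)) *
    ∫⁻ θ in Set.Ioc (-Real.pi) Real.pi,
      ‖f ((r : ℂ) * Complex.exp ((θ : ℂ) * Complex.I))‖ₑ ^ 2) ^ (1 / 2 : ℝ)

/-- The norm of `B(2,∞)`: `|g(0)| + sup_{0<r<1} M₂(r,g') (1-r)^{1/2}`, with values in `[0,∞]`. -/
def besovNorm (g : ℂ → ℂ) : ℝ≥0∞ :=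
  ‖g 0‖ₑ + ⨆ r ∈ Set.Ioo (0 : ℝ) 1,
    integralMean r (deriv g) * ENNReal.ofReal ((1 - r) ^ (1 / 2 : ℝ))

/-- The space `B(2,∞)`. -/
def besovSpace : Set (ℂ → ℂ) := {g | IsHol g ∧ besovNorm g < ∞}

end HilbertOp

end

noncomputable section
namespace HilbertOp
open MeasureTheory Set

/-! Let `b n` be the Taylor coefficients of `g'` and `μ n = ∫_0^1 t^n f(t) dt`. Expanding `g'(tz)`
under the integral shows that `H_g f` has Taylor coefficients `b n * μ n` (`genHilbert_hasTaylor`).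
By Parseval the squared norm of `D_v` is `|a 0|² + ∑ (n+1)² |a (n+1)|² moment v n`
(`dirichletNorm_sq`), and the Besov seminorm squared is the supremum of `(1-r) ∑ |b n|² r^(2n)`. The
theorem thus becomes an inequality between `b`, `μ` and the moments of `v`.

Upper estimate. Writing the moments through `vhat` (`moment_eq`) and the square of `∫ |f(t)| t^n dt`
as a double integral leads to the form `∫ vhat(r) ∬ |f(t) f(s)| ∑ (n+1)³ |b (n+1)|² (r²ts)^n`. The
Besov condition makes the inner sum `O((1 - r²ts)⁻⁴)`, and this is at most a multiple of `(1-rt)⁻²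
(1-rs)⁻²`, so the double integral decouples into the square of `∫ |f(t)| (1-rt)⁻² dt`
(`tsum_moment_sq_le`). Splitting at `t = r` leaves two weighted Hardy inequalities: the part `t < r`
holds because `vhat` decreases, the part `t > r` is the condition `M₂` (`lintegral_kernel_le`). Both
are bounded by `∫ |f|² vhat/(1-t)²`. This integral is dominated by the norm of `f` through `M₁`:
Hardy's inequality passes from `f` to `f'`, and Hilbert's inequality, in the guise of a Fejér–Riesz
inequality on the radius, bounds `∫ |f'|² vhat` (`exists_radius_bound`). The same weighted `L²`
space lies in `L¹(0,1)`, whence the convergence of the integral defining `H_g f`.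

Lower estimate. The polynomials `∑_{N ≤ k < 2N} z^k` have radial moments at least `1/3` up to index
`N`, while their norm is governed by a single moment of `v`, which cancels because the moments
decrease (`sum_sq_mul_coeff_le`). The resulting bound for `∑_{n ≤ N} (n+1)² |b (n+1)|²` yields
linear growth of `∑_{n<N} |b (n+1)|²` by dyadic halving, and Abel summation turns that into the
Besov bound (`besovSeminorm_le`). -/

/-! ### Power series on the disc and Parseval's identity. -/

/-- `f` is the sum of the power series with coefficients `a` on the unit disc. -/
def HasTaylor (f : ℂ → ℂ) (a : ℕ → ℂ) : Prop :=
  ∀ z ∈ unitDisc, HasSum (fun n => a n * z ^ n) (f z)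

lemma mem_unitDisc {z : ℂ} : z ∈ unitDisc ↔ ‖z‖ < 1 := by simp [unitDisc]

lemma ofReal_mem_unitDisc {t : ℝ} (h0 : 0 ≤ t) (h1 : t < 1) : (t : ℂ) ∈ unitDisc := by
  simpa [mem_unitDisc, abs_of_nonneg h0] using h1

lemma HasTaylor.apply_zero {f : ℂ → ℂ} {a : ℕ → ℂ} (h : HasTaylor f a) : f 0 = a 0 := by
  have h1 := h 0 (by simp [mem_unitDisc])
  have h2 := hasSum_single (f := fun n => a n * (0 : ℂ) ^ n) 0 (fun n hn => by simp [hn])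
  simpa using h1.unique h2

lemma HasTaylor.summable_norm {f : ℂ → ℂ} {a : ℕ → ℂ} (h : HasTaylor f a) {r : ℝ} (h0 : 0 ≤ r)
    (h1 : r < 1) : Summable (fun n => ‖a n‖ * r ^ n) := by
  have := (h r (ofReal_mem_unitDisc h0 h1)).summable.norm
  simpa [abs_of_nonneg h0] using this

lemma HasTaylor.hasFPowerSeriesOnBall {f : ℂ → ℂ} {a : ℕ → ℂ} (h : HasTaylor f a) :
    HasFPowerSeriesOnBall f (FormalMultilinearSeries.ofScalars ℂ a) 0 1 where
  r_le := by
    refine ENNReal.le_of_forall_nnreal_lt fun r hr => ?_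
    refine FormalMultilinearSeries.le_radius_of_summable _ ?_
    have h1 : (r : ℝ) < 1 := by exact_mod_cast hr
    simpa using h.summable_norm r.2 h1
  r_pos := one_pos
  hasSum := by
    intro y hy
    have hy' : y ∈ unitDisc := by
      rw [mem_unitDisc]
      have : ‖y‖ₑ < 1 := by simpa using hy
      rw [← ofReal_norm] at this
      exact ENNReal.ofReal_lt_one.1 this
    simpa [FormalMultilinearSeries.ofScalars_apply_eq, mul_comm] using h y hy'

lemma HasTaylor.unique {f : ℂ → ℂ} {a b : ℕ → ℂ} (h : HasTaylor f a) (h' : HasTaylor f b) :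
    a = b :=
  FormalMultilinearSeries.ofScalars_series_injective ℂ ℂ
    (h.hasFPowerSeriesOnBall.hasFPowerSeriesAt.eq_formalMultilinearSeries
      h'.hasFPowerSeriesOnBall.hasFPowerSeriesAt)

lemma HasTaylor.isHol {f : ℂ → ℂ} {a : ℕ → ℂ} (h : HasTaylor f a) : IsHol f := by
  have := h.hasFPowerSeriesOnBall.differentiableOn
  refine this.mono fun z hz => ?_
  rw [mem_unitDisc] at hz
  have : ENNReal.ofReal ‖z‖ < 1 := ENNReal.ofReal_lt_one.2 hz
  rw [ofReal_norm] at this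
  simpa using this

lemma IsHol.hasTaylor {f : ℂ → ℂ} (h : IsHol f) :
    HasTaylor f (fun n => (n.factorial : ℂ)⁻¹ * iteratedDeriv n f 0) := by
  intro z hz
  have := Complex.hasSum_taylorSeries_on_ball h hz
  refine this.congr_fun fun n => ?_
  simp only [smul_eq_mul, sub_zero]
  ring

lemma IsHol.deriv {f : ℂ → ℂ} (h : IsHol f) : IsHol (deriv f) :=
  DifferentiableOn.deriv h Metric.isOpen_ball

lemma HasTaylor.deriv {f : ℂ → ℂ} {a : ℕ → ℂ} (h : HasTaylor f a) :
    HasTaylor (deriv f) (fun n => (n + 1) * a (n + 1)) := by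
  have h1 := h.isHol.deriv.hasTaylor
  rw [h.unique h.isHol.hasTaylor]
  refine fun z hz => (h1 z hz).congr_fun fun n => ?_
  beta_reduce
  rw [iteratedDeriv_succ', Nat.factorial_succ]
  have h2 : (n.factorial : ℂ) ≠ 0 := by exact_mod_cast n.factorial_ne_zero
  have h3 : (n : ℂ) + 1 ≠ 0 := by exact_mod_cast n.succ_ne_zero
  push_cast
  field_simp

lemma IsHol.continuousOn_radius {f : ℂ → ℂ} (h : IsHol f) :
    ContinuousOn (fun t : ℝ => f t) (Ico 0 1) :=
  h.continuousOn.comp Complex.continuous_ofReal.continuousOn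
    fun _ ht => ofReal_mem_unitDisc ht.1 ht.2

lemma circle_mem_unitDisc {r : ℝ} (h0 : 0 ≤ r) (h1 : r < 1) (θ : ℝ) :
    (r : ℂ) * Complex.exp (θ * Complex.I) ∈ unitDisc := by
  rw [mem_unitDisc, norm_mul, Complex.norm_exp_ofReal_mul_I]
  simpa [abs_of_nonneg h0] using h1

lemma integral_exp_sub_mul_I (n m : ℕ) :
    ∫ θ in Ioc (-Real.pi) Real.pi,
      Complex.exp ((n : ℂ) * (θ * Complex.I)) * Complex.exp (-((m : ℂ) * (θ * Complex.I))) =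
      if n = m then 2 * Real.pi else 0 := by
  rw [← intervalIntegral.integral_of_le (by linarith [Real.pi_pos])]
  split_ifs with h
  · subst h
    simp_rw [← Complex.exp_add, add_neg_cancel, Complex.exp_zero]
    simp; ring
  · have hc : ((n : ℂ) - m) * Complex.I ≠ 0 := by
      refine mul_ne_zero (sub_ne_zero.2 (by exact_mod_cast h)) Complex.I_ne_zero
    have : ∀ θ : ℝ, Complex.exp ((n : ℂ) * (θ * Complex.I)) *
        Complex.exp (-((m : ℂ) * (θ * Complex.I))) = Complex.exp ((n - m) * Complex.I * θ) := by
      intro θ; rw [← Complex.exp_add]; congr 1; ring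
    simp_rw [this]
    rw [integral_exp_mul_complex hc, Complex.ofReal_zero, div_eq_zero_iff]
    left
    rw [sub_eq_zero, Complex.exp_eq_exp_iff_exists_int]
    refine ⟨n - m, ?_⟩
    push_cast; ring

/-- Parseval's identity on the circle of radius `r`. -/
lemma HasTaylor.lintegral_circle {f : ℂ → ℂ} {a : ℕ → ℂ} (h : HasTaylor f a) {r : ℝ}
    (h0 : 0 ≤ r) (h1 : r < 1) :
    ∫⁻ θ in Ioc (-Real.pi) Real.pi, ‖f (r * Complex.exp (θ * Complex.I))‖ₑ ^ 2 =
      ENNReal.ofReal (2 * Real.pi) * ∑' n, ‖a n‖ₑ ^ 2 * ENNReal.ofReal (r ^ (2 * n)) := by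
  set μ : Measure ℝ := volume.restrict (Ioc (-Real.pi) Real.pi)
  set F : ℝ → ℂ := fun θ => f (r * Complex.exp (θ * Complex.I)) with hF
  have hs := h.summable_norm h0 h1
  have hFc : Continuous F := by
    have := h.isHol.continuousOn.comp_continuous (f := fun θ : ℝ => (r : ℂ) * Complex.exp (θ * Complex.I))
      (by fun_prop) (circle_mem_unitDisc h0 h1)
    exact this
  have hsum : ∀ θ : ℝ, HasSum (fun n => a n * r ^ n * Complex.exp ((n : ℂ) * (θ * Complex.I)))
      (F θ) := by
    intro θ
    refine (h _ (circle_mem_unitDisc h0 h1 θ)).congr_fun fun n => ?_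
    rw [mul_pow, ← Complex.exp_nat_mul]; ring
  -- Termwise integration against a continuous `G`, used twice: exponentials extract the
  -- coefficients of `F`, and then the conjugate of `F` gives the energy.
  have key : ∀ G : ℝ → ℂ, Continuous G → HasSum (fun n => a n * r ^ n *
      ∫ θ, Complex.exp ((n : ℂ) * (θ * Complex.I)) * G θ ∂μ) (∫ θ, F θ * G θ ∂μ) := by
    intro G hG
    have hint : ∀ n : ℕ, Integrable (fun θ : ℝ =>
        a n * r ^ n * (Complex.exp ((n : ℂ) * (θ * Complex.I)) * G θ)) μ := fun n =>
      ((by fun_prop : Continuous _).integrableOn_Icc).mono_set Ioc_subset_Icc_self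
    have hnorm : ∀ (n : ℕ) (θ : ℝ), ‖a n * r ^ n * (Complex.exp ((n : ℂ) * (θ * Complex.I)) * G θ)‖
        = ‖a n‖ * r ^ n * ‖G θ‖ := by
      intro n θ
      have : (n : ℂ) * (θ * Complex.I) = ((n * θ : ℝ) : ℂ) * Complex.I := by push_cast; ring
      rw [this, norm_mul, norm_mul, norm_mul, Complex.norm_exp_ofReal_mul_I]
      simp [abs_of_nonneg h0]
    have := hasSum_integral_of_summable_integral_norm hint (by
      simp_rw [hnorm, integral_const_mul]
      exact hs.mul_right _)
    simp_rw [integral_const_mul] at this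
    have hFG : ∫ θ, F θ * G θ ∂μ = ∫ θ, ∑' n : ℕ,
        a n * r ^ n * (Complex.exp ((n : ℂ) * (θ * Complex.I)) * G θ) ∂μ := by
      refine integral_congr_ae (Filter.Eventually.of_forall fun θ => ?_)
      have := (hsum θ).mul_right (G θ)
      refine (HasSum.tsum_eq (this.congr_fun fun n => ?_)).symm
      ring
    rw [hFG]
    exact this
  have hcoef : ∀ m : ℕ, ∫ θ, F θ * Complex.exp (-((m : ℂ) * (θ * Complex.I))) ∂μ =
      a m * r ^ m * (2 * Real.pi) := by
    intro m
    have h2 := key (fun θ => Complex.exp (-((m : ℂ) * (θ * Complex.I)))) (by fun_prop)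
    simp_rw [μ, integral_exp_sub_mul_I] at h2
    refine h2.unique ?_
    have h3 := hasSum_single
      (f := fun n => a n * (r : ℂ) ^ n * ((if n = m then 2 * Real.pi else 0 : ℝ) : ℂ)) m
      (fun n hn => by simp [hn])
    simpa using h3
  have h3 := key (fun θ => (starRingEnd ℂ) (F θ)) (by fun_prop)
  have hconj : ∀ n : ℕ, ∫ θ, Complex.exp ((n : ℂ) * (θ * Complex.I)) * (starRingEnd ℂ) (F θ) ∂μ =
      (starRingEnd ℂ) (a n * r ^ n * (2 * Real.pi)) := by
    intro n
    rw [← hcoef n, ← integral_conj]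
    congr 1; ext θ
    rw [map_mul, ← Complex.exp_conj]
    simp [mul_comm]
  simp_rw [hconj, Complex.mul_conj] at h3
  have h4 : HasSum (fun n => 2 * Real.pi * (‖a n‖ ^ 2 * r ^ (2 * n))) (∫ θ, ‖F θ‖ ^ 2 ∂μ) := by
    have h5 : ∀ n : ℕ, a n * (r : ℂ) ^ n * (starRingEnd ℂ) (a n * r ^ n * (2 * Real.pi)) =
        ((2 * Real.pi * (‖a n‖ ^ 2 * r ^ (2 * n)) : ℝ) : ℂ) := by
      intro n
      have : a n * (starRingEnd ℂ) (a n) = ((‖a n‖ ^ 2 : ℝ) : ℂ) := by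
        rw [Complex.mul_conj, Complex.normSq_eq_norm_sq]
      simp only [map_mul, map_pow, Complex.conj_ofReal, map_ofNat]
      rw [show a n * (r : ℂ) ^ n * ((starRingEnd ℂ) (a n) * r ^ n * (2 * Real.pi)) =
        (a n * (starRingEnd ℂ) (a n)) * (r ^ (2 * n) * (2 * Real.pi)) by ring, this]
      push_cast; ring
    simp_rw [h5, Complex.normSq_eq_norm_sq] at h3
    rw [integral_complex_ofReal] at h3
    exact_mod_cast h3
  have h6 : ∫⁻ θ, ‖F θ‖ₑ ^ 2 ∂μ = ENNReal.ofReal (∫ θ, ‖F θ‖ ^ 2 ∂μ) := by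
    rw [ofReal_integral_eq_lintegral_ofReal]
    · congr 1; ext θ
      rw [ENNReal.ofReal_pow (norm_nonneg _), ofReal_norm]
    · exact ((by fun_prop : Continuous _).integrableOn_Icc).mono_set Ioc_subset_Icc_self
    · exact Filter.Eventually.of_forall fun θ => by positivity
  rw [h6, ← h4.tsum_eq, ENNReal.ofReal_tsum_of_nonneg (fun n => by have := Real.pi_pos; positivity)
    h4.summable, ← ENNReal.tsum_mul_left]
  congr 1; ext n
  rw [ENNReal.ofReal_mul (by have := Real.pi_pos; positivity),
    ENNReal.ofReal_mul (p := ‖a n‖ ^ 2) (by positivity), ENNReal.ofReal_pow (norm_nonneg _), ofReal_norm]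

lemma HasTaylor.integralMean_sq {f : ℂ → ℂ} {a : ℕ → ℂ} (h : HasTaylor f a) {r : ℝ}
    (h0 : 0 ≤ r) (h1 : r < 1) :
    integralMean r f ^ 2 = ∑' n, ‖a n‖ₑ ^ 2 * ENNReal.ofReal (r ^ (2 * n)) := by
  rw [integralMean, ← ENNReal.rpow_natCast, ← ENNReal.rpow_mul, h.lintegral_circle h0 h1,
    ← mul_assoc, ← ENNReal.ofReal_mul (by have := Real.pi_pos; positivity)]
  have := Real.pi_pos
  rw [one_div_mul_cancel (by positivity)]
  simp

/-! ### Schur's test and Hilbert's inequality. -/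

lemma lintegral_mul_sq_le {α : Type*} [MeasurableSpace α] {μ : Measure α} {f g : α → ℝ≥0∞}
    (hf : AEMeasurable f μ) (hg : AEMeasurable g μ) :
    (∫⁻ x, f x * g x ∂μ) ^ 2 ≤ (∫⁻ x, f x ^ 2 ∂μ) * ∫⁻ x, g x ^ 2 ∂μ := by
  have h := ENNReal.lintegral_mul_le_Lp_mul_Lq μ Real.HolderConjugate.two_two hf hg
  calc (∫⁻ x, f x * g x ∂μ) ^ 2 ≤ ((∫⁻ a, f a ^ (2 : ℝ) ∂μ) ^ (1 / 2 : ℝ) *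
        (∫⁻ a, g a ^ (2 : ℝ) ∂μ) ^ (1 / 2 : ℝ)) ^ 2 := by gcongr; exact h
    _ = _ := by
      rw [mul_pow, ← ENNReal.rpow_natCast, ← ENNReal.rpow_natCast, ← ENNReal.rpow_mul,
        ← ENNReal.rpow_mul]
      norm_num

lemma ENNReal.rpow_half_sq (x : ℝ≥0∞) : (x ^ (1 / 2 : ℝ)) ^ 2 = x := by
  rw [← ENNReal.rpow_natCast, ← ENNReal.rpow_mul]; norm_num

lemma ENNReal.rpow_half_mul_self (x : ℝ≥0∞) : x ^ (1 / 2 : ℝ) * x ^ (1 / 2 : ℝ) = x := by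
  rw [← sq, ENNReal.rpow_half_sq]

/-- Schur's test for positive kernels on `L²`. -/
theorem schur_test {α β : Type*} [MeasurableSpace α] [MeasurableSpace β] {μ : Measure α}
    {ν : Measure β} [SFinite μ] [SFinite ν] {K : α → β → ℝ≥0∞} {p : α → ℝ≥0∞} {q φ : β → ℝ≥0∞}
    {C D : ℝ≥0∞} (hK : AEMeasurable (Function.uncurry K) (μ.prod ν))
    (hKx : ∀ᵐ x ∂μ, AEMeasurable (K x) ν) (hKy : ∀ᵐ y ∂ν, AEMeasurable (fun x => K x y) μ)
    (hp : AEMeasurable p μ) (hq : AEMeasurable q ν) (hφ : AEMeasurable φ ν)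
    (hq0 : ∀ᵐ y ∂ν, q y ≠ 0 ∧ q y ≠ ∞)
    (h1 : ∀ᵐ x ∂μ, ∫⁻ y, K x y * q y ∂ν ≤ C * p x)
    (h2 : ∀ᵐ y ∂ν, ∫⁻ x, K x y * p x ∂μ ≤ D * q y) :
    ∫⁻ x, (∫⁻ y, K x y * φ y ∂ν) ^ 2 ∂μ ≤ C * D * ∫⁻ y, φ y ^ 2 ∂ν := by
  -- Cauchy–Schwarz for the splitting `K φ = (K^(1/2) φ q^(-1/2)) (K^(1/2) q^(1/2))`; the second
  -- factor is absorbed by `h1`, and `h2` is kept for the integration in `x`.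
  have step : ∀ᵐ x ∂μ, (∫⁻ y, K x y * φ y ∂ν) ^ 2 ≤
      C * ∫⁻ y, K x y * p x * (φ y ^ 2 * (q y)⁻¹) ∂ν := by
    filter_upwards [h1, hKx] with x hx hKx
    have e1 : ∫⁻ y, K x y * φ y ∂ν = ∫⁻ y, (K x y ^ (1 / 2 : ℝ) * φ y * (q y ^ (1 / 2 : ℝ))⁻¹) *
        (K x y ^ (1 / 2 : ℝ) * q y ^ (1 / 2 : ℝ)) ∂ν := by
      refine lintegral_congr_ae ?_
      filter_upwards [hq0] with y hy
      have hne : q y ^ (1 / 2 : ℝ) ≠ 0 := by simp [ENNReal.rpow_eq_zero_iff, hy.1, hy.2]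
      have hnt : q y ^ (1 / 2 : ℝ) ≠ ∞ := by simp [ENNReal.rpow_eq_top_iff, hy.1, hy.2]
      calc K x y * φ y = (K x y ^ (1 / 2 : ℝ) * K x y ^ (1 / 2 : ℝ)) * φ y *
            ((q y ^ (1 / 2 : ℝ))⁻¹ * q y ^ (1 / 2 : ℝ)) := by
            rw [ENNReal.rpow_half_mul_self, ENNReal.inv_mul_cancel hne hnt, mul_one]
        _ = _ := by ring
    rw [e1]
    refine (lintegral_mul_sq_le (by fun_prop) (by fun_prop)).trans ?_
    have e2 : ∫⁻ y, (K x y ^ (1 / 2 : ℝ) * q y ^ (1 / 2 : ℝ)) ^ 2 ∂ν = ∫⁻ y, K x y * q y ∂ν := by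
      simp_rw [mul_pow, ENNReal.rpow_half_sq]
    have e3 : ∫⁻ y, (K x y ^ (1 / 2 : ℝ) * φ y * (q y ^ (1 / 2 : ℝ))⁻¹) ^ 2 ∂ν =
        ∫⁻ y, K x y * (φ y ^ 2 * (q y)⁻¹) ∂ν := by
      simp_rw [mul_pow, ← ENNReal.inv_pow, ENNReal.rpow_half_sq, mul_assoc]
    rw [e2, e3]
    calc (∫⁻ y, K x y * (φ y ^ 2 * (q y)⁻¹) ∂ν) * ∫⁻ y, K x y * q y ∂ν
        ≤ (∫⁻ y, K x y * (φ y ^ 2 * (q y)⁻¹) ∂ν) * (C * p x) := by gcongr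
      _ = C * (p x * ∫⁻ y, K x y * (φ y ^ 2 * (q y)⁻¹) ∂ν) := by ring
      _ = _ := by
        rw [← lintegral_const_mul'' _ (by fun_prop)]
        congr 2; ext y; ring
  have hmeas : AEMeasurable (Function.uncurry fun x y => K x y * p x * (φ y ^ 2 * (q y)⁻¹))
      (μ.prod ν) :=
    (hK.mul hp.comp_fst).mul ((hφ.comp_snd.pow_const 2).mul hq.comp_snd.inv)
  calc ∫⁻ x, (∫⁻ y, K x y * φ y ∂ν) ^ 2 ∂μ
      ≤ ∫⁻ x, C * ∫⁻ y, K x y * p x * (φ y ^ 2 * (q y)⁻¹) ∂ν ∂μ := lintegral_mono_ae step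
    _ = C * ∫⁻ x, ∫⁻ y, K x y * p x * (φ y ^ 2 * (q y)⁻¹) ∂ν ∂μ :=
        lintegral_const_mul'' _ hmeas.lintegral_prod_right'
    _ = C * ∫⁻ y, ∫⁻ x, K x y * p x * (φ y ^ 2 * (q y)⁻¹) ∂μ ∂ν := by
        rw [lintegral_lintegral_swap hmeas]
    _ ≤ C * ∫⁻ y, D * φ y ^ 2 ∂ν := by
        gcongr 1
        refine lintegral_mono_ae ?_
        filter_upwards [h2, hq0, hKy] with y hy hqy hKy
        rw [lintegral_mul_const'' _ (by fun_prop : AEMeasurable (fun x => K x y * p x) μ)]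
        calc (∫⁻ x, K x y * p x ∂μ) * (φ y ^ 2 * (q y)⁻¹)
            ≤ D * q y * (φ y ^ 2 * (q y)⁻¹) := by gcongr
          _ = D * φ y ^ 2 * (q y * (q y)⁻¹) := by ring
          _ = D * φ y ^ 2 := by rw [ENNReal.mul_inv_cancel hqy.1 hqy.2, mul_one]
    _ = C * D * ∫⁻ y, φ y ^ 2 ∂ν := by
        rw [lintegral_const_mul'' _ (by fun_prop), mul_assoc]

/-- Both ranges telescope. For `m ≤ n` the kernel is constant and `1/√(m+1) ≤ 2√(m+1) - 2√m`; for `m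
> n` the terms are `(m+1)^(-3/2) ≤ 2/√m - 2/√(m+1)`. Each range contributes at most `2/√(n+1)`. -/
lemma sum_max_kernel_le (n M : ℕ) :
    ∑ m ∈ Finset.range M, 1 / ((max n m : ℕ) + 1 : ℝ) * (1 / √(m + 1)) ≤ 4 / √(n + 1) := by
  have hn : 0 < √((n : ℝ) + 1) := Real.sqrt_pos.2 (by positivity)
  have hsn : √((n : ℝ) + 1) ^ 2 = n + 1 := Real.sq_sqrt (by positivity)
  have low : ∀ M ≤ n + 1, ∑ m ∈ Finset.range M, 1 / ((max n m : ℕ) + 1 : ℝ) * (1 / √(m + 1)) ≤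
      2 * √M / (n + 1) := by
    intro M
    induction M with
    | zero => simp
    | succ M ih =>
      intro hM
      rw [Finset.sum_range_succ]
      have hmax : max n M = n := by omega
      refine (add_le_add_left (ih (by omega)) _).trans ?_
      rw [hmax]
      have h1 : 0 < √((M : ℝ) + 1) := Real.sqrt_pos.2 (by positivity)
      have h2 : √((M : ℝ) + 1) ^ 2 = M + 1 := Real.sq_sqrt (by positivity)
      have h3 : √(M : ℝ) ^ 2 = M := Real.sq_sqrt (by positivity)
      have h4 : 1 / √((M : ℝ) + 1) ≤ 2 * √((M : ℝ) + 1) - 2 * √M := by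
        rw [div_le_iff₀ h1]
        nlinarith [sq_nonneg (√((M : ℝ) + 1) - √M)]
      have : 1 / ((n : ℝ) + 1) * (1 / √((M : ℝ) + 1)) ≤
          1 / ((n : ℝ) + 1) * (2 * √((M : ℝ) + 1) - 2 * √M) := by gcongr
      push_cast
      calc _ ≤ 2 * √M / ((n : ℝ) + 1) + 1 / ((n : ℝ) + 1) * (2 * √((M : ℝ) + 1) - 2 * √M) := by
            gcongr
        _ = _ := by ring
  have high : ∀ k : ℕ, ∑ m ∈ Finset.range (n + 1 + k), 1 / ((max n m : ℕ) + 1 : ℝ) *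
      (1 / √(m + 1)) ≤ 4 / √(n + 1) - 2 / √((n + 1 + k : ℕ)) := by
    intro k
    induction k with
    | zero =>
      refine (low (n + 1) le_rfl).trans (le_of_eq ?_)
      push_cast
      nth_rw 2 [← hsn]
      simp only [add_zero]
      field_simp
      norm_num
    | succ k ih =>
      rw [← add_assoc, Finset.sum_range_succ]
      refine (add_le_add_left ih _).trans ?_
      have hmax : max n (n + 1 + k) = n + 1 + k := by omega
      rw [hmax]
      generalize hM : n + 1 + k = M at *
      have hM1 : (1 : ℝ) ≤ M := by exact_mod_cast (by omega : 1 ≤ M)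
      have h0 : 0 < √(M : ℝ) := Real.sqrt_pos.2 (by positivity)
      have h1 : 0 < √((M : ℝ) + 1) := Real.sqrt_pos.2 (by positivity)
      have h2 : √((M : ℝ) + 1) ^ 2 = M + 1 := Real.sq_sqrt (by positivity)
      have h3 : √(M : ℝ) ^ 2 = M := Real.sq_sqrt (by positivity)
      have h5 : √(M : ℝ) ≤ √((M : ℝ) + 1) := Real.sqrt_le_sqrt (by linarith)
      have h4 : 1 / ((M : ℝ) + 1) * (1 / √((M : ℝ) + 1)) ≤ 2 / √M - 2 / √((M : ℝ) + 1) := by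
        rw [show 1 / ((M : ℝ) + 1) = 1 / √((M : ℝ) + 1) ^ 2 by rw [h2], div_sub_div _ _ h0.ne' h1.ne', div_mul_div_comm, div_le_div_iff₀ (by positivity)
          (by positivity)]
        set x := √(M : ℝ)
        set y := √((M : ℝ) + 1)
        have : (y - x) * (y + x) = 1 := by nlinarith
        have h6 : x ≤ (2 * y - x * 2) * y ^ 2 := by
          have : (2 * y - x * 2) * (2 * y) ≥ 2 * 1 := by nlinarith
          nlinarith
        nlinarith
      push_cast
      linarith
  have hmono : ∑ m ∈ Finset.range M, 1 / ((max n m : ℕ) + 1 : ℝ) * (1 / √(m + 1)) ≤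
      ∑ m ∈ Finset.range (n + 1 + M), 1 / ((max n m : ℕ) + 1 : ℝ) * (1 / √(m + 1)) :=
    Finset.sum_le_sum_of_subset_of_nonneg (by intro i; simp; omega) (fun i _ _ => by positivity)
  have := high M
  have h7 : (0 : ℝ) ≤ 2 / √((n + 1 + M : ℕ)) := by positivity
  linarith

lemma tsum_max_kernel_le (n : ℕ) :
    ∑' m : ℕ, ENNReal.ofReal (1 / ((max n m : ℕ) + 1 : ℝ)) * ENNReal.ofReal (1 / √(m + 1)) ≤
      4 * ENNReal.ofReal (1 / √(n + 1)) := by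
  refine ENNReal.tsum_le_of_sum_range_le fun M => ?_
  simp_rw [← ENNReal.ofReal_mul (by positivity : (0 : ℝ) ≤ 1 / ((max n _ : ℕ) + 1 : ℝ))]
  rw [← ENNReal.ofReal_sum_of_nonneg (fun i _ => by positivity),
    show (4 : ℝ≥0∞) = ENNReal.ofReal 4 by simp, ← ENNReal.ofReal_mul (by norm_num)]
  refine ENNReal.ofReal_le_ofReal ((sum_max_kernel_le n M).trans_eq (by ring))

lemma ENNReal.mul_le_sq_add_sq (a b : ℝ≥0∞) : a * b ≤ a ^ 2 + b ^ 2 := by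
  rcases le_total a b with h | h
  · calc a * b ≤ b * b := by gcongr
      _ ≤ _ := by rw [← sq]; exact le_add_self
  · calc a * b ≤ a * a := by gcongr
      _ ≤ _ := by rw [← sq]; exact le_self_add

/-- Hilbert's inequality for the kernel `1 / (n + m + 1)`. -/
theorem hilbert_inequality (α : ℕ → ℝ≥0∞) :
    ∑' n : ℕ, ∑' m : ℕ, α n * α m * ENNReal.ofReal (1 / (n + m + 1 : ℝ)) ≤
      17 * ∑' n, α n ^ 2 := by
  set K : ℕ → ℕ → ℝ≥0∞ := fun n m => ENNReal.ofReal (1 / ((max n m : ℕ) + 1 : ℝ))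
  -- The kernel `1/(n+m+1)` is dominated by `1/(max n m + 1)`, for which `1/√(n+1)` is a Schur
  -- weight with constant `4` on either side. The final `17` is `4 * 4` plus `1` from `ab ≤ a² +
  -- b²`.
  have hs := schur_test (μ := Measure.count) (ν := Measure.count) (K := K)
    (p := fun n : ℕ => ENNReal.ofReal (1 / √(n + 1))) (q := fun n : ℕ => ENNReal.ofReal (1 / √(n + 1)))
    (φ := α) (C := 4) (D := 4) (Measurable.of_discrete.aemeasurable)
    (.of_forall fun _ => Measurable.of_discrete.aemeasurable)
    (.of_forall fun _ => Measurable.of_discrete.aemeasurable)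
    Measurable.of_discrete.aemeasurable Measurable.of_discrete.aemeasurable
    Measurable.of_discrete.aemeasurable
    (.of_forall fun n => ⟨by simp; positivity, by simp⟩)
    (.of_forall fun n => by
      rw [lintegral_count]; exact tsum_max_kernel_le n)
    (.of_forall fun n => by
      rw [lintegral_count]
      simp only [K, max_comm _ n]
      exact tsum_max_kernel_le n)
  simp_rw [lintegral_count] at hs
  have hle : ∀ n m : ℕ, α n * α m * ENNReal.ofReal (1 / (n + m + 1 : ℝ)) ≤
      α n * (K n m * α m) := by
    intro n m
    rw [mul_assoc, mul_comm (α m)]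
    gcongr
    refine ENNReal.ofReal_le_ofReal ?_
    gcongr
    push_cast
    refine max_le ?_ ?_ <;> simp
  calc ∑' n : ℕ, ∑' m : ℕ, α n * α m * ENNReal.ofReal (1 / (n + m + 1 : ℝ))
      ≤ ∑' n : ℕ, ∑' m : ℕ, α n * (K n m * α m) :=
        ENNReal.tsum_le_tsum fun n => ENNReal.tsum_le_tsum fun m => hle n m
    _ = ∑' n : ℕ, α n * ∑' m : ℕ, (K n m * α m) := by simp_rw [ENNReal.tsum_mul_left]
    _ ≤ ∑' n : ℕ, (α n ^ 2 + (∑' m : ℕ, K n m * α m) ^ 2) :=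
        ENNReal.tsum_le_tsum fun n => ENNReal.mul_le_sq_add_sq _ _
    _ = ∑' n : ℕ, α n ^ 2 + ∑' n, (∑' m : ℕ, K n m * α m) ^ 2 := ENNReal.tsum_add
    _ ≤ ∑' n : ℕ, α n ^ 2 + 4 * 4 * ∑' n, α n ^ 2 := by gcongr
    _ = 17 * ∑' n, α n ^ 2 := by ring

/-! ### Weighted Hardy inequalities. -/

lemma setLIntegral_Ioo_ne_zero {f : ℝ → ℝ≥0∞} {a b : ℝ} (hab : a < b)
    (hf : AEMeasurable f (volume.restrict (Ioo a b))) (h0 : ∀ x ∈ Ioo a b, f x ≠ 0) :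
    ∫⁻ x in Ioo a b, f x ≠ 0 := by
  intro h
  rw [lintegral_eq_zero_iff' hf] at h
  have h1 : ∀ᵐ x ∂volume.restrict (Ioo a b), False := by
    filter_upwards [h, ae_restrict_mem measurableSet_Ioo] with x hx hx'
    exact h0 x hx' hx
  rw [Filter.eventually_false_iff_eq_bot, ae_eq_bot, Measure.restrict_eq_zero] at h1
  exact absurd hab (not_lt.2 (by simpa using h1))

lemma setLIntegral_Ioo_one_sub (f : ℝ → ℝ≥0∞) (a b : ℝ) :
    ∫⁻ x in Ioo a b, f (1 - x) = ∫⁻ x in Ioo (1 - b) (1 - a), f x := by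
  have h := (Measure.measurePreserving_sub_left (volume : Measure ℝ) 1).setLIntegral_comp_preimage_emb
    (MeasurableEquiv.subLeft (1 : ℝ)).measurableEmbedding f (Ioo (1 - b) (1 - a))
  rw [← h]
  simp

/-- With `H` the primitive of `σ` vanishing at `0`, the integrand is `σ/√H`, the derivative of
`2√H`. This is the bound that makes the square root of a primitive a Schur weight. -/
lemma setLIntegral_div_sqrt_le {σ : ℝ → ℝ} (hσ : ContinuousOn σ (Ioo 0 1))
    (hpos : ∀ t ∈ Ioo (0 : ℝ) 1, 0 < σ t) {s : ℝ} (hs : s ∈ Ioo (0 : ℝ) 1)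
    (hfin : ∫⁻ t in Ioo 0 s, ENNReal.ofReal (σ t) ≠ ∞) :
    ∫⁻ t in Ioo 0 s, ENNReal.ofReal (σ t) /
      (∫⁻ x in Ioo 0 t, ENNReal.ofReal (σ x)) ^ (1 / 2 : ℝ) ≤
      2 * (∫⁻ x in Ioo 0 s, ENNReal.ofReal (σ x)) ^ (1 / 2 : ℝ) := by
  have hsub : Ioo 0 s ⊆ Ioo (0 : ℝ) 1 := Ioo_subset_Ioo_right hs.2.le
  have hint : IntegrableOn σ (Ioc 0 s) := by
    rw [integrableOn_Ioc_iff_integrableOn_Ioo]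
    refine ⟨(hσ.mono hsub).aestronglyMeasurable measurableSet_Ioo, ?_⟩
    rw [HasFiniteIntegral, lt_top_iff_ne_top]
    convert hfin using 1
    refine setLIntegral_congr_fun measurableSet_Ioo fun t ht => ?_
    exact Real.enorm_of_nonneg (hpos t (hsub ht)).le
  have hii : IntervalIntegrable σ volume 0 s :=
    (intervalIntegrable_iff_integrableOn_Ioc_of_le hs.1.le).2 hint
  set H : ℝ → ℝ := fun t => ∫ x in (0 : ℝ)..t, σ x with hH
  have hHeq : ∀ t ∈ Ioc 0 s, ∫⁻ x in Ioo 0 t, ENNReal.ofReal (σ x) = ENNReal.ofReal (H t) := by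
    intro t ht
    rw [hH]
    beta_reduce
    rw [intervalIntegral.integral_of_le ht.1.le, integral_Ioc_eq_integral_Ioo,
      ofReal_integral_eq_lintegral_ofReal]
    · exact hint.mono_set (Ioo_subset_Ioc_self.trans (Ioc_subset_Ioc_right ht.2))
    · filter_upwards [ae_restrict_mem measurableSet_Ioo] with x hx
      exact (hpos x ⟨hx.1, hx.2.trans_le (ht.2.trans hs.2.le)⟩).le
  have hHpos : ∀ t ∈ Ioc 0 s, 0 < H t := by
    intro t ht
    refine intervalIntegral.intervalIntegral_pos_of_pos_on ?_ (fun x hx => ?_) ht.1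
    · exact hii.mono_set (by
        rw [uIcc_of_le ht.1.le, uIcc_of_le hs.1.le]; exact Icc_subset_Icc_right ht.2)
    · exact hpos x ⟨hx.1, hx.2.trans_le (ht.2.trans hs.2.le)⟩
  have hcont : ContinuousOn (fun t => 2 * √(H t)) (Icc 0 s) := by
    have : ContinuousOn H (Icc 0 s) := by
      have := intervalIntegral.continuousOn_primitive_interval (μ := volume) (f := σ) (a := 0) (b := s)
        (by rw [uIcc_of_le hs.1.le, integrableOn_Icc_iff_integrableOn_Ioc]; exact hint)
      rwa [uIcc_of_le hs.1.le] at this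
    fun_prop
  have hderiv : ∀ t ∈ Ioo 0 s, HasDerivAt (fun t => 2 * √(H t)) (σ t / √(H t)) t := by
    intro t ht
    have hct : ContinuousAt σ t := hσ.continuousAt (Ioo_mem_nhds ht.1 (ht.2.trans hs.2))
    have h1 : HasDerivAt H (σ t) t := by
      refine intervalIntegral.integral_hasDerivAt_right ?_ ?_ hct
      · exact hii.mono_set (by
          rw [uIcc_of_le ht.1.le, uIcc_of_le hs.1.le]; exact Icc_subset_Icc_right ht.2.le)
      · exact ContinuousOn.stronglyMeasurableAtFilter isOpen_Ioo hσ t (hsub ht)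
    have h2 := (h1.sqrt (hHpos t ⟨ht.1, ht.2.le⟩).ne').const_mul 2
    exact h2.congr_deriv (by field_simp)
  have hg0 : ∀ t ∈ Ioo 0 s, 0 ≤ σ t / √(H t) := fun t ht =>
    div_nonneg (hpos t (hsub ht)).le (Real.sqrt_nonneg _)
  have hgi := intervalIntegral.integrableOn_deriv_of_nonneg hcont hderiv hg0
  have hftc := intervalIntegral.integral_eq_sub_of_hasDerivAt_of_le hs.1.le hcont hderiv
    ((intervalIntegrable_iff_integrableOn_Ioc_of_le hs.1.le).2 hgi)
  have hH0 : H 0 = 0 := by simp [hH]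
  rw [hH0, Real.sqrt_zero, mul_zero, sub_zero, intervalIntegral.integral_of_le hs.1.le,
    integral_Ioc_eq_integral_Ioo] at hftc
  have hsq : ∀ t ∈ Ioc 0 s, (∫⁻ x in Ioo 0 t, ENNReal.ofReal (σ x)) ^ (1 / 2 : ℝ) =
      ENNReal.ofReal √(H t) := by
    intro t ht
    rw [hHeq t ht, ENNReal.ofReal_rpow_of_pos (hHpos t ht), Real.sqrt_eq_rpow]
  rw [hsq s ⟨hs.1, le_rfl⟩, show (2 : ℝ≥0∞) = ENNReal.ofReal 2 by simp,
    ← ENNReal.ofReal_mul (by norm_num), ← hftc, ofReal_integral_eq_lintegral_ofReal]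
  · refine (setLIntegral_congr_fun measurableSet_Ioo fun t ht => ?_).le
    rw [hsq t ⟨ht.1, ht.2.le⟩, ENNReal.ofReal_div_of_pos (Real.sqrt_pos.2 (hHpos t ⟨ht.1, ht.2.le⟩))]
  · exact hgi.mono_set Ioo_subset_Ioc_self
  · filter_upwards [ae_restrict_mem measurableSet_Ioo] with x hx using hg0 x hx

lemma setLIntegral_div_sqrt_le' {σ : ℝ → ℝ} (hσ : ContinuousOn σ (Ioo 0 1))
    (hpos : ∀ t ∈ Ioo (0 : ℝ) 1, 0 < σ t) {s : ℝ} (hs : s ∈ Ioo (0 : ℝ) 1)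
    (hfin : ∫⁻ t in Ioo s 1, ENNReal.ofReal (σ t) ≠ ∞) :
    ∫⁻ t in Ioo s 1, ENNReal.ofReal (σ t) /
      (∫⁻ x in Ioo t 1, ENNReal.ofReal (σ x)) ^ (1 / 2 : ℝ) ≤
      2 * (∫⁻ x in Ioo s 1, ENNReal.ofReal (σ x)) ^ (1 / 2 : ℝ) := by
  have hmem : ∀ t ∈ Ioo (0 : ℝ) 1, 1 - t ∈ Ioo (0 : ℝ) 1 := fun t ht =>
    ⟨by linarith [ht.2], by linarith [ht.1]⟩
  have hrefl : ∀ t, ∫⁻ x in Ioo 0 (1 - t), ENNReal.ofReal (σ (1 - x)) =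
      ∫⁻ x in Ioo t 1, ENNReal.ofReal (σ x) := by
    intro t
    rw [setLIntegral_Ioo_one_sub (fun x => ENNReal.ofReal (σ x))]
    simp
  have h := setLIntegral_div_sqrt_le (σ := fun t => σ (1 - t))
    (hσ.comp (by fun_prop) hmem) (fun t ht => hpos _ (hmem t ht)) (hmem s hs)
    (by rwa [hrefl])
  rw [hrefl] at h
  refine le_trans (le_of_eq ?_) h
  have h2 := setLIntegral_Ioo_one_sub (fun t => ENNReal.ofReal (σ t) /
      (∫⁻ x in Ioo t 1, ENNReal.ofReal (σ x)) ^ (1 / 2 : ℝ)) 0 (1 - s)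
  rw [sub_sub_cancel, sub_zero] at h2
  rw [← h2]
  refine lintegral_congr fun t => ?_
  rw [← hrefl, sub_sub_cancel]

/-- A weighted Hardy inequality for the averaging operator along the sections of `E`, from
Schur's test with the auxiliary functions `h` and `k`. -/
theorem hardy_of_bounds {E : Set (ℝ × ℝ)} (hE : MeasurableSet E) {U σ h k φ : ℝ → ℝ≥0∞}
    {A : ℝ≥0∞} (hU : AEMeasurable U (volume.restrict (Ioo 0 1)))
    (hσ : AEMeasurable σ (volume.restrict (Ioo 0 1)))
    (hh : AEMeasurable h (volume.restrict (Ioo 0 1)))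
    (hk : AEMeasurable k (volume.restrict (Ioo 0 1)))
    (hφ : AEMeasurable φ (volume.restrict (Ioo 0 1)))
    (hσ0 : ∀ t ∈ Ioo (0 : ℝ) 1, σ t ≠ 0 ∧ σ t ≠ ∞) (hU0 : ∀ t ∈ Ioo (0 : ℝ) 1, U t ≠ ∞)
    (hh0 : ∀ t ∈ Ioo (0 : ℝ) 1, h t ≠ 0 ∧ h t ≠ ∞)
    (hk0 : ∀ t ∈ Ioo (0 : ℝ) 1, k t ≠ 0 ∧ k t ≠ ∞)
    (h1 : ∀ s ∈ Ioo (0 : ℝ) 1, ∫⁻ t in Ioo 0 1 ∩ {t | (s, t) ∈ E}, σ t / h t ≤ 2 * h s)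
    (h2 : ∀ t ∈ Ioo (0 : ℝ) 1, ∫⁻ s in Ioo 0 1 ∩ {s | (s, t) ∈ E}, U s / k s ≤ 2 * k t)
    (hA : ∀ s ∈ Ioo (0 : ℝ) 1, h s * k s ≤ A) :
    ∫⁻ s in Ioo 0 1, U s * (∫⁻ t in Ioo 0 1 ∩ {t | (s, t) ∈ E}, φ t) ^ 2 ≤
      4 * A ^ 2 * ∫⁻ t in Ioo 0 1, φ t ^ 2 / σ t := by
  set I : Measure ℝ := volume.restrict (Ioo 0 1)
  have hmem : ∀ᵐ t ∂I, t ∈ Ioo (0 : ℝ) 1 := ae_restrict_mem measurableSet_Ioo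
  have hE1 : ∀ s, MeasurableSet {t | (s, t) ∈ E} := fun s => measurable_prodMk_left hE
  have hE2 : ∀ t, MeasurableSet {s | (s, t) ∈ E} := fun t => measurable_prodMk_right hE
  have hhalf : ∀ x : ℝ≥0∞, x ≠ 0 → x ≠ ∞ → x ^ (1 / 2 : ℝ) ≠ 0 ∧ x ^ (1 / 2 : ℝ) ≠ ∞ := by
    intro x h0 h1
    simp [ENNReal.rpow_eq_zero_iff, ENNReal.rpow_eq_top_iff, h0, h1]
  have hind1 : ∀ (s : ℝ) (f : ℝ → ℝ≥0∞), ∫⁻ t, E.indicator 1 (s, t) * f t ∂I =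
      ∫⁻ t in Ioo 0 1 ∩ {t | (s, t) ∈ E}, f t := by
    intro s f
    rw [inter_comm, ← Measure.restrict_restrict (hE1 s), ← lintegral_indicator (hE1 s)]
    refine lintegral_congr fun t => ?_
    by_cases ht : (s, t) ∈ E <;> simp [ht, indicator]
  have hind2 : ∀ (t : ℝ) (f : ℝ → ℝ≥0∞), ∫⁻ s, E.indicator 1 (s, t) * f s ∂I =
      ∫⁻ s in Ioo 0 1 ∩ {s | (s, t) ∈ E}, f s := by
    intro s f
    rw [inter_comm, ← Measure.restrict_restrict (hE2 s), ← lintegral_indicator (hE2 s)]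
    refine lintegral_congr fun t => ?_
    by_cases ht : (t, s) ∈ E <;> simp [ht, indicator]
  have hEm : Measurable (E.indicator (1 : ℝ × ℝ → ℝ≥0∞)) := measurable_one.indicator hE
  -- Conjugating by `U^(1/2)` and `σ^(1/2)` moves the weights into the kernel and makes the
  -- inequality unweighted. The two Schur constants are `2` and `2 * A ^ 2`, hence the factor `4 * A
  -- ^ 2`.
  have hs := schur_test (μ := I) (ν := I)
    (K := fun s t => U s ^ (1 / 2 : ℝ) * (E.indicator 1 (s, t) * σ t ^ (1 / 2 : ℝ)))
    (p := fun s => U s ^ (1 / 2 : ℝ) * h s) (q := fun t => σ t ^ (1 / 2 : ℝ) / h t)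
    (φ := fun t => φ t / σ t ^ (1 / 2 : ℝ)) (C := 2) (D := 2 * A ^ 2)
    (by
      refine AEMeasurable.mul (f := fun p : ℝ × ℝ => U p.1 ^ (1 / 2 : ℝ)) ?_
        (AEMeasurable.mul (f := E.indicator (1 : ℝ × ℝ → ℝ≥0∞))
          (g := fun p : ℝ × ℝ => σ p.2 ^ (1 / 2 : ℝ)) hEm.aemeasurable ?_)
      · exact (hU.pow_const _).comp_fst
      · exact (hσ.pow_const _).comp_snd)
    (.of_forall fun s => ((hEm.comp measurable_prodMk_left).aemeasurable.mul
      (hσ.pow_const _)).const_mul _)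
    (.of_forall fun t => (hU.pow_const _).mul
      ((hEm.comp measurable_prodMk_right).aemeasurable.mul_const _))
    (by fun_prop) (by fun_prop) (by fun_prop)
    (by
      filter_upwards [hmem] with t ht
      have := hhalf _ (hσ0 t ht).1 (hσ0 t ht).2
      exact ⟨ENNReal.div_ne_zero.2 ⟨this.1, (hh0 t ht).2⟩, ENNReal.div_ne_top this.2 (hh0 t ht).1⟩)
    (by
      filter_upwards [hmem] with s hs
      calc ∫⁻ t, U s ^ (1 / 2 : ℝ) * (E.indicator 1 (s, t) * σ t ^ (1 / 2 : ℝ)) *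
            (σ t ^ (1 / 2 : ℝ) / h t) ∂I
          = ∫⁻ t, U s ^ (1 / 2 : ℝ) * (E.indicator 1 (s, t) * (σ t / h t)) ∂I := by
            refine lintegral_congr fun t => ?_
            nth_rw 3 [← ENNReal.rpow_half_mul_self (σ t)]
            simp only [div_eq_mul_inv]; ring
        _ = U s ^ (1 / 2 : ℝ) * ∫⁻ t in Ioo 0 1 ∩ {t | (s, t) ∈ E}, σ t / h t := by
            rw [lintegral_const_mul' _ _ (ENNReal.rpow_ne_top_of_nonneg (by norm_num) (hU0 s hs)),
              hind1]
        _ ≤ U s ^ (1 / 2 : ℝ) * (2 * h s) := by gcongr; exact h1 s hs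
        _ = _ := by ring)
    (by
      filter_upwards [hmem] with t ht
      have hσt := hhalf _ (hσ0 t ht).1 (hσ0 t ht).2
      -- The bound `h * k ≤ A` enters twice: it trades `h` for `A / k` so that `h2` applies, then
      -- `k` for `A / h` to return to the Schur weight. This is the origin of `A ^ 2`.
      have hhk : ∀ s ∈ Ioo (0 : ℝ) 1, h s ≤ A / k s := fun s hs =>
        (ENNReal.le_div_iff_mul_le (.inl (hk0 s hs).1) (.inl (hk0 s hs).2)).2 (hA s hs)
      have hkh : k t ≤ A / h t :=
        (ENNReal.le_div_iff_mul_le (.inl (hh0 t ht).1) (.inl (hh0 t ht).2)).2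
          (by rw [mul_comm]; exact hA t ht)
      calc ∫⁻ s, U s ^ (1 / 2 : ℝ) * (E.indicator 1 (s, t) * σ t ^ (1 / 2 : ℝ)) *
            (U s ^ (1 / 2 : ℝ) * h s) ∂I
          = ∫⁻ s, σ t ^ (1 / 2 : ℝ) * (E.indicator 1 (s, t) * (U s * h s)) ∂I := by
            refine lintegral_congr fun s => ?_
            nth_rw 3 [← ENNReal.rpow_half_mul_self (U s)]
            ring
        _ ≤ ∫⁻ s, (A * σ t ^ (1 / 2 : ℝ)) * (E.indicator 1 (s, t) * (U s / k s)) ∂I := by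
            refine lintegral_mono_ae ?_
            filter_upwards [hmem] with s hs
            calc _ ≤ σ t ^ (1 / 2 : ℝ) * (E.indicator 1 (s, t) * (U s * (A / k s))) := by
                  gcongr; exact hhk s hs
              _ = _ := by simp only [div_eq_mul_inv]; ring
        _ = (A * σ t ^ (1 / 2 : ℝ)) * ∫⁻ s in Ioo 0 1 ∩ {s | (s, t) ∈ E}, U s / k s := by
            rw [lintegral_const_mul'', hind2]
            refine (hEm.comp measurable_prodMk_right).aemeasurable.mul ?_
            fun_prop
        _ ≤ (A * σ t ^ (1 / 2 : ℝ)) * (2 * k t) := by gcongr; exact h2 t ht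
        _ ≤ (A * σ t ^ (1 / 2 : ℝ)) * (2 * (A / h t)) := by gcongr
        _ = _ := by simp only [div_eq_mul_inv]; ring)
  calc ∫⁻ s in Ioo 0 1, U s * (∫⁻ t in Ioo 0 1 ∩ {t | (s, t) ∈ E}, φ t) ^ 2
      = ∫⁻ s, (∫⁻ t, U s ^ (1 / 2 : ℝ) * (E.indicator 1 (s, t) * σ t ^ (1 / 2 : ℝ)) *
          (φ t / σ t ^ (1 / 2 : ℝ)) ∂I) ^ 2 ∂I := by
        refine lintegral_congr_ae ?_
        filter_upwards [hmem] with s hs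
        conv_lhs => rw [← ENNReal.rpow_half_sq (U s)]
        rw [← hind1, ← mul_pow,
          ← lintegral_const_mul' _ _ (ENNReal.rpow_ne_top_of_nonneg (by norm_num) (hU0 s hs))]
        congr 1
        refine lintegral_congr_ae ?_
        filter_upwards [hmem] with t ht
        have hσt := hhalf _ (hσ0 t ht).1 (hσ0 t ht).2
        calc U s ^ (1 / 2 : ℝ) * (E.indicator 1 (s, t) * φ t)
            = U s ^ (1 / 2 : ℝ) * (E.indicator 1 (s, t) * φ t) *
              (σ t ^ (1 / 2 : ℝ) * (σ t ^ (1 / 2 : ℝ))⁻¹) := by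
              rw [ENNReal.mul_inv_cancel hσt.1 hσt.2, mul_one]
          _ = _ := by simp only [div_eq_mul_inv]; ring
    _ ≤ 2 * (2 * A ^ 2) * ∫⁻ t, (φ t / σ t ^ (1 / 2 : ℝ)) ^ 2 ∂I := hs
    _ = _ := by
        rw [show (2 : ℝ≥0∞) * (2 * A ^ 2) = 4 * A ^ 2 by ring]
        congr 1
        refine lintegral_congr fun t => ?_
        rw [div_eq_mul_inv, mul_pow, ← ENNReal.inv_pow, ENNReal.rpow_half_sq, div_eq_mul_inv]

lemma measurable_setLIntegral_Ioo_right (f : ℝ → ℝ≥0∞) (a : ℝ) :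
    Measurable fun s => ∫⁻ t in Ioo a s, f t :=
  Monotone.measurable fun _ _ h => lintegral_mono_set (Ioo_subset_Ioo_right h)

lemma measurable_setLIntegral_Ioo_left (f : ℝ → ℝ≥0∞) (b : ℝ) :
    Measurable fun s => ∫⁻ t in Ioo s b, f t :=
  Antitone.measurable fun _ _ h => lintegral_mono_set (Ioo_subset_Ioo_left h)

lemma ENNReal.rpow_half_ne {x : ℝ≥0∞} (h0 : x ≠ 0) (h1 : x ≠ ∞) :
    x ^ (1 / 2 : ℝ) ≠ 0 ∧ x ^ (1 / 2 : ℝ) ≠ ∞ := by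
  simp [ENNReal.rpow_eq_zero_iff, ENNReal.rpow_eq_top_iff, h0, h1]

/-- An infinite factor beside a nonzero one would make the product infinite. A finite Muckenhoupt
constant therefore already forces both of its integrals to be finite. -/
lemma ENNReal.ne_top_of_rpow_half_mul_le {x y A : ℝ≥0∞} (hA : A ≠ ∞) (hx : x ≠ 0) (hy : y ≠ 0)
    (h : x ^ (1 / 2 : ℝ) * y ^ (1 / 2 : ℝ) ≤ A) : x ≠ ∞ ∧ y ≠ ∞ := by
  have hpos : (0 : ℝ) < 1 / 2 := by norm_num
  constructor
  · rintro rfl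
    rw [ENNReal.top_rpow_of_pos hpos, ENNReal.top_mul] at h
    · exact hA (top_le_iff.1 h)
    · simp [ENNReal.rpow_eq_zero_iff, hy]
  · rintro rfl
    rw [ENNReal.top_rpow_of_pos hpos, ENNReal.mul_top] at h
    · exact hA (top_le_iff.1 h)
    · simp [ENNReal.rpow_eq_zero_iff, hx]

/-- Muckenhoupt's weighted Hardy inequality for `s ↦ ∫_0^s φ`. -/
theorem hardy_left {U σ : ℝ → ℝ} (hU : ContinuousOn U (Ioo 0 1)) (hσ : ContinuousOn σ (Ioo 0 1))
    (hU0 : ∀ t ∈ Ioo (0 : ℝ) 1, 0 < U t) (hσ0 : ∀ t ∈ Ioo (0 : ℝ) 1, 0 < σ t)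
    {A : ℝ≥0∞} (hA : A ≠ ∞)
    (h : ∀ r ∈ Ioo (0 : ℝ) 1, (∫⁻ s in Ioo r 1, ENNReal.ofReal (U s)) ^ (1 / 2 : ℝ) *
      (∫⁻ s in Ioo 0 r, ENNReal.ofReal (σ s)) ^ (1 / 2 : ℝ) ≤ A)
    {φ : ℝ → ℝ≥0∞} (hφ : AEMeasurable φ (volume.restrict (Ioo 0 1))) :
    ∫⁻ s in Ioo 0 1, ENNReal.ofReal (U s) * (∫⁻ t in Ioo 0 s, φ t) ^ 2 ≤
      4 * A ^ 2 * ∫⁻ t in Ioo 0 1, φ t ^ 2 / ENNReal.ofReal (σ t) := by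
  have hUm : AEMeasurable (fun s => ENNReal.ofReal (U s)) (volume.restrict (Ioo 0 1)) :=
    (hU.aemeasurable measurableSet_Ioo).ennreal_ofReal
  have hσm : AEMeasurable (fun s => ENNReal.ofReal (σ s)) (volume.restrict (Ioo 0 1)) :=
    (hσ.aemeasurable measurableSet_Ioo).ennreal_ofReal
  have hU1 : ∀ r ∈ Ioo (0 : ℝ) 1, ∫⁻ s in Ioo r 1, ENNReal.ofReal (U s) ≠ 0 := fun r hr =>
    setLIntegral_Ioo_ne_zero hr.2 (hUm.mono_measure
      (Measure.restrict_mono_set _ (Ioo_subset_Ioo_left hr.1.le)))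
      fun x hx => by simpa using hU0 x ⟨hr.1.trans hx.1, hx.2⟩
  have hσ1 : ∀ r ∈ Ioo (0 : ℝ) 1, ∫⁻ s in Ioo 0 r, ENNReal.ofReal (σ s) ≠ 0 := fun r hr =>
    setLIntegral_Ioo_ne_zero hr.1 (hσm.mono_measure
      (Measure.restrict_mono_set _ (Ioo_subset_Ioo_right hr.2.le)))
      fun x hx => by simpa using hσ0 x ⟨hx.1, hx.2.trans hr.2⟩
  have hfin := fun r hr => ENNReal.ne_top_of_rpow_half_mul_le hA (hU1 r hr) (hσ1 r hr) (h r hr)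
  have hsec1 : ∀ s ∈ Ioo (0 : ℝ) 1, Ioo 0 1 ∩ {t | (s, t) ∈ {p : ℝ × ℝ | p.2 < p.1}} = Ioo 0 s := by
    intro s hs; ext t; simp only [mem_inter_iff, mem_Ioo, mem_ofPred_eq]
    exact ⟨fun h => ⟨h.1.1, h.2⟩, fun h => ⟨⟨h.1, h.2.trans hs.2⟩, h.2⟩⟩
  have hsec2 : ∀ t ∈ Ioo (0 : ℝ) 1, Ioo 0 1 ∩ {s | (s, t) ∈ {p : ℝ × ℝ | p.2 < p.1}} = Ioo t 1 := by
    intro s hs; ext t; simp only [mem_inter_iff, mem_Ioo, mem_ofPred_eq]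
    exact ⟨fun h => ⟨h.2, h.1.2⟩, fun h => ⟨⟨hs.1.trans h.1, h.2⟩, h.1⟩⟩
  -- The auxiliary functions are the square roots of the two integrals in the Muckenhoupt condition,
  -- so that `h * k ≤ A` is that condition itself.
  have key := hardy_of_bounds (E := {p : ℝ × ℝ | p.2 < p.1})
    (measurableSet_lt measurable_snd measurable_fst) hUm hσm (φ := φ) (A := A)
    (h := fun r => (∫⁻ s in Ioo 0 r, ENNReal.ofReal (σ s)) ^ (1 / 2 : ℝ))
    (k := fun r => (∫⁻ s in Ioo r 1, ENNReal.ofReal (U s)) ^ (1 / 2 : ℝ))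
    ((measurable_setLIntegral_Ioo_right _ _).pow_const _).aemeasurable
    ((measurable_setLIntegral_Ioo_left _ _).pow_const _).aemeasurable hφ
    (fun t ht => ⟨by simpa using hσ0 t ht, ENNReal.ofReal_ne_top⟩)
    (fun t ht => ENNReal.ofReal_ne_top)
    (fun t ht => ENNReal.rpow_half_ne (hσ1 t ht) (hfin t ht).2)
    (fun t ht => ENNReal.rpow_half_ne (hU1 t ht) (hfin t ht).1)
    (fun s hs => by
      rw [hsec1 s hs]; exact setLIntegral_div_sqrt_le hσ hσ0 hs (hfin s hs).2)
    (fun s hs => by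
      rw [hsec2 s hs]; exact setLIntegral_div_sqrt_le' hU hU0 hs (hfin s hs).1)
    (fun s hs => by rw [mul_comm]; exact h s hs)
  refine le_trans (le_of_eq ?_) key
  refine setLIntegral_congr_fun measurableSet_Ioo fun s hs => ?_
  rw [hsec1 s hs]

/-- Muckenhoupt's weighted Hardy inequality for `s ↦ ∫_s^1 φ`. -/
theorem hardy_right {U σ : ℝ → ℝ} (hU : ContinuousOn U (Ioo 0 1)) (hσ : ContinuousOn σ (Ioo 0 1))
    (hU0 : ∀ t ∈ Ioo (0 : ℝ) 1, 0 < U t) (hσ0 : ∀ t ∈ Ioo (0 : ℝ) 1, 0 < σ t)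
    {A : ℝ≥0∞} (hA : A ≠ ∞)
    (h : ∀ r ∈ Ioo (0 : ℝ) 1, (∫⁻ s in Ioo 0 r, ENNReal.ofReal (U s)) ^ (1 / 2 : ℝ) *
      (∫⁻ s in Ioo r 1, ENNReal.ofReal (σ s)) ^ (1 / 2 : ℝ) ≤ A)
    {φ : ℝ → ℝ≥0∞} (hφ : AEMeasurable φ (volume.restrict (Ioo 0 1))) :
    ∫⁻ s in Ioo 0 1, ENNReal.ofReal (U s) * (∫⁻ t in Ioo s 1, φ t) ^ 2 ≤
      4 * A ^ 2 * ∫⁻ t in Ioo 0 1, φ t ^ 2 / ENNReal.ofReal (σ t) := by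
  have hmem : ∀ t ∈ Ioo (0 : ℝ) 1, 1 - t ∈ Ioo (0 : ℝ) 1 := fun t ht =>
    ⟨by linarith [ht.2], by linarith [ht.1]⟩
  have hr0 : ∀ (f : ℝ → ℝ≥0∞) (t : ℝ), ∫⁻ x in Ioo 0 t, f (1 - x) = ∫⁻ x in Ioo (1 - t) 1, f x := by
    intro f t
    rw [setLIntegral_Ioo_one_sub f, sub_zero]
  have hr1 : ∀ (f : ℝ → ℝ≥0∞) (t : ℝ), ∫⁻ x in Ioo t 1, f (1 - x) = ∫⁻ x in Ioo 0 (1 - t), f x := by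
    intro f t
    rw [setLIntegral_Ioo_one_sub f, sub_self]
  have hφ' : AEMeasurable (fun t => φ (1 - t)) (volume.restrict (Ioo 0 1)) := by
    have hmp := (Measure.measurePreserving_sub_left (volume : Measure ℝ) 1).restrict_preimage_emb
      (MeasurableEquiv.subLeft (1 : ℝ)).measurableEmbedding (Ioo 0 1)
    rw [preimage_const_sub_Ioo, sub_self, sub_zero] at hmp
    exact hφ.comp_quasiMeasurePreserving hmp.quasiMeasurePreserving
  -- The reflection `t ↦ 1 - t` exchanges the two Hardy operators and the two Muckenhoupt
  -- conditions.
  have key := hardy_left (U := fun t => U (1 - t)) (σ := fun t => σ (1 - t))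
    (hU.comp (by fun_prop) hmem) (hσ.comp (by fun_prop) hmem) (fun t ht => hU0 _ (hmem t ht))
    (fun t ht => hσ0 _ (hmem t ht)) hA (fun r hr => by
      rw [hr1 (fun x => ENNReal.ofReal (U x)), hr0 (fun x => ENNReal.ofReal (σ x))]
      exact h _ (hmem r hr)) hφ'
  simp_rw [hr0] at key
  rw [hr0 (fun t => φ t ^ 2 / ENNReal.ofReal (σ t)),
    hr0 (fun s => ENNReal.ofReal (U s) * (∫⁻ t in Ioo s 1, φ t) ^ 2), sub_self] at key
  exact key

/-! ### Radial weights: polar coordinates, moments and the tail integral. -/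

lemma setLIntegral_triangle_swap {a b : ℝ → ℝ≥0∞}
    (ha : AEMeasurable a (volume.restrict (Ioo 0 1)))
    (hb : AEMeasurable b (volume.restrict (Ioo 0 1))) :
    ∫⁻ s in Ioo 0 1, a s * ∫⁻ t in Ioo 0 s, b t =
      ∫⁻ t in Ioo 0 1, b t * ∫⁻ s in Ioo t 1, a s := by
  set I : Measure ℝ := volume.restrict (Ioo 0 1)
  set E : Set (ℝ × ℝ) := {p | p.2 < p.1}
  have hE : MeasurableSet E := measurableSet_lt measurable_snd measurable_fst
  have hm : AEMeasurable (Function.uncurry fun s t => E.indicator (fun p => a p.1 * b p.2) (s, t))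
      (I.prod I) := (ha.comp_fst.mul hb.comp_snd).indicator hE
  have h1 : ∀ s ∈ Ioo (0 : ℝ) 1, a s * ∫⁻ t in Ioo 0 s, b t =
      ∫⁻ t, E.indicator (fun p => a p.1 * b p.2) (s, t) ∂I := by
    intro s hs
    have hset : Ioo 0 s = Iio s ∩ Ioo 0 1 := by
      ext t; simp only [mem_inter_iff, mem_Ioo, mem_Iio]
      exact ⟨fun h => ⟨h.2, h.1, h.2.trans hs.2⟩, fun h => ⟨h.2.1, h.1⟩⟩
    rw [hset, ← Measure.restrict_restrict measurableSet_Iio, ← lintegral_const_mul'',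
      ← lintegral_indicator measurableSet_Iio]
    · refine lintegral_congr fun t => ?_
      by_cases ht : t < s <;> simp [E, indicator, ht]
    · exact hb.restrict
  have h2 : ∀ t ∈ Ioo (0 : ℝ) 1, b t * ∫⁻ s in Ioo t 1, a s =
      ∫⁻ s, E.indicator (fun p => a p.1 * b p.2) (s, t) ∂I := by
    intro t ht
    have hset : Ioo t 1 = Ioi t ∩ Ioo 0 1 := by
      ext s; simp only [mem_inter_iff, mem_Ioo, mem_Ioi]
      exact ⟨fun h => ⟨h.1, ht.1.trans h.1, h.2⟩, fun h => ⟨h.1, h.2.2⟩⟩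
    rw [hset, ← Measure.restrict_restrict measurableSet_Ioi, ← lintegral_const_mul'',
      ← lintegral_indicator measurableSet_Ioi]
    · refine lintegral_congr fun s => ?_
      by_cases hs : t < s <;> simp [E, indicator, hs, mul_comm]
    · exact ha.restrict
  rw [setLIntegral_congr_fun measurableSet_Ioo h1, setLIntegral_congr_fun measurableSet_Ioo h2,
    lintegral_lintegral_swap hm]

lemma setLIntegral_unitDisc (F : ℂ → ℝ≥0∞) :
    ∫⁻ z in unitDisc, F z = ∫⁻ p in Ioo (0 : ℝ) 1 ×ˢ Ioo (-Real.pi) Real.pi,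
      ENNReal.ofReal p.1 * F (p.1 * Complex.exp (p.2 * Complex.I)) := by
  have hD : MeasurableSet unitDisc := Metric.isOpen_ball.measurableSet
  have hR : MeasurableSet (Ioo (0 : ℝ) 1 ×ˢ Ioo (-Real.pi) Real.pi) :=
    measurableSet_Ioo.prod measurableSet_Ioo
  have hT : MeasurableSet polarCoord.target := polarCoord.open_target.measurableSet
  have hsub : Ioo (0 : ℝ) 1 ×ˢ Ioo (-Real.pi) Real.pi ⊆ polarCoord.target := by
    rw [polarCoord_target]
    exact prod_mono (fun x hx => hx.1) subset_rfl
  rw [← lintegral_indicator hD, ← Complex.lintegral_comp_polarCoord_symm,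
    ← inter_eq_left.2 hsub, ← setLIntegral_indicator hR]
  refine setLIntegral_congr_fun hT fun p hp => ?_
  have hsymm : Complex.polarCoord.symm p = p.1 * Complex.exp (p.2 * Complex.I) := by
    rw [Complex.polarCoord_symm_apply, Complex.exp_mul_I]
    push_cast; ring
  rw [polarCoord_target] at hp
  have hp1 : 0 < p.1 := hp.1
  have hiff : Complex.polarCoord.symm p ∈ unitDisc ↔ p ∈ Ioo (0 : ℝ) 1 ×ˢ Ioo (-Real.pi) Real.pi := by
    rw [mem_unitDisc, hsymm, norm_mul, Complex.norm_exp_ofReal_mul_I, mul_one, Complex.norm_real,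
      Real.norm_of_nonneg hp1.le]
    exact ⟨fun h => ⟨⟨hp1, h⟩, hp.2⟩, fun h => h.1.2⟩
  by_cases h : p ∈ Ioo (0 : ℝ) 1 ×ˢ Ioo (-Real.pi) Real.pi
  · rw [indicator_of_mem (hiff.2 h), indicator_of_mem h, hsymm, smul_eq_mul]
  · rw [indicator_of_notMem (fun h' => h (hiff.1 h')), indicator_of_notMem h, smul_zero]

variable {v : ℂ → ℝ}

lemma IsRadialWeight.apply_circle (hv : IsRadialWeight v) {r : ℝ} (h0 : 0 < r) (h1 : r < 1) (θ : ℝ) :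
    v (r * Complex.exp (θ * Complex.I)) = v r := by
  rw [hv.radial _ (circle_mem_unitDisc h0.le h1 θ), norm_mul, Complex.norm_exp_ofReal_mul_I,
    mul_one, Complex.norm_real, Real.norm_of_nonneg h0.le]

lemma volume_restrict_polar_rectangle :
    (volume.restrict (Ioo (0 : ℝ) 1 ×ˢ Ioo (-Real.pi) Real.pi) : Measure (ℝ × ℝ)) =
      (volume.restrict (Ioo 0 1)).prod (volume.restrict (Ioo (-Real.pi) Real.pi)) := by
  rw [Measure.prod_restrict]; rfl

/-- The radial profile of a radial weight is measurable. -/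
lemma IsRadialWeight.aemeasurable (hv : IsRadialWeight v) :
    AEMeasurable (fun r : ℝ => ENNReal.ofReal (v r)) (volume.restrict (Ioo 0 1)) := by
  have hvm : AEMeasurable v (volume.restrict unitDisc) := hv.integrable.aestronglyMeasurable.aemeasurable
  set w := hvm.mk v
  have hw : Measurable w := hvm.measurable_mk
  have hvw : ∀ᵐ z ∂volume.restrict unitDisc, v z = w z := hvm.ae_eq_mk
  -- A radius is a null set of the disc, so a.e. equality of `v` and `w` cannot be restricted to it.
  -- In polar coordinates, however, the two agree for a.e. angle on a.e. circle, and `v` is constant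
  -- on circles; the circle mean of `ENNReal.ofReal (w z)` is thus a measurable representative of
  -- the profile.
  obtain ⟨N, hN, hNm, hN0⟩ := exists_measurable_superset_of_null (ae_iff.1 hvw)
  have h1 : ∫⁻ z in unitDisc, N.indicator 1 z = 0 := by
    rw [lintegral_indicator_one hNm, hN0]
  rw [setLIntegral_unitDisc, volume_restrict_polar_rectangle, lintegral_eq_zero_iff] at h1
  · have h2 := Measure.ae_ae_of_ae_prod h1
    refine ⟨fun r => ENNReal.ofReal (1 / (2 * Real.pi)) * ∫⁻ θ in Ioo (-Real.pi) Real.pi,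
      ENNReal.ofReal (w (r * Complex.exp (θ * Complex.I))), ?_, ?_⟩
    · refine Measurable.const_mul (Measurable.lintegral_prod_right' (f := fun p : ℝ × ℝ =>
        ENNReal.ofReal (w (p.1 * Complex.exp (p.2 * Complex.I)))) ?_) _
      exact (hw.comp (by fun_prop)).ennreal_ofReal
    · filter_upwards [h2, ae_restrict_mem measurableSet_Ioo] with r hr hr1
      have h3 : ∫⁻ θ in Ioo (-Real.pi) Real.pi,
          ENNReal.ofReal (w (r * Complex.exp (θ * Complex.I))) =
          ∫⁻ θ in Ioo (-Real.pi) Real.pi, ENNReal.ofReal (v r) := by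
        refine lintegral_congr_ae ?_
        filter_upwards [hr] with θ hθ
        have h4 : (r : ℂ) * Complex.exp (θ * Complex.I) ∉ N := by
          intro h5
          simp [h5] at hθ
          linarith [hr1.1]
        have h6 : v (r * Complex.exp (θ * Complex.I)) = w (r * Complex.exp (θ * Complex.I)) := by
          by_contra h7; exact h4 (hN h7)
        rw [← h6, hv.apply_circle hr1.1 hr1.2]
      rw [h3, setLIntegral_const, Real.volume_Ioo, mul_comm, mul_assoc, ← ENNReal.ofReal_mul (by
        linarith [Real.pi_pos])]
      have : (Real.pi - -Real.pi) * (1 / (2 * Real.pi)) = 1 := by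
        field_simp [Real.pi_pos.ne']; ring
      rw [this]; simp
  · refine Measurable.mul (by fun_prop) ?_
    exact (measurable_one.indicator hNm).comp (by fun_prop)

lemma IsRadialWeight.lintegral_areaMeasure (hv : IsRadialWeight v) {G : ℂ → ℝ≥0∞}
    (hG : Measurable G) :
    ∫⁻ z, G z * ENNReal.ofReal (v z) ∂areaMeasure =
      ENNReal.ofReal (1 / Real.pi) * ∫⁻ r in Ioo 0 1, ENNReal.ofReal r * ENNReal.ofReal (v r) *
        ∫⁻ θ in Ioc (-Real.pi) Real.pi, G (r * Complex.exp (θ * Complex.I)) := by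
  have hvm := hv.aemeasurable
  have hR : MeasurableSet (Ioo (0 : ℝ) 1 ×ˢ Ioo (-Real.pi) Real.pi) :=
    measurableSet_Ioo.prod measurableSet_Ioo
  rw [areaMeasure, lintegral_smul_measure, smul_eq_mul, setLIntegral_unitDisc]
  congr 1
  have h1 : ∫⁻ p in Ioo (0 : ℝ) 1 ×ˢ Ioo (-Real.pi) Real.pi, ENNReal.ofReal p.1 *
      (G (p.1 * Complex.exp (p.2 * Complex.I)) *
        ENNReal.ofReal (v (p.1 * Complex.exp (p.2 * Complex.I)))) =
      ∫⁻ p in Ioo (0 : ℝ) 1 ×ˢ Ioo (-Real.pi) Real.pi, ENNReal.ofReal p.1 * ENNReal.ofReal (v p.1) *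
        G (p.1 * Complex.exp (p.2 * Complex.I)) := by
    refine setLIntegral_congr_fun hR fun p hp => ?_
    rw [hv.apply_circle hp.1.1 hp.1.2]
    ring
  rw [h1, volume_restrict_polar_rectangle, lintegral_prod]
  · refine lintegral_congr fun r => ?_
    dsimp only
    rw [lintegral_const_mul' _ _ (ENNReal.mul_ne_top ENNReal.ofReal_ne_top ENNReal.ofReal_ne_top),
      Measure.restrict_congr_set Ioo_ae_eq_Ioc]
  · refine AEMeasurable.mul (AEMeasurable.mul (by fun_prop) hvm.comp_fst) ?_
    exact (hG.comp (by fun_prop)).aemeasurable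

/-- The moments `2 ∫_0^1 r^{2n+1} v(r) dr`. -/
def moment (v : ℂ → ℝ) (n : ℕ) : ℝ≥0∞ :=
  2 * ∫⁻ r in Ioo 0 1, ENNReal.ofReal (r ^ (2 * n + 1)) * ENNReal.ofReal (v (r : ℂ))

lemma IsRadialWeight.dirichletNorm_sq (hv : IsRadialWeight v) {f : ℂ → ℂ} {a : ℕ → ℂ}
    (h : HasTaylor f a) :
    dirichletNorm v f ^ 2 =
      ‖a 0‖ₑ ^ 2 + ∑' n : ℕ, ((n + 1 : ℕ) : ℝ≥0∞) ^ 2 * ‖a (n + 1)‖ₑ ^ 2 * moment v n := by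
  have hvm := hv.aemeasurable
  rw [dirichletNorm, ENNReal.rpow_half_sq, h.apply_zero,
    hv.lintegral_areaMeasure (G := fun z => ‖deriv f z‖ₑ ^ 2)
      ((measurable_deriv f).enorm.pow_const _)]
  congr 1
  have h1 : ∀ r ∈ Ioo (0 : ℝ) 1, ENNReal.ofReal r * ENNReal.ofReal (v r) *
      ∫⁻ θ in Ioc (-Real.pi) Real.pi, ‖deriv f (r * Complex.exp (θ * Complex.I))‖ₑ ^ 2 =
      ∑' n : ℕ, ENNReal.ofReal (2 * Real.pi) * (((n + 1 : ℕ) : ℝ≥0∞) ^ 2 * ‖a (n + 1)‖ₑ ^ 2) *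
        (ENNReal.ofReal (r ^ (2 * n + 1)) * ENNReal.ofReal (v r)) := by
    intro r hr
    rw [h.deriv.lintegral_circle hr.1.le hr.2, ← ENNReal.tsum_mul_left, ← ENNReal.tsum_mul_left]
    refine tsum_congr fun n => ?_
    have h2 : ‖(n + 1 : ℂ) * a (n + 1)‖ₑ = ((n + 1 : ℕ) : ℝ≥0∞) * ‖a (n + 1)‖ₑ := by
      rw [enorm_mul]
      congr 1
      rw [← Nat.cast_succ, ← ofReal_norm, Complex.norm_natCast, ENNReal.ofReal_natCast]
    rw [h2, pow_succ r, ENNReal.ofReal_mul (pow_nonneg hr.1.le _)]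
    ring
  rw [setLIntegral_congr_fun measurableSet_Ioo h1, lintegral_tsum (fun n => by fun_prop),
    ← ENNReal.tsum_mul_left]
  refine tsum_congr fun n => ?_
  rw [lintegral_const_mul'' _ (by fun_prop), moment, ← mul_assoc, ← mul_assoc,
    ← ENNReal.ofReal_mul (by have := Real.pi_pos; positivity)]
  have : 1 / Real.pi * (2 * Real.pi) = 2 := by
    field_simp [Real.pi_pos.ne']
  rw [this, ENNReal.ofReal_ofNat]
  ring

/-- Integrability over the disc controls `r v(r)` only. Near `0` the profile itself need not be
integrable and `vhat v 0` may be infinite, so later statements on the tail stay on the open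
interval. -/
lemma IsRadialWeight.lintegral_ne_top (hv : IsRadialWeight v) :
    ∫⁻ r in Ioo 0 1, ENNReal.ofReal r * ENNReal.ofReal (v (r : ℂ)) ≠ ∞ := by
  have hπ : 0 < Real.pi := Real.pi_pos
  have h := hv.lintegral_areaMeasure (G := fun _ => 1) measurable_const
  have hfin : ∫⁻ z, 1 * ENNReal.ofReal (v z) ∂areaMeasure ≠ ∞ := by
    simp_rw [one_mul]
    rw [areaMeasure, lintegral_smul_measure, smul_eq_mul]
    refine ENNReal.mul_ne_top ENNReal.ofReal_ne_top ?_
    exact (hasFiniteIntegral_iff_ofReal (by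
      filter_upwards [ae_restrict_mem Metric.isOpen_ball.measurableSet] with z hz
      exact (hv.pos z hz).le)).1 hv.integrable.2 |>.ne
  intro htop
  rw [h] at hfin
  apply hfin
  simp only [lintegral_const, Measure.restrict_apply_univ, Real.volume_Ioc, one_mul]
  rw [lintegral_mul_const' _ _ ENNReal.ofReal_ne_top, htop, ENNReal.top_mul, ENNReal.mul_top]
  · simpa using hπ
  · simpa using hπ

lemma IsRadialWeight.pos_radius (hv : IsRadialWeight v) {r : ℝ} (h0 : 0 ≤ r) (h1 : r < 1) :
    0 < v r := hv.pos _ (ofReal_mem_unitDisc h0 h1)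

lemma IsRadialWeight.moment_ne_top (hv : IsRadialWeight v) (n : ℕ) : moment v n ≠ ∞ := by
  refine ENNReal.mul_ne_top (by simp) (ne_top_of_le_ne_top hv.lintegral_ne_top ?_)
  refine setLIntegral_mono' measurableSet_Ioo fun r hr => ?_
  gcongr
  exact pow_le_of_le_one hr.1.le hr.2.le (by omega)

lemma IsRadialWeight.moment_ne_zero (hv : IsRadialWeight v) (n : ℕ) : moment v n ≠ 0 := by
  have hvm := hv.aemeasurable
  refine mul_ne_zero (by simp) (setLIntegral_Ioo_ne_zero one_pos (by fun_prop) fun r hr => ?_)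
  have h1 := hv.pos_radius hr.1.le hr.2
  have h2 := pow_pos hr.1 (2 * n + 1)
  simp only [ne_eq, mul_eq_zero, ENNReal.ofReal_eq_zero, not_or, not_le]
  exact ⟨h2, h1⟩

lemma moment_antitone (v : ℂ → ℝ) : Antitone (moment v) := by
  intro n m hnm
  refine mul_le_mul_right (setLIntegral_mono' measurableSet_Ioo fun r hr => ?_) _
  gcongr ENNReal.ofReal ?_ * _
  exact pow_le_pow_of_le_one hr.1.le hr.2.le (by omega)

lemma setLIntegral_ofReal_pow {s : ℝ} (hs : 0 ≤ s) (n : ℕ) :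
    ∫⁻ t in Ioo 0 s, ENNReal.ofReal (t ^ n) = ENNReal.ofReal (s ^ (n + 1) / (n + 1)) := by
  rw [← ofReal_integral_eq_lintegral_ofReal, ← integral_Ioc_eq_integral_Ioo,
    ← intervalIntegral.integral_of_le hs, integral_pow]
  · simp
  · exact ((continuous_pow n).integrableOn_Icc).mono_set Ioo_subset_Icc_self
  · filter_upwards [ae_restrict_mem measurableSet_Ioo] with t ht using pow_nonneg ht.1.le _

/-- Integration by parts, done as Tonelli on the triangle `t < r` with `r^(2n+1) = (2n+1) ∫_0^r
t^(2n) dt`. The gained factor `2n+1` is what raises `(n+1)²` to `(n+1)³` in the upper estimate. -/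
lemma IsRadialWeight.moment_eq (hv : IsRadialWeight v) (n : ℕ) :
    moment v n = 2 * ((2 * n + 1 : ℕ) : ℝ≥0∞) *
      ∫⁻ r in Ioo 0 1, ENNReal.ofReal (r ^ (2 * n)) * vhat v r := by
  have hvm := hv.aemeasurable
  have h := setLIntegral_triangle_swap (a := fun s : ℝ => ENNReal.ofReal (v s))
    (b := fun t => ENNReal.ofReal (t ^ (2 * n))) hvm (by fun_prop)
  unfold vhat
  rw [← h, moment, mul_assoc]
  congr 1
  rw [← lintegral_const_mul' _ _ (ENNReal.natCast_ne_top _)]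
  refine setLIntegral_congr_fun measurableSet_Ioo fun s hs => ?_
  rw [setLIntegral_ofReal_pow hs.1.le, mul_left_comm, ← ENNReal.ofReal_natCast,
    ← ENNReal.ofReal_mul (p := ((2 * n + 1 : ℕ) : ℝ)) (by positivity), mul_comm]
  congr 2
  push_cast
  field_simp

lemma IsRadialWeight.vhat_ne_zero (hv : IsRadialWeight v) {r : ℝ} (hr : r ∈ Ioo (0 : ℝ) 1) :
    vhat v r ≠ 0 :=
  setLIntegral_Ioo_ne_zero hr.2 (hv.aemeasurable.mono_measure
    (Measure.restrict_mono_set _ (Ioo_subset_Ioo_left hr.1.le)))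
    fun x hx => by simpa using hv.pos_radius (hr.1.trans hx.1).le hx.2

lemma IsRadialWeight.vhat_ne_top (hv : IsRadialWeight v) {r : ℝ} (hr : r ∈ Ioo (0 : ℝ) 1) :
    vhat v r ≠ ∞ := by
  have hle : ENNReal.ofReal r * vhat v r ≤
      ∫⁻ r in Ioo 0 1, ENNReal.ofReal r * ENNReal.ofReal (v (r : ℂ)) := by
    rw [vhat, ← lintegral_const_mul' _ _ ENNReal.ofReal_ne_top]
    calc ∫⁻ s in Ioo r 1, ENNReal.ofReal r * ENNReal.ofReal (v s)
        ≤ ∫⁻ s in Ioo r 1, ENNReal.ofReal s * ENNReal.ofReal (v s) := by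
          refine setLIntegral_mono' measurableSet_Ioo fun s hs => ?_
          gcongr
          exact hs.1.le
      _ ≤ _ := lintegral_mono_set (Ioo_subset_Ioo_left hr.1.le)
  intro h
  rw [h, ENNReal.mul_top (by simpa using hr.1)] at hle
  exact hv.lintegral_ne_top (top_le_iff.1 hle)

/-- The tail integral as a real-valued function. -/
def vtail (v : ℂ → ℝ) (r : ℝ) : ℝ := (vhat v r).toReal

lemma IsRadialWeight.ofReal_vtail (hv : IsRadialWeight v) {r : ℝ} (hr : r ∈ Ioo (0 : ℝ) 1) :
    ENNReal.ofReal (vtail v r) = vhat v r := ENNReal.ofReal_toReal (hv.vhat_ne_top hr)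

lemma IsRadialWeight.vtail_pos (hv : IsRadialWeight v) {r : ℝ} (hr : r ∈ Ioo (0 : ℝ) 1) :
    0 < vtail v r := ENNReal.toReal_pos (hv.vhat_ne_zero hr) (hv.vhat_ne_top hr)

lemma vhat_antitone (v : ℂ → ℝ) : Antitone (vhat v) := fun _ _ h =>
  lintegral_mono_set (Ioo_subset_Ioo_left h)

/-- The Hardy inequalities are stated for continuous weights. Near `r` the tail is a primitive of a
function integrable on `[r/2, 1]`. -/
lemma IsRadialWeight.continuousOn_vtail (hv : IsRadialWeight v) :
    ContinuousOn (vtail v) (Ioo 0 1) := by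
  intro r hr
  have hr2 : r / 2 ∈ Ioo (0 : ℝ) 1 := ⟨by linarith [hr.1], by linarith [hr.1, hr.2]⟩
  set w : ℝ → ℝ := fun s => (ENNReal.ofReal (v s)).toReal
  have hm : AEMeasurable (fun r : ℝ => ENNReal.ofReal (v r)) (volume.restrict (Ioo (r / 2) 1)) :=
    hv.aemeasurable.mono_measure (Measure.restrict_mono_set _ (Ioo_subset_Ioo_left hr2.1.le))
  have hi : IntegrableOn w (Icc (r / 2) 1) := by
    rw [integrableOn_Icc_iff_integrableOn_Ioo]
    exact integrable_toReal_of_lintegral_ne_top hm (hv.vhat_ne_top hr2)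
  have hc := intervalIntegral.continuousOn_primitive_interval_left (μ := volume) (f := w)
    (a := r / 2) (b := 1) (by rwa [uIcc_of_le hr2.2.le])
  rw [uIcc_of_le hr2.2.le] at hc
  have hc' : ContinuousAt (fun x => ∫ t in x..1, w t) r :=
    hc.continuousAt (Icc_mem_nhds (by linarith [hr.1]) hr.2)
  refine (hc'.congr ?_).continuousWithinAt
  filter_upwards [Ioo_mem_nhds (show r / 2 < r by linarith [hr.1]) hr.2] with x hx
  rw [intervalIntegral.integral_of_le hx.2.le, integral_Ioc_eq_integral_Ioo, vtail, vhat,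
    integral_toReal]
  · exact hm.mono_measure (Measure.restrict_mono_set _ (Ioo_subset_Ioo_left hx.1.le))
  · exact .of_forall fun s => ENNReal.ofReal_lt_top

/-! ### Restriction of functions in `D_v` to the radius. -/

lemma ENNReal.add_sq_le (a b : ℝ≥0∞) : (a + b) ^ 2 ≤ 3 * a ^ 2 + 3 * b ^ 2 := by
  calc (a + b) ^ 2 = a ^ 2 + b ^ 2 + 2 * (a * b) := by ring
    _ ≤ a ^ 2 + b ^ 2 + 2 * (a ^ 2 + b ^ 2) := by gcongr; exact mul_le_sq_add_sq a b
    _ = _ := by ring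

lemma enorm_succ_mul_sq (a : ℕ → ℂ) (n : ℕ) :
    ‖(n + 1 : ℂ) * a (n + 1)‖ₑ ^ 2 = ((n + 1 : ℕ) : ℝ≥0∞) ^ 2 * ‖a (n + 1)‖ₑ ^ 2 := by
  rw [enorm_mul, mul_pow]
  congr 2
  rw [← Nat.cast_succ, ← ofReal_norm, Complex.norm_natCast, ENNReal.ofReal_natCast]

lemma HasTaylor.enorm_radius_le {f : ℂ → ℂ} {a : ℕ → ℂ} (h : HasTaylor f a) {t : ℝ} (h0 : 0 ≤ t)
    (h1 : t < 1) : ‖f t‖ₑ ≤ ∑' n, ‖a n‖ₑ * ENNReal.ofReal (t ^ n) := by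
  rw [← (h t (ofReal_mem_unitDisc h0 h1)).tsum_eq]
  refine enorm_tsum_le_tsum_enorm.trans_eq (tsum_congr fun n => ?_)
  rw [enorm_mul, enorm_pow, ← ofReal_norm (t : ℂ), Complex.norm_real, Real.norm_of_nonneg h0,
    ENNReal.ofReal_pow h0]

/-- An inequality of Fejér–Riesz type on the radius. -/
lemma HasTaylor.setLIntegral_radius_sq_le {f : ℂ → ℂ} {a : ℕ → ℂ} (h : HasTaylor f a) {s : ℝ}
    (hs : s ∈ Ioo (0 : ℝ) 1) :
    ∫⁻ t in Ioo 0 s, ‖f t‖ₑ ^ 2 ≤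
      17 * (ENNReal.ofReal s * ∑' n, ‖a n‖ₑ ^ 2 * ENNReal.ofReal (s ^ (2 * n))) := by
  calc ∫⁻ t in Ioo 0 s, ‖f t‖ₑ ^ 2
      ≤ ∫⁻ t in Ioo 0 s, ∑' n, ∑' m, ‖a n‖ₑ * ‖a m‖ₑ * ENNReal.ofReal (t ^ (n + m)) := by
        refine setLIntegral_mono' measurableSet_Ioo fun t ht => ?_
        calc ‖f t‖ₑ ^ 2 ≤ (∑' n, ‖a n‖ₑ * ENNReal.ofReal (t ^ n)) ^ 2 := by
              gcongr; exact h.enorm_radius_le ht.1.le (ht.2.trans hs.2)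
          _ = _ := by
              rw [sq, ← ENNReal.tsum_mul_right]
              refine tsum_congr fun n => ?_
              rw [← ENNReal.tsum_mul_left]
              refine tsum_congr fun m => ?_
              rw [pow_add, ENNReal.ofReal_mul (pow_nonneg ht.1.le _)]
              ring
    -- Integrating `t^(n+m)` over `(0,s)` produces the Hilbert matrix, with the powers of `s`
    -- absorbed into the coefficients.
    _ = ∑' n, ∑' m, ‖a n‖ₑ * ‖a m‖ₑ * ENNReal.ofReal (s ^ (n + m + 1) / (n + m + 1)) := by
        rw [lintegral_tsum (fun n => by fun_prop)]
        refine tsum_congr fun n => ?_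
        rw [lintegral_tsum (fun n => by fun_prop)]
        refine tsum_congr fun m => ?_
        rw [lintegral_const_mul _ (by fun_prop), setLIntegral_ofReal_pow hs.1.le]
        push_cast; rfl
    _ = ENNReal.ofReal s * ∑' n : ℕ, ∑' m : ℕ, (‖a n‖ₑ * ENNReal.ofReal (s ^ n)) *
          (‖a m‖ₑ * ENNReal.ofReal (s ^ m)) * ENNReal.ofReal (1 / (n + m + 1 : ℝ)) := by
        simp_rw [← ENNReal.tsum_mul_left]
        refine tsum_congr fun n => tsum_congr fun m => ?_
        have h1 : s ^ (n + m + 1) / (n + m + 1 : ℝ) = s * (s ^ n * (s ^ m * (1 / (n + m + 1 : ℝ)))) := by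
          rw [pow_succ, pow_add]; ring
        rw [h1, ENNReal.ofReal_mul hs.1.le, ENNReal.ofReal_mul (pow_nonneg hs.1.le _),
          ENNReal.ofReal_mul (pow_nonneg hs.1.le _)]
        ring
    _ ≤ ENNReal.ofReal s * (17 * ∑' n, (‖a n‖ₑ * ENNReal.ofReal (s ^ n)) ^ 2) := by
        gcongr; exact hilbert_inequality _
    _ = _ := by
        rw [mul_left_comm]
        congr 2
        refine tsum_congr fun n => ?_
        rw [mul_pow, ← ENNReal.ofReal_pow (pow_nonneg hs.1.le _), ← pow_mul, mul_comm n]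

lemma measurable_enorm_deriv_radius (f : ℂ → ℂ) : Measurable fun t : ℝ => ‖deriv f t‖ₑ :=
  ((measurable_deriv f).comp Complex.measurable_ofReal).enorm

/-- After exchanging the order of integration, the Fejér–Riesz inequality applies on each `(0,s)`,
and integrating its right side against `v(s)` reproduces the moments in the Dirichlet norm. -/
lemma IsRadialWeight.lintegral_deriv_radius_le (hv : IsRadialWeight v) {f : ℂ → ℂ} (hf : IsHol f) :
    ∫⁻ (t : ℝ) in Ioo 0 1, ‖deriv f t‖ₑ ^ 2 * vhat v t ≤ 17 * dirichletNorm v f ^ 2 := by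
  obtain ⟨a, h⟩ : ∃ a, HasTaylor f a := ⟨_, hf.hasTaylor⟩
  have hvm := hv.aemeasurable
  have hm := measurable_enorm_deriv_radius f
  unfold vhat
  rw [← setLIntegral_triangle_swap (a := fun s : ℝ => ENNReal.ofReal (v s))
    (b := fun t => ‖deriv f t‖ₑ ^ 2) hvm (by fun_prop)]
  calc ∫⁻ (s : ℝ) in Ioo 0 1, ENNReal.ofReal (v s) * ∫⁻ (t : ℝ) in Ioo 0 s, ‖deriv f t‖ₑ ^ 2
      ≤ ∫⁻ (s : ℝ) in Ioo 0 1, ∑' n : ℕ, 17 * (((n + 1 : ℕ) : ℝ≥0∞) ^ 2 * ‖a (n + 1)‖ₑ ^ 2) *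
          (ENNReal.ofReal (s ^ (2 * n + 1)) * ENNReal.ofReal (v s)) := by
        refine setLIntegral_mono' measurableSet_Ioo fun s hs => ?_
        calc _ ≤ ENNReal.ofReal (v s) * (17 * (ENNReal.ofReal s *
              ∑' n : ℕ, ‖(n + 1 : ℂ) * a (n + 1)‖ₑ ^ 2 * ENNReal.ofReal (s ^ (2 * n)))) := by
              gcongr; exact h.deriv.setLIntegral_radius_sq_le hs
          _ = _ := by
              simp_rw [← ENNReal.tsum_mul_left]
              refine tsum_congr fun n => ?_
              rw [enorm_succ_mul_sq, pow_succ s, ENNReal.ofReal_mul (pow_nonneg hs.1.le _)]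
              ring
    _ = ∑' n : ℕ, 17 * (((n + 1 : ℕ) : ℝ≥0∞) ^ 2 * ‖a (n + 1)‖ₑ ^ 2) *
          ∫⁻ (s : ℝ) in Ioo 0 1, (ENNReal.ofReal (s ^ (2 * n + 1)) * ENNReal.ofReal (v s)) := by
        rw [lintegral_tsum (fun n => by fun_prop)]
        exact tsum_congr fun n => lintegral_const_mul'' _ (by fun_prop)
    _ ≤ ∑' n : ℕ, 17 * (((n + 1 : ℕ) : ℝ≥0∞) ^ 2 * ‖a (n + 1)‖ₑ ^ 2) * moment v n := by
        gcongr with n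
        rw [moment]
        exact le_mul_of_one_le_left zero_le one_le_two
    _ = 17 * ∑' n : ℕ, (((n + 1 : ℕ) : ℝ≥0∞) ^ 2 * ‖a (n + 1)‖ₑ ^ 2) * moment v n := by
        rw [← ENNReal.tsum_mul_left]; simp_rw [mul_assoc]
    _ ≤ _ := by
        rw [hv.dirichletNorm_sq h]
        gcongr
        exact le_add_self

lemma IsHol.enorm_radius_le {f : ℂ → ℂ} (hf : IsHol f) {t : ℝ} (ht : t ∈ Ioo (0 : ℝ) 1) :
    ‖f t‖ₑ ≤ ‖f 0‖ₑ + ∫⁻ x in Ioo 0 t, ‖_root_.deriv f x‖ₑ := by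
  have hftc : ∫ x in (0 : ℝ)..t, _root_.deriv f x = f t - f (0 : ℝ) := by
    refine intervalIntegral.integral_eq_sub_of_hasDerivAt (f := fun x : ℝ => f x)
      (f' := fun x : ℝ => _root_.deriv f x) (fun x hx => ?_) ?_
    · rw [uIcc_of_le ht.1.le] at hx
      have := hf.differentiableAt (Metric.isOpen_ball.mem_nhds
        (ofReal_mem_unitDisc hx.1 (hx.2.trans_lt ht.2)))
      exact this.hasDerivAt.comp_ofReal
    · refine (hf.deriv.continuousOn_radius.mono ?_).intervalIntegrable
      rw [uIcc_of_le ht.1.le]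
      exact fun x hx => ⟨hx.1, hx.2.trans_lt ht.2⟩
  have h1 : f t = f 0 + ∫ x in (0 : ℝ)..t, _root_.deriv f x := by rw [hftc]; simp
  rw [h1]
  refine (enorm_add_le _ _).trans ?_
  gcongr
  rw [intervalIntegral.integral_of_le ht.1.le, integral_Ioc_eq_integral_Ioo]
  exact enorm_integral_le_lintegral_enorm _

lemma setLIntegral_ofReal_ne_zero {U : ℝ → ℝ} (hU : ContinuousOn U (Ioo 0 1))
    (hpos : ∀ t ∈ Ioo (0 : ℝ) 1, 0 < U t) {a b : ℝ} (ha : 0 ≤ a) (hab : a < b) (hb : b ≤ 1) :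
    ∫⁻ t in Ioo a b, ENNReal.ofReal (U t) ≠ 0 :=
  setLIntegral_Ioo_ne_zero hab
    ((hU.mono (Ioo_subset_Ioo ha hb)).aemeasurable measurableSet_Ioo).ennreal_ofReal
    fun x hx => by simpa using hpos x ⟨ha.trans_lt hx.1, hx.2.trans_le hb⟩

lemma IsRadialWeight.continuousOn_vtail_div (hv : IsRadialWeight v) (k : ℕ) :
    ContinuousOn (fun s => vtail v s / (1 - s) ^ k) (Ioo 0 1) :=
  hv.continuousOn_vtail.div (by fun_prop) fun s hs => pow_ne_zero _ (by linarith [hs.2])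

lemma IsRadialWeight.continuousOn_div_vtail (hv : IsRadialWeight v) (k : ℕ) :
    ContinuousOn (fun s => (1 - s) ^ k / vtail v s) (Ioo 0 1) :=
  ContinuousOn.div (by fun_prop) hv.continuousOn_vtail fun s hs => (hv.vtail_pos hs).ne'

lemma IsRadialWeight.vtail_div_pos (hv : IsRadialWeight v) (k : ℕ) {s : ℝ} (hs : s ∈ Ioo (0 : ℝ) 1) :
    0 < vtail v s / (1 - s) ^ k :=
  div_pos (hv.vtail_pos hs) (pow_pos (by linarith [hs.2]) _)

lemma IsRadialWeight.div_vtail_pos (hv : IsRadialWeight v) (k : ℕ) {s : ℝ} (hs : s ∈ Ioo (0 : ℝ) 1) :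
    0 < (1 - s) ^ k / vtail v s :=
  div_pos (pow_pos (by linarith [hs.2]) _) (hv.vtail_pos hs)

lemma IsRadialWeight.ofReal_vtail_div (hv : IsRadialWeight v) (k : ℕ) {s : ℝ} (hs : s ∈ Ioo (0 : ℝ) 1) :
    ENNReal.ofReal (vtail v s / (1 - s) ^ k) = vhat v s / ENNReal.ofReal ((1 - s) ^ k) := by
  rw [ENNReal.ofReal_div_of_pos (pow_pos (by linarith [hs.2]) _), hv.ofReal_vtail hs]

lemma IsRadialWeight.ofReal_div_vtail (hv : IsRadialWeight v) (k : ℕ) {s : ℝ} (hs : s ∈ Ioo (0 : ℝ) 1) :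
    ENNReal.ofReal ((1 - s) ^ k / vtail v s) = ENNReal.ofReal ((1 - s) ^ k) / vhat v s := by
  rw [ENNReal.ofReal_div_of_pos (hv.vtail_pos hs), hv.ofReal_vtail hs]

/-- The trivial power `(1 - s) ^ 0` is kept so that the lemmas on `(1 - s) ^ k / vtail v s` serve
both Muckenhoupt constants. -/
lemma IsRadialWeight.muckenhoupt₁_bound (hv : IsRadialWeight v) {r : ℝ} (hr : r ∈ Ioo (0 : ℝ) 1) :
    (∫⁻ s in Ioo r 1, ENNReal.ofReal (vtail v s / (1 - s) ^ 2)) ^ (1 / 2 : ℝ) *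
      (∫⁻ s in Ioo 0 r, ENNReal.ofReal ((1 - s) ^ 0 / vtail v s)) ^ (1 / 2 : ℝ) ≤
      muckenhoupt₁ v := by
  refine le_trans (le_of_eq ?_) (le_iSup₂_of_le (i := r) (j := hr) le_rfl)
  congr 2
  · exact setLIntegral_congr_fun measurableSet_Ioo fun s hs =>
      hv.ofReal_vtail_div 2 ⟨hr.1.trans hs.1, hs.2⟩
  · refine setLIntegral_congr_fun measurableSet_Ioo fun s hs => ?_
    simpa using hv.ofReal_div_vtail 0 ⟨hs.1, hs.2.trans hr.2⟩

lemma IsRadialWeight.muckenhoupt₂_bound (hv : IsRadialWeight v) {r : ℝ} (hr : r ∈ Ioo (0 : ℝ) 1) :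
    (∫⁻ s in Ioo 0 r, ENNReal.ofReal (vtail v s / (1 - s) ^ 4)) ^ (1 / 2 : ℝ) *
      (∫⁻ s in Ioo r 1, ENNReal.ofReal ((1 - s) ^ 2 / vtail v s)) ^ (1 / 2 : ℝ) ≤
      muckenhoupt₂ v := by
  refine le_trans (le_of_eq ?_) (le_iSup₂_of_le (i := r) (j := hr) le_rfl)
  congr 2
  · exact setLIntegral_congr_fun measurableSet_Ioo fun s hs =>
      hv.ofReal_vtail_div 4 ⟨hs.1, hs.2.trans hr.2⟩
  · exact setLIntegral_congr_fun measurableSet_Ioo fun s hs =>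
      hv.ofReal_div_vtail 2 ⟨hr.1.trans hs.1, hs.2⟩

lemma IsRadialWeight.muckenhoupt₁_ne_top (hv : IsRadialWeight v) (h₁ : muckenhoupt₁ v < ∞) {r : ℝ}
    (hr : r ∈ Ioo (0 : ℝ) 1) :
    ∫⁻ s in Ioo r 1, ENNReal.ofReal (vtail v s / (1 - s) ^ 2) ≠ ∞ ∧
      ∫⁻ s in Ioo 0 r, ENNReal.ofReal ((1 - s) ^ 0 / vtail v s) ≠ ∞ :=
  ENNReal.ne_top_of_rpow_half_mul_le h₁.ne
    (setLIntegral_ofReal_ne_zero (hv.continuousOn_vtail_div 2) (fun _ => hv.vtail_div_pos 2)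
      hr.1.le hr.2 le_rfl)
    (setLIntegral_ofReal_ne_zero (hv.continuousOn_div_vtail 0) (fun _ => hv.div_vtail_pos 0)
      le_rfl hr.1 hr.2.le) (hv.muckenhoupt₁_bound hr)

lemma IsRadialWeight.muckenhoupt₂_ne_top (hv : IsRadialWeight v) (h₂ : muckenhoupt₂ v < ∞) {r : ℝ}
    (hr : r ∈ Ioo (0 : ℝ) 1) :
    ∫⁻ s in Ioo 0 r, ENNReal.ofReal (vtail v s / (1 - s) ^ 4) ≠ ∞ ∧
      ∫⁻ s in Ioo r 1, ENNReal.ofReal ((1 - s) ^ 2 / vtail v s) ≠ ∞ :=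
  ENNReal.ne_top_of_rpow_half_mul_le h₂.ne
    (setLIntegral_ofReal_ne_zero (hv.continuousOn_vtail_div 4) (fun _ => hv.vtail_div_pos 4)
      le_rfl hr.1 hr.2.le)
    (setLIntegral_ofReal_ne_zero (hv.continuousOn_div_vtail 2) (fun _ => hv.div_vtail_pos 2)
      hr.1.le hr.2 le_rfl) (hv.muckenhoupt₂_bound hr)

lemma setLIntegral_Ioo_zero_one_ne_top {f : ℝ → ℝ≥0∞} (h0 : ∫⁻ s in Ioo 0 (3 / 4), f s ≠ ∞)
    (h1 : ∫⁻ s in Ioo (1 / 2) 1, f s ≠ ∞) : ∫⁻ s in Ioo (0 : ℝ) 1, f s ≠ ∞ := by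
  refine ne_top_of_le_ne_top (ENNReal.add_ne_top.2 ⟨h0, h1⟩) ?_
  refine (lintegral_mono_set fun s hs => ?_).trans (lintegral_union_le f (Ioo 0 (3 / 4)) (Ioo (1 / 2) 1))
  rcases lt_or_ge s (3 / 4) with h | h
  · exact .inl ⟨hs.1, h⟩
  · exact .inr ⟨by linarith, hs.2⟩

/-- Near `1` this is the first factor of `M₁`; near `0` the integrand is at most that of the first
factor of `M₂`. The overlapping intervals meet both endpoints. -/
lemma IsRadialWeight.lintegral_vtail_div_ne_top (hv : IsRadialWeight v) (h₁ : muckenhoupt₁ v < ∞)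
    (h₂ : muckenhoupt₂ v < ∞) :
    ∫⁻ s in Ioo 0 1, ENNReal.ofReal (vtail v s / (1 - s) ^ 2) ≠ ∞ := by
  refine setLIntegral_Ioo_zero_one_ne_top ?_
    (hv.muckenhoupt₁_ne_top h₁ (r := 1 / 2) ⟨by norm_num, by norm_num⟩).1
  refine ne_top_of_le_ne_top
    (hv.muckenhoupt₂_ne_top h₂ (r := 3 / 4) ⟨by norm_num, by norm_num⟩).1
    (setLIntegral_mono' measurableSet_Ioo fun s hs => ENNReal.ofReal_le_ofReal ?_)
  have hs1 : 0 < 1 - s := by linarith [hs.2]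
  have := hv.vtail_pos ⟨hs.1, by linarith [hs.2]⟩
  have hle : (1 - s) ^ 4 ≤ (1 - s) ^ 2 :=
    pow_le_pow_of_le_one hs1.le (by linarith [hs.1]) (by norm_num)
  gcongr

/-- Here the roles are reversed: the second factor of `M₂` serves near `1` and that of `M₁` near
`0`. -/
lemma IsRadialWeight.lintegral_div_vtail_ne_top (hv : IsRadialWeight v) (h₁ : muckenhoupt₁ v < ∞)
    (h₂ : muckenhoupt₂ v < ∞) :
    ∫⁻ s in Ioo 0 1, ENNReal.ofReal ((1 - s) ^ 2 / vtail v s) ≠ ∞ := by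
  refine setLIntegral_Ioo_zero_one_ne_top ?_
    (hv.muckenhoupt₂_ne_top h₂ (r := 1 / 2) ⟨by norm_num, by norm_num⟩).2
  refine ne_top_of_le_ne_top
    (hv.muckenhoupt₁_ne_top h₁ (r := 3 / 4) ⟨by norm_num, by norm_num⟩).2
    (setLIntegral_mono' measurableSet_Ioo fun s hs => ENNReal.ofReal_le_ofReal ?_)
  have hs1 : 0 < 1 - s := by linarith [hs.2]
  have := hv.vtail_pos ⟨hs.1, by linarith [hs.2]⟩
  have hle : (1 - s) ^ 2 ≤ (1 - s) ^ 0 :=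
    pow_le_pow_of_le_one hs1.le (by linarith [hs.1]) (by norm_num)
  gcongr

/-- The radial restriction embeds `D_v` into a weighted `L²` space on `(0,1)`. -/
lemma IsRadialWeight.exists_radius_bound (hv : IsRadialWeight v) (h₁ : muckenhoupt₁ v < ∞) (h₂ : muckenhoupt₂ v < ∞) :
    ∃ C : ℝ≥0∞, C ≠ ∞ ∧ ∀ f, IsHol f →
      ∫⁻ (t : ℝ) in Ioo 0 1, ‖f t‖ₑ ^ 2 * ENNReal.ofReal (vtail v t / (1 - t) ^ 2) ≤
        C * dirichletNorm v f ^ 2 := by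
  set J := ∫⁻ s in Ioo 0 1, ENNReal.ofReal (vtail v s / (1 - s) ^ 2) with hJ
  have hUm : AEMeasurable (fun s => ENNReal.ofReal (vtail v s / (1 - s) ^ 2))
      (volume.restrict (Ioo 0 1)) :=
    ((hv.continuousOn_vtail_div 2).aemeasurable measurableSet_Ioo).ennreal_ofReal
  refine ⟨3 * J + 3 * (4 * muckenhoupt₁ v ^ 2 * 17), ?_, fun f hf => ?_⟩
  · have hJ1 : J ≠ ∞ := hv.lintegral_vtail_div_ne_top h₁ h₂
    exact ENNReal.add_ne_top.2 ⟨ENNReal.mul_ne_top (by simp) hJ1, ENNReal.mul_ne_top (by simp)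
      (ENNReal.mul_ne_top (ENNReal.mul_ne_top (by simp) (ENNReal.pow_ne_top h₁.ne)) (by simp))⟩
  have hm := measurable_enorm_deriv_radius f
  -- This is where `M₁` acts: it bounds the primitive of `|f'|` in `L²(vhat/(1-t)²)` by `|f'|` in
  -- `L²(vhat)`.
  have key := hardy_left (hv.continuousOn_vtail_div 2) (hv.continuousOn_div_vtail 0)
    (fun _ => hv.vtail_div_pos 2) (fun _ => hv.div_vtail_pos 0) h₁.ne
    (fun r hr => hv.muckenhoupt₁_bound hr) (φ := fun t => ‖deriv f t‖ₑ) hm.aemeasurable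
  have h0 : ‖f 0‖ₑ ^ 2 ≤ dirichletNorm v f ^ 2 := by
    rw [hv.dirichletNorm_sq hf.hasTaylor, hf.hasTaylor.apply_zero]
    exact le_self_add
  have hder : ∫⁻ (t : ℝ) in Ioo 0 1, ‖deriv f t‖ₑ ^ 2 / ENNReal.ofReal ((1 - t) ^ 0 / vtail v t) ≤
      17 * dirichletNorm v f ^ 2 := by
    refine le_trans (le_of_eq ?_) (hv.lintegral_deriv_radius_le hf)
    refine setLIntegral_congr_fun measurableSet_Ioo fun t ht => ?_
    rw [hv.ofReal_div_vtail 0 ht, pow_zero, ENNReal.ofReal_one, one_div, div_eq_mul_inv, inv_inv]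
  calc ∫⁻ (t : ℝ) in Ioo 0 1, ‖f t‖ₑ ^ 2 * ENNReal.ofReal (vtail v t / (1 - t) ^ 2)
      ≤ ∫⁻ (t : ℝ) in Ioo 0 1, (3 * ‖f 0‖ₑ ^ 2 * ENNReal.ofReal (vtail v t / (1 - t) ^ 2) +
          3 * (ENNReal.ofReal (vtail v t / (1 - t) ^ 2) * (∫⁻ x in Ioo 0 t, ‖deriv f x‖ₑ) ^ 2)) := by
        refine setLIntegral_mono' measurableSet_Ioo fun t ht => ?_
        calc _ ≤ (3 * ‖f 0‖ₑ ^ 2 + 3 * (∫⁻ x in Ioo 0 t, ‖deriv f x‖ₑ) ^ 2) *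
              ENNReal.ofReal (vtail v t / (1 - t) ^ 2) := by
              gcongr
              refine le_trans ?_ (ENNReal.add_sq_le _ _)
              gcongr
              exact hf.enorm_radius_le ht
          _ = _ := by ring
    _ = 3 * ‖f 0‖ₑ ^ 2 * J + 3 * ∫⁻ (t : ℝ) in Ioo 0 1, ENNReal.ofReal (vtail v t / (1 - t) ^ 2) *
          (∫⁻ x in Ioo 0 t, ‖deriv f x‖ₑ) ^ 2 := by
        rw [lintegral_add_left' (hUm.const_mul _), lintegral_const_mul'' _ hUm,
          lintegral_const_mul' _ _ (by simp)]
    _ ≤ 3 * dirichletNorm v f ^ 2 * J + 3 * (4 * muckenhoupt₁ v ^ 2 * (17 * dirichletNorm v f ^ 2)) := by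
        gcongr
        exact key.trans (by gcongr)
    _ = _ := by ring

/-- Cauchy–Schwarz with the weight and its reciprocal. As the reciprocal is integrable, the weighted
`L²` space embeds in `L¹(0,1)`. -/
lemma IsRadialWeight.lintegral_sq_le (hv : IsRadialWeight v) {φ : ℝ → ℝ≥0∞}
    (hφ : AEMeasurable φ (volume.restrict (Ioo 0 1))) :
    (∫⁻ t in Ioo 0 1, φ t) ^ 2 ≤ (∫⁻ s in Ioo 0 1, ENNReal.ofReal ((1 - s) ^ 2 / vtail v s)) *
      ∫⁻ t in Ioo 0 1, φ t ^ 2 * ENNReal.ofReal (vtail v t / (1 - t) ^ 2) := by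
  have hU : AEMeasurable (fun s => ENNReal.ofReal (vtail v s / (1 - s) ^ 2))
      (volume.restrict (Ioo 0 1)) :=
    ((hv.continuousOn_vtail_div 2).aemeasurable measurableSet_Ioo).ennreal_ofReal
  have hσ : AEMeasurable (fun s => ENNReal.ofReal ((1 - s) ^ 2 / vtail v s))
      (volume.restrict (Ioo 0 1)) :=
    ((hv.continuousOn_div_vtail 2).aemeasurable measurableSet_Ioo).ennreal_ofReal
  have h := lintegral_mul_sq_le (hσ.pow_const (1 / 2 : ℝ)) (hφ.mul (hU.pow_const (1 / 2 : ℝ)))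
  simp only [Pi.mul_apply, mul_pow, ENNReal.rpow_half_sq] at h
  refine le_trans (le_of_eq ?_) h
  congr 1
  refine setLIntegral_congr_fun measurableSet_Ioo fun t ht => ?_
  rw [mul_left_comm, ← ENNReal.mul_rpow_of_nonneg _ _ (by norm_num : (0 : ℝ) ≤ 1 / 2),
    ← ENNReal.ofReal_mul (hv.div_vtail_pos 2 ht).le]
  have h1 : 1 - t ≠ 0 := by linarith [ht.2]
  have h2 := (hv.vtail_pos ht).ne'
  have : (1 - t) ^ 2 / vtail v t * (vtail v t / (1 - t) ^ 2) = 1 := by field_simp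
  rw [this]; simp

/-! ### The integral operator with kernel `(1 - rt)⁻²`. -/

/-- Monotonicity of the tail suffices: the first integral is at most `vhat(r) (1-r)`, the second at
most `1/(vhat(r) (1-r))`. Consequently the part `t < r` of the kernel needs neither Muckenhoupt
condition. -/
lemma IsRadialWeight.hardy_tail_bound (hv : IsRadialWeight v) {r : ℝ} (hr : r ∈ Ioo (0 : ℝ) 1) :
    (∫⁻ s in Ioo r 1, ENNReal.ofReal (vtail v s / (1 - s) ^ 0)) ^ (1 / 2 : ℝ) *
      (∫⁻ s in Ioo 0 r, ENNReal.ofReal (1 / (vtail v s * (1 - s) ^ 2))) ^ (1 / 2 : ℝ) ≤ 1 := by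
  have hV := hv.vtail_pos hr
  have hr1 : 0 < 1 - r := by linarith [hr.2]
  have hanti : ∀ {s t}, s ∈ Ioo (0 : ℝ) 1 → t ∈ Ioo (0 : ℝ) 1 → s ≤ t → vtail v t ≤ vtail v s :=
    fun hs ht hst => ENNReal.toReal_mono (hv.vhat_ne_top hs) (vhat_antitone v hst)
  have h1 : ∫⁻ s in Ioo r 1, ENNReal.ofReal (vtail v s / (1 - s) ^ 0) ≤
      ENNReal.ofReal (vtail v r * (1 - r)) := by
    calc _ ≤ ∫⁻ s in Ioo r 1, ENNReal.ofReal (vtail v r) := by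
          refine setLIntegral_mono' measurableSet_Ioo fun s hs => ENNReal.ofReal_le_ofReal ?_
          rw [pow_zero, div_one]
          exact hanti hr ⟨hr.1.trans hs.1, hs.2⟩ hs.1.le
      _ = _ := by rw [setLIntegral_const, Real.volume_Ioo, ← ENNReal.ofReal_mul hV.le]
  have h2 : ∫⁻ s in Ioo 0 r, ENNReal.ofReal (1 / (vtail v s * (1 - s) ^ 2)) ≤
      ENNReal.ofReal (1 / (vtail v r * (1 - r))) := by
    have hderiv : ∀ s ∈ Icc 0 r, HasDerivAt (fun s : ℝ => (1 - s)⁻¹) (1 / (1 - s) ^ 2) s := by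
      intro s hs
      have := ((hasDerivAt_id s).const_sub 1).fun_inv (by simp; linarith [hs.2, hr.2])
      simpa using this
    have hc : ContinuousOn (fun s : ℝ => 1 / (1 - s) ^ 2) (Icc 0 r) :=
      ContinuousOn.div (by fun_prop) (by fun_prop)
        fun s hs => pow_ne_zero _ (by linarith [hs.2, hr.2])
    have hftc := intervalIntegral.integral_eq_sub_of_hasDerivAt (a := 0) (b := r)
      (f := fun s : ℝ => (1 - s)⁻¹) (f' := fun s => 1 / (1 - s) ^ 2)
      (by rwa [uIcc_of_le hr.1.le]) (ContinuousOn.intervalIntegrable (by rwa [uIcc_of_le hr.1.le]))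
    rw [intervalIntegral.integral_of_le hr.1.le, integral_Ioc_eq_integral_Ioo] at hftc
    calc _ ≤ ∫⁻ s in Ioo 0 r, ENNReal.ofReal (1 / vtail v r) * ENNReal.ofReal (1 / (1 - s) ^ 2) := by
          refine setLIntegral_mono' measurableSet_Ioo fun s hs => ?_
          have hs' : s ∈ Ioo (0 : ℝ) 1 := ⟨hs.1, hs.2.trans hr.2⟩
          have hs1 : 0 < 1 - s := by linarith [hs'.2]
          rw [← ENNReal.ofReal_mul (by positivity), ← one_div_mul_one_div]
          gcongr
          exact hanti hs' hr hs.2.le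
      _ = ENNReal.ofReal (1 / vtail v r) * ENNReal.ofReal ((1 - r)⁻¹ - (1 - 0)⁻¹) := by
          rw [lintegral_const_mul' _ _ ENNReal.ofReal_ne_top, ← hftc,
            ofReal_integral_eq_lintegral_ofReal]
          · exact hc.integrableOn_Icc.mono_set Ioo_subset_Icc_self
          · exact .of_forall fun s => by positivity
      _ ≤ _ := by
          rw [← ENNReal.ofReal_mul (by positivity), ← one_div_mul_one_div]
          gcongr
          simp
  rw [← ENNReal.mul_rpow_of_nonneg _ _ (by norm_num : (0 : ℝ) ≤ 1 / 2)]
  refine ENNReal.rpow_le_one ?_ (by norm_num)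
  calc _ ≤ ENNReal.ofReal (vtail v r * (1 - r)) * ENNReal.ofReal (1 / (vtail v r * (1 - r))) := by
        gcongr
    _ = 1 := by
        rw [← ENNReal.ofReal_mul (by positivity), mul_one_div_cancel (by positivity),
          ENNReal.ofReal_one]

lemma IsRadialWeight.continuousOn_inv_vtail_mul (hv : IsRadialWeight v) :
    ContinuousOn (fun s => 1 / (vtail v s * (1 - s) ^ 2)) (Ioo 0 1) :=
  continuousOn_const.div (hv.continuousOn_vtail.mul (by fun_prop)) fun s hs =>
    mul_ne_zero (hv.vtail_pos hs).ne' (pow_ne_zero _ (by linarith [hs.2]))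

/-- The maximal Hilbert-type operator with kernel `(1 - rt)⁻²` is bounded between weighted `L²`
spaces on `(0,1)`. -/
lemma IsRadialWeight.lintegral_kernel_le (hv : IsRadialWeight v) (h₂ : muckenhoupt₂ v < ∞) {φ : ℝ → ℝ≥0∞}
    (hφ : AEMeasurable φ (volume.restrict (Ioo 0 1))) :
    ∫⁻ r in Ioo 0 1, vhat v r *
        (∫⁻ t in Ioo 0 1, φ t * ENNReal.ofReal (1 / (1 - r * t) ^ 2)) ^ 2 ≤
      (3 * 4 + 3 * (4 * muckenhoupt₂ v ^ 2)) *
        ∫⁻ t in Ioo 0 1, φ t ^ 2 * ENNReal.ofReal (vtail v t / (1 - t) ^ 2) := by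
  set Q := ∫⁻ t in Ioo 0 1, φ t ^ 2 * ENNReal.ofReal (vtail v t / (1 - t) ^ 2) with hQ
  set ψ : ℝ → ℝ≥0∞ := fun t => φ t * ENNReal.ofReal (1 / (1 - t) ^ 2) with hψ
  have hψm : AEMeasurable ψ (volume.restrict (Ioo 0 1)) := hφ.mul (by fun_prop)
  have k1 := hardy_left (hv.continuousOn_vtail_div 0) hv.continuousOn_inv_vtail_mul
    (fun _ => hv.vtail_div_pos 0)
    (fun s hs => one_div_pos.2 (mul_pos (hv.vtail_pos hs) (pow_pos (by linarith [hs.2]) _)))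
    ENNReal.one_ne_top (fun r hr => hv.hardy_tail_bound hr) hψm
  have k2 := hardy_right (hv.continuousOn_vtail_div 4) (hv.continuousOn_div_vtail 2)
    (fun _ => hv.vtail_div_pos 4) (fun _ => hv.div_vtail_pos 2) h₂.ne
    (fun r hr => hv.muckenhoupt₂_bound hr) hφ
  have e1 : ∫⁻ t in Ioo 0 1, ψ t ^ 2 / ENNReal.ofReal (1 / (vtail v t * (1 - t) ^ 2)) = Q := by
    refine setLIntegral_congr_fun measurableSet_Ioo fun t ht => ?_
    have h1 : 0 < 1 - t := by linarith [ht.2]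
    have h2 := hv.vtail_pos ht
    rw [hψ, mul_pow, mul_div_assoc, ← ENNReal.ofReal_pow (by positivity),
      ← ENNReal.ofReal_div_of_pos (by positivity)]
    congr 2
    field_simp
  have e2 : ∫⁻ t in Ioo 0 1, φ t ^ 2 / ENNReal.ofReal ((1 - t) ^ 2 / vtail v t) = Q := by
    refine setLIntegral_congr_fun measurableSet_Ioo fun t ht => ?_
    have h1 : 0 < 1 - t := by linarith [ht.2]
    have h2 := hv.vtail_pos ht
    rw [div_eq_mul_inv, ← ENNReal.ofReal_inv_of_pos (by positivity), inv_div]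
  rw [e1] at k1
  rw [e2] at k2
  have hpt : ∀ r ∈ Ioo (0 : ℝ) 1, vhat v r *
      (∫⁻ t in Ioo 0 1, φ t * ENNReal.ofReal (1 / (1 - r * t) ^ 2)) ^ 2 ≤
      3 * (ENNReal.ofReal (vtail v r / (1 - r) ^ 0) * (∫⁻ t in Ioo 0 r, ψ t) ^ 2) +
      3 * (ENNReal.ofReal (vtail v r / (1 - r) ^ 4) * (∫⁻ t in Ioo r 1, φ t) ^ 2) := by
    intro r hr
    have hr1 : 0 < 1 - r := by linarith [hr.2]
    have hV := hv.vtail_pos hr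
    -- The kernel is at most `(1-t)⁻²` for `t < r`, which goes into `ψ`, and at most `(1-r)⁻²` for
    -- `t ≥ r`, whose square gives the power `4` in `M₂`.
    have hsplit : ∫⁻ t in Ioo 0 1, φ t * ENNReal.ofReal (1 / (1 - r * t) ^ 2) ≤
        (∫⁻ t in Ioo 0 r, ψ t) + ENNReal.ofReal (1 / (1 - r) ^ 2) * ∫⁻ t in Ioo r 1, φ t := by
      calc _ ≤ ∫⁻ t in Ioo 0 r ∪ Ico r 1, φ t * ENNReal.ofReal (1 / (1 - r * t) ^ 2) :=
            lintegral_mono_set fun t ht => (lt_or_ge t r).imp (fun h => ⟨ht.1, h⟩) fun h => ⟨h, ht.2⟩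
        _ ≤ (∫⁻ t in Ioo 0 r, φ t * ENNReal.ofReal (1 / (1 - r * t) ^ 2)) +
            ∫⁻ t in Ico r 1, φ t * ENNReal.ofReal (1 / (1 - r * t) ^ 2) := lintegral_union_le _ _ _
        _ ≤ _ := by
            rw [Measure.restrict_congr_set (Ioo_ae_eq_Ico (a := r) (b := (1 : ℝ))).symm,
              ← lintegral_const_mul' _ _ ENNReal.ofReal_ne_top]
            gcongr ?_ + ?_
            · refine setLIntegral_mono' measurableSet_Ioo fun t ht => ?_
              have : 0 < 1 - t := by linarith [ht.2, hr.2]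
              change _ ≤ φ t * ENNReal.ofReal (1 / (1 - t) ^ 2)
              gcongr
              nlinarith [ht.1, hr.2]
            · refine setLIntegral_mono' measurableSet_Ioo fun t ht => ?_
              rw [mul_comm]
              gcongr
              nlinarith [ht.2, hr.1]
    calc _ ≤ vhat v r * (3 * (∫⁻ t in Ioo 0 r, ψ t) ^ 2 +
          3 * (ENNReal.ofReal (1 / (1 - r) ^ 2) * ∫⁻ t in Ioo r 1, φ t) ^ 2) := by
          gcongr
          refine le_trans ?_ (ENNReal.add_sq_le _ _)
          gcongr
      _ = _ := by
          have : ENNReal.ofReal (vtail v r / (1 - r) ^ 4) =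
              vhat v r * ENNReal.ofReal (1 / (1 - r) ^ 2) ^ 2 := by
            rw [← hv.ofReal_vtail hr, ← ENNReal.ofReal_pow (by positivity),
              ← ENNReal.ofReal_mul hV.le]
            congr 1
            field_simp
          rw [this, pow_zero, div_one, hv.ofReal_vtail hr]
          ring
  have hm1 : AEMeasurable (fun r => 3 * (ENNReal.ofReal (vtail v r / (1 - r) ^ 0) *
      (∫⁻ t in Ioo 0 r, ψ t) ^ 2)) (volume.restrict (Ioo 0 1)) :=
    ((((hv.continuousOn_vtail_div 0).aemeasurable measurableSet_Ioo).ennreal_ofReal).mul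
      ((measurable_setLIntegral_Ioo_right _ _).pow_const 2).aemeasurable).const_mul _
  calc _ ≤ ∫⁻ r in Ioo 0 1,
        (3 * (ENNReal.ofReal (vtail v r / (1 - r) ^ 0) * (∫⁻ t in Ioo 0 r, ψ t) ^ 2) +
        3 * (ENNReal.ofReal (vtail v r / (1 - r) ^ 4) * (∫⁻ t in Ioo r 1, φ t) ^ 2)) :=
        setLIntegral_mono' measurableSet_Ioo hpt
    _ ≤ 3 * (4 * 1 ^ 2 * Q) + 3 * (4 * muckenhoupt₂ v ^ 2 * Q) := by
        rw [lintegral_add_left' hm1, lintegral_const_mul' _ _ (by simp),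
          lintegral_const_mul' _ _ (by simp)]
        gcongr
    _ = _ := by ring

/-! ### The Besov condition on Taylor coefficients. -/

/-- The Besov seminorm `sup_{0<r<1} (1-r)^{1/2} M₂(r, g')`. -/
def besovSeminorm (g : ℂ → ℂ) : ℝ≥0∞ :=
  ⨆ r ∈ Set.Ioo (0 : ℝ) 1, integralMean r (deriv g) * ENNReal.ofReal ((1 - r) ^ (1 / 2 : ℝ))

lemma ofReal_sqrt_sq {x : ℝ} (hx : 0 ≤ x) :
    ENNReal.ofReal (x ^ (1 / 2 : ℝ)) ^ 2 = ENNReal.ofReal x := by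
  rw [← ENNReal.ofReal_pow (by positivity), ← Real.rpow_natCast, ← Real.rpow_mul hx]
  norm_num

lemma tsum_mul_le_besovSeminorm_sq {g : ℂ → ℂ} {b : ℕ → ℂ} (h : HasTaylor (deriv g) b) {r : ℝ}
    (hr : r ∈ Ioo (0 : ℝ) 1) :
    (∑' n, ‖b n‖ₑ ^ 2 * ENNReal.ofReal (r ^ (2 * n))) * ENNReal.ofReal (1 - r) ≤
      besovSeminorm g ^ 2 := by
  rw [← h.integralMean_sq hr.1.le hr.2, ← ofReal_sqrt_sq (by linarith [hr.2] : 0 ≤ 1 - r),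
    ← mul_pow]
  gcongr
  exact le_iSup₂_of_le (i := r) (j := hr) le_rfl

/-- Each of the `n + 1` terms `ρ^k`, `k ≤ n`, of the geometric sum is at least `ρ^n`. -/
lemma succ_mul_pow_le {ρ : ℝ} (h0 : 0 ≤ ρ) (h1 : ρ < 1) (n : ℕ) :
    (n + 1) * ρ ^ n ≤ 1 / (1 - ρ) := by
  rw [le_div_iff₀ (by linarith)]
  calc (n + 1) * ρ ^ n * (1 - ρ) = (∑ _k ∈ Finset.range (n + 1), ρ ^ n) * (1 - ρ) := by simp
    _ ≤ (∑ k ∈ Finset.range (n + 1), ρ ^ k) * (1 - ρ) := by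
        refine mul_le_mul_of_nonneg_right (Finset.sum_le_sum fun k hk => ?_) (by linarith)
        exact pow_le_pow_of_le_one h0 h1.le (by simpa [Nat.lt_succ_iff] using hk)
    _ = 1 - ρ ^ (n + 1) := by rw [geom_sum_mul_neg]
    _ ≤ 1 := by linarith [pow_nonneg h0 (n + 1)]

/-- The radius `ρ = (7+x)/8` satisfies `1 - ρ = (1-x)/8`, and Bernoulli's inequality gives `x ≤ ρ⁵`.
Of the five powers of `ρ^n`, three absorb `(n+1)³` at a cost of `(8/(1-x))³`, and two remain as the
`ρ^(2n)` of the Besov condition. The factor `2` in `1024 = 2 * 8³` pays for the shift to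
`ρ^(2(n+1))`, since `2ρ² ≥ 1`. -/
lemma cube_mul_pow_le {x : ℝ} (h0 : 0 ≤ x) (h1 : x < 1) (n : ℕ) :
    ((n + 1 : ℕ) : ℝ) ^ 3 * x ^ n ≤ 1024 / (1 - x) ^ 3 * ((7 + x) / 8) ^ (2 * (n + 1)) := by
  have hδ : 0 < 1 - x := by linarith
  set ρ := (7 + x) / 8 with hρ
  have hρ0 : 7 / 8 ≤ ρ := by rw [hρ]; linarith
  have hρ1 : 1 - ρ = (1 - x) / 8 := by rw [hρ]; ring
  have hx : x ≤ ρ ^ 5 := by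
    have := one_add_mul_le_pow (a := -((1 - x) / 8)) (by linarith) 5
    have h2 : 1 + -((1 - x) / 8) = ρ := by rw [hρ]; ring
    rw [h2] at this
    push_cast at this
    linarith
  have hA : ((n + 1 : ℕ) : ℝ) * ρ ^ n ≤ 8 / (1 - x) := by
    have := succ_mul_pow_le (by linarith : 0 ≤ ρ) (by linarith) n
    rw [hρ1, one_div_div] at this
    push_cast; exact this
  calc ((n + 1 : ℕ) : ℝ) ^ 3 * x ^ n ≤ ((n + 1 : ℕ) : ℝ) ^ 3 * (ρ ^ 5) ^ n := by gcongr
    _ = (((n + 1 : ℕ) : ℝ) * ρ ^ n) ^ 3 * (ρ ^ n) ^ 2 := by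
        rw [← pow_mul, mul_comm 5 n, pow_mul, mul_pow, mul_assoc, ← pow_add]
    _ ≤ (8 / (1 - x)) ^ 3 * (2 * ρ ^ 2 * (ρ ^ n) ^ 2) := by
        have : 1 ≤ 2 * ρ ^ 2 := by nlinarith
        have h3 : (ρ ^ n) ^ 2 ≤ 2 * ρ ^ 2 * (ρ ^ n) ^ 2 := le_mul_of_one_le_left (by positivity) this
        gcongr
    _ = _ := by
        have e : ρ ^ (2 * (n + 1)) = ρ ^ 2 * (ρ ^ n) ^ 2 := by ring
        rw [div_pow, e]; ring

/-- Growth of the weighted power series whose coefficients have bounded averages. -/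
lemma tsum_cube_mul_le {c : ℕ → ℝ≥0∞} {B : ℝ≥0∞}
    (hc : ∀ ρ ∈ Ioo (0 : ℝ) 1,
      (∑' n, c n * ENNReal.ofReal (ρ ^ (2 * n))) * ENNReal.ofReal (1 - ρ) ≤ B)
    {x : ℝ} (h0 : 0 ≤ x) (h1 : x < 1) :
    ∑' n : ℕ, ((n + 1 : ℕ) : ℝ≥0∞) ^ 3 * c (n + 1) * ENNReal.ofReal (x ^ n) ≤
      ENNReal.ofReal 8192 * B * ENNReal.ofReal (1 / (1 - x) ^ 4) := by
  have hδ : 0 < 1 - x := by linarith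
  set ρ := (7 + x) / 8 with hρ
  -- The Besov bound at this `ρ` costs one more factor `8/(1-x)`; hence `8192 = 8 * 1024` and the
  -- fourth power.
  have hS := hc ρ ⟨by rw [hρ]; linarith, by rw [hρ]; linarith⟩
  set S := ∑' n, c n * ENNReal.ofReal (ρ ^ (2 * n)) with hSdef
  have hS' : S ≤ ENNReal.ofReal (8 / (1 - x)) * B := by
    have e : 1 - ρ = (1 - x) / 8 := by rw [hρ]; ring
    rw [e] at hS
    calc S = ENNReal.ofReal (8 / (1 - x)) * (S * ENNReal.ofReal ((1 - x) / 8)) := by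
          rw [mul_left_comm, ← ENNReal.ofReal_mul (by positivity)]
          have : 8 / (1 - x) * ((1 - x) / 8) = 1 := by field_simp
          rw [this]; simp
      _ ≤ _ := by gcongr
  calc ∑' n : ℕ, ((n + 1 : ℕ) : ℝ≥0∞) ^ 3 * c (n + 1) * ENNReal.ofReal (x ^ n)
      ≤ ∑' n : ℕ, ENNReal.ofReal (1024 / (1 - x) ^ 3) *
          (c (n + 1) * ENNReal.ofReal (ρ ^ (2 * (n + 1)))) := by
        refine ENNReal.tsum_le_tsum fun n => ?_
        have h2 : ((n + 1 : ℕ) : ℝ≥0∞) ^ 3 * ENNReal.ofReal (x ^ n) ≤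
            ENNReal.ofReal (1024 / (1 - x) ^ 3) * ENNReal.ofReal (ρ ^ (2 * (n + 1))) := by
          rw [← ENNReal.ofReal_natCast, ← ENNReal.ofReal_pow (by positivity),
            ← ENNReal.ofReal_mul (by positivity), ← ENNReal.ofReal_mul (by positivity)]
          exact ENNReal.ofReal_le_ofReal (cube_mul_pow_le h0 h1 n)
        calc _ = c (n + 1) * (((n + 1 : ℕ) : ℝ≥0∞) ^ 3 * ENNReal.ofReal (x ^ n)) := by
              rw [mul_comm _ (c (n + 1)), mul_assoc]
          _ ≤ c (n + 1) * (ENNReal.ofReal (1024 / (1 - x) ^ 3) *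
              ENNReal.ofReal (ρ ^ (2 * (n + 1)))) := by gcongr
          _ = _ := mul_left_comm _ _ _
    _ ≤ ENNReal.ofReal (1024 / (1 - x) ^ 3) * S := by
        rw [ENNReal.tsum_mul_left]
        gcongr
        exact ENNReal.tsum_comp_le_tsum_of_injective Nat.succ_injective
          fun n => c n * ENNReal.ofReal (ρ ^ (2 * n))
    _ ≤ ENNReal.ofReal (1024 / (1 - x) ^ 3) * (ENNReal.ofReal (8 / (1 - x)) * B) := by gcongr
    _ = _ := by
        have e : 1024 / (1 - x) ^ 3 * (8 / (1 - x)) = 8192 * (1 / (1 - x) ^ 4) := by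
          field_simp
          norm_num
        rw [← mul_assoc, ← ENNReal.ofReal_mul (by positivity), e, ENNReal.ofReal_mul (by norm_num)]
        exact mul_right_comm _ _ _

/-- Since `r²ts = (rt)(rs)` is at most each of `rt` and `rs`, the quantity `1 - r²ts` dominates both
`1 - rt` and `1 - rs`. This separates the variables `t` and `s`. -/
lemma one_div_pow_four_le_kernel {r s t : ℝ} (hr : r ∈ Ioo (0 : ℝ) 1) (hs : s ∈ Ioo (0 : ℝ) 1)
    (ht : t ∈ Ioo (0 : ℝ) 1) :
    1 / (1 - r ^ 2 * (t * s)) ^ 4 ≤ 1 / (1 - r * t) ^ 2 * (1 / (1 - r * s) ^ 2) := by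
  have hrt : r * t < 1 := by nlinarith [hr.1, hr.2, ht.1, ht.2]
  have hrs : r * s < 1 := by nlinarith [hr.1, hr.2, hs.1, hs.2]
  have hrt0 : 0 < r * t := mul_pos hr.1 ht.1
  have hrs0 : 0 < r * s := mul_pos hr.1 hs.1
  have e : r ^ 2 * (t * s) = (r * t) * (r * s) := by ring
  have h1 : 1 - r * t ≤ 1 - r ^ 2 * (t * s) := by rw [e]; nlinarith
  have h2 : 1 - r * s ≤ 1 - r ^ 2 * (t * s) := by rw [e]; nlinarith
  rw [one_div_mul_one_div]
  have h3 : 0 < 1 - r * t := by linarith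
  have h4 : 0 < 1 - r * s := by linarith
  refine one_div_le_one_div_of_le (by positivity) ?_
  calc (1 - r * t) ^ 2 * (1 - r * s) ^ 2 ≤ (1 - r ^ 2 * (t * s)) ^ 2 * (1 - r ^ 2 * (t * s)) ^ 2 := by
        gcongr
    _ = _ := by ring

/-- The quadratic form of the kernel at a fixed radius. -/
lemma tsum_moment_sq_le {c : ℕ → ℝ≥0∞} {B : ℝ≥0∞}
    (hc : ∀ ρ ∈ Ioo (0 : ℝ) 1,
      (∑' n, c n * ENNReal.ofReal (ρ ^ (2 * n))) * ENNReal.ofReal (1 - ρ) ≤ B)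
    {φ : ℝ → ℝ≥0∞} (hφ : AEMeasurable φ (volume.restrict (Ioo 0 1))) {r : ℝ}
    (hr : r ∈ Ioo (0 : ℝ) 1) :
    ∑' n : ℕ, ((n + 1 : ℕ) : ℝ≥0∞) ^ 3 * c (n + 1) * ENNReal.ofReal (r ^ (2 * n)) *
        (∫⁻ t in Ioo 0 1, φ t * ENNReal.ofReal (t ^ n)) ^ 2 ≤
      ENNReal.ofReal 8192 * B * (∫⁻ t in Ioo 0 1, φ t * ENNReal.ofReal (1 / (1 - r * t) ^ 2)) ^ 2 := by
  set I : Measure ℝ := volume.restrict (Ioo 0 1)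
  have hmem : ∀ᵐ t ∂I, t ∈ Ioo (0 : ℝ) 1 := ae_restrict_mem measurableSet_Ioo
  set K : ℝ → ℝ → ℝ≥0∞ := fun t s => ∑' n : ℕ, ((n + 1 : ℕ) : ℝ≥0∞) ^ 3 * c (n + 1) *
    ENNReal.ofReal (r ^ (2 * n)) * (φ t * ENNReal.ofReal (t ^ n) * (φ s * ENNReal.ofReal (s ^ n)))
    with hK
  have hsq : ∀ n : ℕ, (∫⁻ t, φ t * ENNReal.ofReal (t ^ n) ∂I) ^ 2 =
      ∫⁻ t, ∫⁻ s, φ t * ENNReal.ofReal (t ^ n) * (φ s * ENNReal.ofReal (s ^ n)) ∂I ∂I := by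
    intro n
    have hm : AEMeasurable (fun t => φ t * ENNReal.ofReal (t ^ n)) I := hφ.mul (by fun_prop)
    rw [sq, ← lintegral_mul_const'' _ hm]
    exact lintegral_congr fun t => (lintegral_const_mul'' _ hm).symm
  have hLHS : ∑' n : ℕ, ((n + 1 : ℕ) : ℝ≥0∞) ^ 3 * c (n + 1) * ENNReal.ofReal (r ^ (2 * n)) *
      (∫⁻ t, φ t * ENNReal.ofReal (t ^ n) ∂I) ^ 2 = ∫⁻ t, ∫⁻ s, K t s ∂I ∂I := by
    simp_rw [hK]
    have hms : ∀ n : ℕ, AEMeasurable (fun s => φ s * ENNReal.ofReal (s ^ n)) I :=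
      fun n => hφ.mul (by fun_prop)
    have h1 : ∀ t, ∫⁻ s, ∑' n : ℕ, ((n + 1 : ℕ) : ℝ≥0∞) ^ 3 * c (n + 1) *
        ENNReal.ofReal (r ^ (2 * n)) * (φ t * ENNReal.ofReal (t ^ n) * (φ s * ENNReal.ofReal (s ^ n)))
        ∂I = ∑' n : ℕ, ((n + 1 : ℕ) : ℝ≥0∞) ^ 3 * c (n + 1) * ENNReal.ofReal (r ^ (2 * n)) *
          ∫⁻ s, φ t * ENNReal.ofReal (t ^ n) * (φ s * ENNReal.ofReal (s ^ n)) ∂I := by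
      intro t
      rw [lintegral_tsum (fun n => ((hms n).const_mul _).const_mul _)]
      exact tsum_congr fun n => lintegral_const_mul'' _ ((hms n).const_mul _)
    have h2 : ∀ n : ℕ, AEMeasurable (fun t => ∫⁻ s, φ t * ENNReal.ofReal (t ^ n) *
        (φ s * ENNReal.ofReal (s ^ n)) ∂I) I := by
      intro n
      simp_rw [lintegral_const_mul'' _ (hms n)]
      exact (hms n).mul_const _
    simp_rw [h1]
    rw [lintegral_tsum (fun n => (h2 n).const_mul _)]
    refine tsum_congr fun n => ?_
    rw [lintegral_const_mul'' _ (h2 n), hsq]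
  set G : ℝ → ℝ≥0∞ := fun t => φ t * ENNReal.ofReal (1 / (1 - r * t) ^ 2)
  have hG : AEMeasurable G I := hφ.mul (by fun_prop)
  rw [hLHS]
  calc ∫⁻ t, ∫⁻ s, K t s ∂I ∂I ≤ ∫⁻ t, ∫⁻ s, ENNReal.ofReal 8192 * B * G t * G s ∂I ∂I := by
        refine lintegral_mono_ae ?_
        filter_upwards [hmem] with t ht
        refine lintegral_mono_ae ?_
        filter_upwards [hmem] with s hs
        have hx0 : 0 ≤ r ^ 2 * (t * s) := by have := hr.1; have := ht.1; have := hs.1; positivity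
        have hx1 : r ^ 2 * (t * s) < 1 := by
          have h1 : t * s < 1 := by nlinarith [ht.1, ht.2, hs.1, hs.2]
          have h2 : r ^ 2 < 1 := by nlinarith [hr.1, hr.2]
          have h3 : 0 < t * s := mul_pos ht.1 hs.1
          nlinarith
        calc K t s = φ t * φ s * ∑' n : ℕ, ((n + 1 : ℕ) : ℝ≥0∞) ^ 3 * c (n + 1) *
              ENNReal.ofReal ((r ^ 2 * (t * s)) ^ n) := by
              rw [hK, ← ENNReal.tsum_mul_left]
              refine tsum_congr fun n => ?_
              rw [mul_pow, mul_pow, ← pow_mul, ENNReal.ofReal_mul (pow_nonneg hr.1.le _),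
                ENNReal.ofReal_mul (pow_nonneg ht.1.le _)]
              ring
          _ ≤ φ t * φ s * (ENNReal.ofReal 8192 * B * ENNReal.ofReal (1 / (1 - r ^ 2 * (t * s)) ^ 4)) := by
              gcongr; exact tsum_cube_mul_le hc hx0 hx1
          _ ≤ φ t * φ s * (ENNReal.ofReal 8192 * B * (ENNReal.ofReal (1 / (1 - r * t) ^ 2) *
              ENNReal.ofReal (1 / (1 - r * s) ^ 2))) := by
              gcongr
              rw [← ENNReal.ofReal_mul (by positivity)]
              exact ENNReal.ofReal_le_ofReal (one_div_pow_four_le_kernel hr hs ht)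
          _ = ENNReal.ofReal 8192 * B * G t * G s := by simp only [G]; ring
    _ = _ := by
        simp_rw [lintegral_const_mul'' _ hG]
        rw [lintegral_mul_const'' _ (hG.const_mul _), lintegral_const_mul'' _ hG]
        ring

/-! ### Taylor expansion of the operator and the upper estimate. -/

/-- The moments `∫_0^1 t^n f(t) dt`. -/
def radialMoment (f : ℂ → ℂ) (n : ℕ) : ℂ := ∫ t in (0 : ℝ)..1, f t * (t : ℂ) ^ n

lemma radialMoment_enorm_le (f : ℂ → ℂ) (n : ℕ) :
    ‖radialMoment f n‖ₑ ≤ ∫⁻ t : ℝ in Ioo 0 1, ‖f t‖ₑ * ENNReal.ofReal (t ^ n) := by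
  rw [radialMoment, intervalIntegral.integral_of_le zero_le_one, integral_Ioc_eq_integral_Ioo]
  refine (enorm_integral_le_lintegral_enorm _).trans_eq ?_
  refine setLIntegral_congr_fun measurableSet_Ioo fun t ht => ?_
  rw [enorm_mul, enorm_pow, ← ofReal_norm (t : ℂ), Complex.norm_real, Real.norm_of_nonneg ht.1.le,
    ENNReal.ofReal_pow ht.1.le]

lemma IsHol.aemeasurable_radius {f : ℂ → ℂ} (hf : IsHol f) :
    AEMeasurable (fun t : ℝ => ‖f t‖ₑ) (volume.restrict (Ioo 0 1)) :=
  ((hf.continuousOn_radius.mono Ioo_subset_Ico_self).aemeasurable measurableSet_Ioo).enorm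

lemma IsHol.integrableOn_radius {f : ℂ → ℂ} (hf : IsHol f)
    (h : ∫⁻ t : ℝ in Ioo 0 1, ‖f t‖ₑ ≠ ∞) : IntegrableOn (fun t : ℝ => f t) (Ioc 0 1) := by
  rw [integrableOn_Ioc_iff_integrableOn_Ioo]
  exact ⟨(hf.continuousOn_radius.mono Ioo_subset_Ico_self).aestronglyMeasurable measurableSet_Ioo,
    lt_top_iff_ne_top.2 h⟩

lemma genHilbert_integrable {f g : ℂ → ℂ} (hf : IsHol f) (hg : IsHol g)
    (h : ∫⁻ t : ℝ in Ioo 0 1, ‖f t‖ₑ ≠ ∞) {z : ℂ} (hz : z ∈ unitDisc) :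
    IntervalIntegrable (fun t : ℝ => f t * deriv g (t * z)) volume 0 1 := by
  rw [intervalIntegrable_iff_integrableOn_Icc_of_le zero_le_one]
  refine IntegrableOn.mul_continuousOn ?_ ?_ isCompact_Icc
  · rw [integrableOn_Icc_iff_integrableOn_Ioc]
    exact hf.integrableOn_radius h
  · refine hg.deriv.continuousOn.comp (by fun_prop) fun t ht => ?_
    rw [mem_unitDisc] at hz ⊢
    rw [norm_mul, Complex.norm_real, Real.norm_of_nonneg ht.1]
    exact (mul_le_of_le_one_left (norm_nonneg _) ht.2).trans_lt hz

/-- The series of `g'(tz)` may be integrated termwise against `f`, because its terms are dominated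
by `|b n| |z|^n |f(t)|`, with `f` integrable on the radius. Thus `H_g` acts on `f` through its
radial moments, multiplied by the coefficients of `g'`. -/
lemma genHilbert_hasTaylor {f g : ℂ → ℂ} {b : ℕ → ℂ} (hf : IsHol f) (hb : HasTaylor (deriv g) b)
    (h : ∫⁻ t : ℝ in Ioo 0 1, ‖f t‖ₑ ≠ ∞) :
    HasTaylor (genHilbert g f) (fun n => b n * radialMoment f n) := by
  intro z hz
  rw [mem_unitDisc] at hz
  have hfi := hf.integrableOn_radius h
  have hint : ∀ n : ℕ, IntegrableOn (fun t : ℝ => f t * (t : ℂ) ^ n) (Ioc 0 1) := by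
    intro n
    have := IntegrableOn.mul_continuousOn (g := fun t : ℝ => f t) (g' := fun t : ℝ => (t : ℂ) ^ n)
      (K := Icc (0 : ℝ) 1) (μ := volume) (by rwa [integrableOn_Icc_iff_integrableOn_Ioc]) (by fun_prop) isCompact_Icc
    rwa [integrableOn_Icc_iff_integrableOn_Ioc] at this
  have hsum := hasSum_integral_of_summable_integral_norm
    (F := fun (n : ℕ) (t : ℝ) => b n * z ^ n * (f t * (t : ℂ) ^ n))
    (μ := volume.restrict (Ioc 0 1)) (fun n => (hint n).const_mul _) (by
      refine Summable.of_nonneg_of_le (fun n => integral_nonneg fun t => norm_nonneg _) (fun n => ?_)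
        ((hb.summable_norm (norm_nonneg z) hz).mul_right (∫ t : ℝ in Ioc 0 1, ‖f t‖))
      simp_rw [norm_mul (b n * z ^ n)]
      rw [integral_const_mul, norm_mul, norm_pow]
      refine mul_le_mul_of_nonneg_left ?_ (by positivity)
      refine setIntegral_mono_on (hint n).norm hfi.norm measurableSet_Ioc fun t ht => ?_
      rw [norm_mul, norm_pow, Complex.norm_real, Real.norm_of_nonneg ht.1.le]
      exact mul_le_of_le_one_right (norm_nonneg _) (pow_le_one₀ ht.1.le ht.2))
  have e1 : ∀ n : ℕ, ∫ t : ℝ in Ioc 0 1, b n * z ^ n * (f t * (t : ℂ) ^ n) =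
      b n * radialMoment f n * z ^ n := by
    intro n
    rw [integral_const_mul, radialMoment, intervalIntegral.integral_of_le zero_le_one]
    ring
  have e2 : genHilbert g f z = ∫ t : ℝ in Ioc 0 1, ∑' n : ℕ, b n * z ^ n * (f t * (t : ℂ) ^ n) := by
    rw [genHilbert, intervalIntegral.integral_of_le zero_le_one]
    refine setIntegral_congr_fun measurableSet_Ioc fun t ht => ?_
    have htz : (t : ℂ) * z ∈ unitDisc := by
      rw [mem_unitDisc, norm_mul, Complex.norm_real, Real.norm_of_nonneg ht.1.le]
      exact (mul_le_of_le_one_left (norm_nonneg _) ht.2).trans_lt hz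
    refine (HasSum.tsum_eq (((hb _ htz).mul_left (f t)).congr_fun fun n => ?_)).symm
    ring
  simp_rw [e1] at hsum
  rw [e2]
  exact hsum

/-- The upper estimate for the generalized Hilbert operator. -/
theorem IsRadialWeight.exists_upper_bound (hv : IsRadialWeight v) (h₁ : muckenhoupt₁ v < ∞)
    (h₂ : muckenhoupt₂ v < ∞) :
    ∃ C : ℝ≥0∞, C ≠ ∞ ∧ ∀ g, IsHol g → ∀ f, f ∈ dirichletSpace v →
      dirichletNorm v (genHilbert g f) ^ 2 ≤ C * besovSeminorm g ^ 2 * dirichletNorm v f ^ 2 := by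
  obtain ⟨C₀, hC₀, hrad⟩ := hv.exists_radius_bound h₁ h₂
  set J := ∫⁻ s in Ioo 0 1, ENNReal.ofReal ((1 - s) ^ 2 / vtail v s)
  have hJ : J ≠ ∞ := hv.lintegral_div_vtail_ne_top h₁ h₂
  set κ : ℝ≥0∞ := 3 * 4 + 3 * (4 * muckenhoupt₂ v ^ 2)
  have hκ : κ ≠ ∞ := ENNReal.add_ne_top.2 ⟨by finiteness, ENNReal.mul_ne_top (by simp)
    (ENNReal.mul_ne_top (by simp) (ENNReal.pow_ne_top h₂.ne))⟩
  set m : ℝ≥0∞ := ENNReal.ofReal 8192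
  refine ⟨2 * J * C₀ + 4 * m * κ * C₀, ENNReal.add_ne_top.2 ⟨ENNReal.mul_ne_top
    (ENNReal.mul_ne_top (by simp) hJ) hC₀, ENNReal.mul_ne_top (ENNReal.mul_ne_top
    (ENNReal.mul_ne_top (by simp) ENNReal.ofReal_ne_top) hκ) hC₀⟩, fun g hg f hf => ?_⟩
  obtain ⟨b, hb⟩ : ∃ b, HasTaylor (deriv g) b := ⟨_, hg.deriv.hasTaylor⟩
  have hφ := hf.1.aemeasurable_radius
  set φ : ℝ → ℝ≥0∞ := fun t => ‖f t‖ₑ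
  set Q := ∫⁻ t in Ioo 0 1, φ t ^ 2 * ENNReal.ofReal (vtail v t / (1 - t) ^ 2)
  set B := besovSeminorm g ^ 2
  have hQ : Q ≤ C₀ * dirichletNorm v f ^ 2 := hrad f hf.1
  have hQtop : Q ≠ ∞ := ne_top_of_le_ne_top (ENNReal.mul_ne_top hC₀ (ENNReal.pow_ne_top hf.2.ne)) hQ
  have hΦ : (∫⁻ t in Ioo 0 1, φ t) ^ 2 ≤ J * Q := hv.lintegral_sq_le hφ
  have hΦtop : ∫⁻ t in Ioo 0 1, φ t ≠ ∞ := fun h => by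
    rw [h, ENNReal.top_pow two_ne_zero] at hΦ
    exact ENNReal.mul_ne_top hJ hQtop (top_le_iff.1 hΦ)
  have hc : ∀ ρ ∈ Ioo (0 : ℝ) 1,
      (∑' n, ‖b n‖ₑ ^ 2 * ENNReal.ofReal (ρ ^ (2 * n))) * ENNReal.ofReal (1 - ρ) ≤ B :=
    fun ρ hρ => tsum_mul_le_besovSeminorm_sq hb hρ
  set Λ : ℕ → ℝ≥0∞ := fun n => ∫⁻ t in Ioo 0 1, φ t * ENNReal.ofReal (t ^ n)
  have hΛ : ∀ n, ‖radialMoment f n‖ₑ ≤ Λ n := radialMoment_enorm_le f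
  -- The coefficient of index `n + 1` is paired with `moment v n`. Lowering the index of `Λ` matches
  -- the powers, so that the summand contains exactly `(r²ts)^n`.
  have hΛmono : ∀ n, Λ (n + 1) ≤ Λ n := fun n =>
    setLIntegral_mono' measurableSet_Ioo fun t ht => by
      refine mul_le_mul_right (ENNReal.ofReal_le_ofReal ?_) _
      exact pow_le_pow_of_le_one ht.1.le ht.2.le n.le_succ
  have hvm : Measurable (vhat v) := (vhat_antitone v).measurable
  rw [hv.dirichletNorm_sq (genHilbert_hasTaylor hf.1 hb hΦtop)]
  have hfirst : ‖b 0 * radialMoment f 0‖ₑ ^ 2 ≤ 2 * B * (J * Q) := by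
    -- The constant coefficient is read off from the Besov bound at radius `1/2`.
    have hb0 : ‖b 0‖ₑ ^ 2 ≤ 2 * B := by
      calc ‖b 0‖ₑ ^ 2 = 2 * (‖b 0‖ₑ ^ 2 * ENNReal.ofReal ((1 / 2) ^ (2 * 0)) *
            ENNReal.ofReal (1 - 1 / 2)) := by
            have : ENNReal.ofReal (1 - 1 / 2) = 2⁻¹ := by
              rw [← ENNReal.ofReal_ofNat 2, ← ENNReal.ofReal_inv_of_pos two_pos]; norm_num
            rw [this, mul_zero, pow_zero, ENNReal.ofReal_one, mul_one, mul_left_comm,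
              ENNReal.mul_inv_cancel (by simp) (by simp), mul_one]
        _ ≤ 2 * B := by
            gcongr
            refine le_trans ?_ (hc (1 / 2) ⟨by norm_num, by norm_num⟩)
            gcongr
            exact ENNReal.le_tsum (f := fun n => ‖b n‖ₑ ^ 2 * ENNReal.ofReal ((1 / 2) ^ (2 * n))) 0
    rw [enorm_mul, mul_pow]
    gcongr
    refine le_trans ?_ hΦ
    gcongr
    simpa [Λ] using hΛ 0
  have hsecond : ∑' n : ℕ, ((n + 1 : ℕ) : ℝ≥0∞) ^ 2 * ‖b (n + 1) * radialMoment f (n + 1)‖ₑ ^ 2 *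
      moment v n ≤ 4 * m * B * (κ * Q) := by
    calc _ ≤ ∑' n : ℕ, ∫⁻ r in Ioo 0 1, 4 * vhat v r * (((n + 1 : ℕ) : ℝ≥0∞) ^ 3 *
            ‖b (n + 1)‖ₑ ^ 2 * ENNReal.ofReal (r ^ (2 * n)) * Λ n ^ 2) := by
          refine ENNReal.tsum_le_tsum fun n => ?_
          have hn : ((2 * n + 1 : ℕ) : ℝ≥0∞) ≤ 2 * ((n + 1 : ℕ) : ℝ≥0∞) := by
            exact_mod_cast (by omega : 2 * n + 1 ≤ 2 * (n + 1))
          calc _ ≤ ((n + 1 : ℕ) : ℝ≥0∞) ^ 2 * (‖b (n + 1)‖ₑ ^ 2 * Λ n ^ 2) *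
                (2 * (2 * ((n + 1 : ℕ) : ℝ≥0∞)) *
                  ∫⁻ r in Ioo 0 1, ENNReal.ofReal (r ^ (2 * n)) * vhat v r) := by
                rw [hv.moment_eq, enorm_mul, mul_pow]
                gcongr
                exact (hΛ _).trans (hΛmono n)
            _ = (4 * (((n + 1 : ℕ) : ℝ≥0∞) ^ 3 * ‖b (n + 1)‖ₑ ^ 2 * Λ n ^ 2)) *
                  ∫⁻ r in Ioo 0 1, ENNReal.ofReal (r ^ (2 * n)) * vhat v r := by ring
            _ = _ := by
                rw [← lintegral_const_mul _ (by fun_prop)]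
                refine lintegral_congr fun r => ?_
                ring
      _ = ∫⁻ r in Ioo 0 1, 4 * vhat v r * ∑' n : ℕ, (((n + 1 : ℕ) : ℝ≥0∞) ^ 3 *
            ‖b (n + 1)‖ₑ ^ 2 * ENNReal.ofReal (r ^ (2 * n)) * Λ n ^ 2) := by
          rw [← lintegral_tsum (fun n => by fun_prop)]
          simp_rw [ENNReal.tsum_mul_left]
      _ ≤ ∫⁻ r in Ioo 0 1, 4 * m * B * (vhat v r *
            (∫⁻ t in Ioo 0 1, φ t * ENNReal.ofReal (1 / (1 - r * t) ^ 2)) ^ 2) := by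
          refine setLIntegral_mono' measurableSet_Ioo fun r hr => ?_
          calc _ ≤ 4 * vhat v r * (m * B *
                (∫⁻ t in Ioo 0 1, φ t * ENNReal.ofReal (1 / (1 - r * t) ^ 2)) ^ 2) := by
                gcongr
                exact tsum_moment_sq_le hc hφ hr
            _ = _ := by ring
      _ ≤ 4 * m * B * ∫⁻ r in Ioo 0 1, (vhat v r *
            (∫⁻ t in Ioo 0 1, φ t * ENNReal.ofReal (1 / (1 - r * t) ^ 2)) ^ 2) := by
          refine (lintegral_const_mul'' _ ?_).le
          have hm : AEMeasurable (fun p : ℝ × ℝ => φ p.2 * ENNReal.ofReal (1 / (1 - p.1 * p.2) ^ 2))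
              ((volume.restrict (Ioo 0 1)).prod (volume.restrict (Ioo 0 1))) :=
            hφ.comp_snd.mul (by fun_prop)
          exact hvm.aemeasurable.mul (hm.lintegral_prod_right'.pow_const 2)
      _ ≤ 4 * m * B * (κ * Q) := by gcongr; exact hv.lintegral_kernel_le h₂ hφ
  calc _ ≤ 2 * B * (J * Q) + 4 * m * B * (κ * Q) := add_le_add hfirst hsecond
    _ ≤ 2 * B * (J * (C₀ * dirichletNorm v f ^ 2)) +
        4 * m * B * (κ * (C₀ * dirichletNorm v f ^ 2)) := by gcongr
    _ = _ := by ring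

/-! ### The lower estimate: testing on block polynomials. -/

lemma HasTaylor.const_mul {f : ℂ → ℂ} {a : ℕ → ℂ} (h : HasTaylor f a) (c : ℂ) :
    HasTaylor (fun z => c * f z) (fun n => c * a n) := fun z hz =>
  ((h z hz).mul_left c).congr_fun fun n => by ring

lemma IsRadialWeight.dirichletNorm_const_mul (hv : IsRadialWeight v) {f : ℂ → ℂ} {a : ℕ → ℂ}
    (h : HasTaylor f a) (c : ℂ) :
    dirichletNorm v (fun z => c * f z) = ‖c‖ₑ * dirichletNorm v f := by
  have h2 : dirichletNorm v (fun z => c * f z) ^ 2 = (‖c‖ₑ * dirichletNorm v f) ^ 2 := by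
    rw [mul_pow, hv.dirichletNorm_sq h, hv.dirichletNorm_sq (h.const_mul c), mul_add, enorm_mul,
      mul_pow, ← ENNReal.tsum_mul_left]
    congr 1
    refine tsum_congr fun n => ?_
    rw [enorm_mul]; ring
  exact le_antisymm ((ENNReal.pow_le_pow_left_iff two_ne_zero).1 h2.le)
    ((ENNReal.pow_le_pow_left_iff two_ne_zero).1 h2.ge)

lemma genHilbert_const_mul (g f : ℂ → ℂ) (c : ℂ) :
    genHilbert g (fun z => c * f z) = fun z => c * genHilbert g f z := by
  ext z
  simp only [genHilbert, mul_assoc]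
  exact intervalIntegral.integral_const_mul _ _

/-- Homogeneity: `f` divided by its norm lies in the unit ball defining `hilbertNorm`. -/
lemma IsRadialWeight.dirichletNorm_genHilbert_le (hv : IsRadialWeight v) {g f : ℂ → ℂ}
    (hg : IsHol g) {a : ℕ → ℂ} (hf : HasTaylor f a) (hi : ∫⁻ t : ℝ in Ioo 0 1, ‖f t‖ₑ ≠ ∞)
    (h0 : dirichletNorm v f ≠ 0) (ht : dirichletNorm v f ≠ ∞) :
    dirichletNorm v (genHilbert g f) ≤ hilbertNorm v g * dirichletNorm v f := by
  set N := dirichletNorm v f with hN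
  set c : ℂ := ((N.toReal⁻¹ : ℝ) : ℂ) with hc
  have hpos : 0 < N.toReal := ENNReal.toReal_pos h0 ht
  have hce : ‖c‖ₑ = N⁻¹ := by
    rw [hc, ← ofReal_norm, Complex.norm_real, Real.norm_of_nonneg (by positivity),
      ENNReal.ofReal_inv_of_pos hpos, ENNReal.ofReal_toReal ht]
  have hnorm : dirichletNorm v (fun z => c * f z) = 1 := by
    rw [hv.dirichletNorm_const_mul hf, hce, ENNReal.inv_mul_cancel h0 ht]
  have hle : dirichletNorm v (genHilbert g fun z => c * f z) ≤ hilbertNorm v g :=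
    le_iSup₂_of_le (i := fun z => c * f z)
      (j := ⟨⟨(hf.const_mul c).isHol, by rw [hnorm]; exact ENNReal.one_lt_top⟩, hnorm.le⟩) le_rfl
  rw [genHilbert_const_mul, hv.dirichletNorm_const_mul
    (genHilbert_hasTaylor hf.isHol hg.deriv.hasTaylor hi), hce] at hle
  calc dirichletNorm v (genHilbert g f) = N⁻¹ * dirichletNorm v (genHilbert g f) * N := by
        rw [mul_right_comm, ENNReal.inv_mul_cancel h0 ht, one_mul]
    _ ≤ _ := by gcongr

/-- The block polynomial `∑_{N ≤ k < 2N} z^k`. -/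
def block (N : ℕ) (z : ℂ) : ℂ := ∑ k ∈ Finset.Ico N (2 * N), z ^ k

lemma block_hasTaylor (N : ℕ) :
    HasTaylor (block N) (fun n => if n ∈ Finset.Ico N (2 * N) then 1 else 0) := by
  intro z _
  have : HasSum (fun n => (if n ∈ Finset.Ico N (2 * N) then (1 : ℂ) else 0) * z ^ n)
      (∑ n ∈ Finset.Ico N (2 * N), (if n ∈ Finset.Ico N (2 * N) then (1 : ℂ) else 0) * z ^ n) :=
    hasSum_sum_of_ne_finset_zero fun n hn => by rw [if_neg hn, zero_mul]
  convert this using 1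
  rw [block]
  refine Finset.sum_congr rfl fun k hk => ?_
  rw [if_pos hk, one_mul]

lemma setLIntegral_enorm_ne_top_of_continuous {f : ℂ → ℂ} (hf : Continuous f) :
    ∫⁻ t : ℝ in Ioo 0 1, ‖f t‖ₑ ≠ ∞ := by
  have h : IntegrableOn (fun t : ℝ => f t) (Ioo 0 1) :=
    ((hf.comp Complex.continuous_ofReal).integrableOn_Icc).mono_set Ioo_subset_Icc_self
  exact h.2.ne

lemma block_continuous (N : ℕ) : Continuous (block N) := by
  unfold block; fun_prop

lemma radialMoment_block (N n : ℕ) :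
    radialMoment (block N) n = ((∑ k ∈ Finset.Ico N (2 * N), 1 / ((k : ℝ) + n + 1) : ℝ) : ℂ) := by
  have h : ∀ t : ℝ, block N t * (t : ℂ) ^ n =
      ((∑ k ∈ Finset.Ico N (2 * N), t ^ (k + n) : ℝ) : ℂ) := by
    intro t
    rw [block, Finset.sum_mul]
    push_cast
    exact Finset.sum_congr rfl fun k _ => (pow_add _ _ _).symm
  simp_rw [radialMoment, h]
  rw [intervalIntegral.integral_ofReal, intervalIntegral.integral_finsetSum
    (fun k _ => (continuous_pow _).intervalIntegrable _ _)]
  congr 1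
  refine Finset.sum_congr rfl fun k _ => ?_
  rw [integral_pow]
  push_cast
  simp

/-- The moment is a sum of `N` terms `1/(k+n+1)`, each at least `1/(3N)` because `k ≤ 2N - 1` and `n
≤ N`. -/
lemma le_radialMoment_block {N n : ℕ} (hN : 0 < N) (hn : n ≤ N) :
    ENNReal.ofReal (1 / 3) ≤ ‖radialMoment (block N) n‖ₑ := by
  rw [radialMoment_block, ← ofReal_norm, Complex.norm_real]
  refine ENNReal.ofReal_le_ofReal (le_trans ?_ (Real.le_norm_self _))
  have hN' : (0 : ℝ) < N := by exact_mod_cast hN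
  calc (1 / 3 : ℝ) = ∑ _k ∈ Finset.Ico N (2 * N), 1 / (3 * N : ℝ) := by
        rw [Finset.sum_const, Nat.card_Ico, nsmul_eq_mul, show 2 * N - N = N by omega]
        field_simp
    _ ≤ _ := by
        refine Finset.sum_le_sum fun k hk => ?_
        rw [Finset.mem_Ico] at hk
        have h1 : (k : ℝ) + n + 1 ≤ 3 * N := by exact_mod_cast (by omega : k + n + 1 ≤ 3 * N)
        gcongr

/-- The derivative of `block (N + 1)` has the degrees `N, …, 2N`, so only moments of index at least
`N` occur. -/
lemma IsRadialWeight.dirichletNorm_block_sq (hv : IsRadialWeight v) (N : ℕ) :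
    dirichletNorm v (block (N + 1)) ^ 2 =
      ∑ n ∈ Finset.Ico N (2 * N + 1), ((n + 1 : ℕ) : ℝ≥0∞) ^ 2 * moment v n := by
  rw [hv.dirichletNorm_sq (block_hasTaylor (N + 1)),
    tsum_eq_sum (s := Finset.Ico N (2 * N + 1)) (fun n hn => by
      rw [Finset.mem_Ico] at hn
      rw [if_neg (by rw [Finset.mem_Ico]; omega)]
      simp)]
  rw [if_neg (by simp), enorm_zero, zero_pow two_ne_zero, zero_add]
  refine Finset.sum_congr rfl fun n hn => ?_
  rw [Finset.mem_Ico] at hn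
  rw [if_pos (by rw [Finset.mem_Ico]; omega)]
  simp

/-- Testing on block polynomials controls weighted partial sums of the coefficients of `g'`. -/
lemma IsRadialWeight.sum_sq_mul_coeff_le (hv : IsRadialWeight v) {g : ℂ → ℂ} (hg : IsHol g)
    {b : ℕ → ℂ} (hb : HasTaylor (deriv g) b) (N : ℕ) :
    ∑ n ∈ Finset.range (N + 1), ((n + 1 : ℕ) : ℝ≥0∞) ^ 2 * ‖b (n + 1)‖ₑ ^ 2 ≤
      36 * ((N + 1 : ℕ) : ℝ≥0∞) ^ 3 * hilbertNorm v g ^ 2 := by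
  have hW0 := hv.moment_ne_zero N
  have hWt := hv.moment_ne_top N
  have hup : dirichletNorm v (block (N + 1)) ^ 2 ≤ 4 * ((N + 1 : ℕ) : ℝ≥0∞) ^ 3 * moment v N := by
    rw [hv.dirichletNorm_block_sq]
    calc _ ≤ ∑ n ∈ Finset.Ico N (2 * N + 1), ((2 * (N + 1) : ℕ) : ℝ≥0∞) ^ 2 * moment v N := by
          refine Finset.sum_le_sum fun n hn => ?_
          rw [Finset.mem_Ico] at hn
          gcongr
          · omega
          · exact moment_antitone v hn.1
      _ = _ := by
          rw [Finset.sum_const, Nat.card_Ico, nsmul_eq_mul, show 2 * N + 1 - N = N + 1 by omega]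
          rw [Nat.cast_mul, Nat.cast_ofNat]
          generalize ((N + 1 : ℕ) : ℝ≥0∞) = x
          ring
  have hlow : dirichletNorm v (block (N + 1)) ≠ 0 := by
    intro h
    have h1 := hv.dirichletNorm_block_sq N
    rw [h, zero_pow two_ne_zero, eq_comm, Finset.sum_eq_zero_iff] at h1
    have h2 := h1 N (by rw [Finset.mem_Ico]; omega)
    exact mul_ne_zero (pow_ne_zero _ (by exact_mod_cast N.succ_ne_zero)) hW0 h2
  have htop : dirichletNorm v (block (N + 1)) ≠ ∞ := by
    intro h
    rw [h, ENNReal.top_pow two_ne_zero, top_le_iff] at hup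
    exact ENNReal.mul_ne_top (ENNReal.mul_ne_top (by simp)
      (ENNReal.pow_ne_top (ENNReal.natCast_ne_top _))) hWt hup
  have hi := setLIntegral_enorm_ne_top_of_continuous (block_continuous (N + 1))
  have hB := hv.dirichletNorm_genHilbert_le hg (block_hasTaylor (N + 1)) hi hlow htop
  have hL := hv.dirichletNorm_sq (genHilbert_hasTaylor (block_hasTaylor (N + 1)).isHol hb hi)
  have h9 : (9 : ℝ≥0∞) * ENNReal.ofReal (1 / 3) ^ 2 = 1 := by
    rw [← ENNReal.ofReal_ofNat, ← ENNReal.ofReal_pow (by norm_num),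
      ← ENNReal.ofReal_mul (by norm_num)]
    norm_num
  -- Multiplying by `moment v N` removes the weight: the moments decrease, so this one is at most
  -- `moment v n` for `n ≤ N` on the operator side and dominates all moments in the norm of the
  -- block. The constant is `36 = 9 * 4`, with `9` undoing the lower bound `1/3` squared.
  refine (ENNReal.mul_le_mul_iff_left hW0 hWt).1 ?_
  calc (∑ n ∈ Finset.range (N + 1), ((n + 1 : ℕ) : ℝ≥0∞) ^ 2 * ‖b (n + 1)‖ₑ ^ 2) * moment v N
      ≤ ∑ n ∈ Finset.range (N + 1), 9 * (((n + 1 : ℕ) : ℝ≥0∞) ^ 2 *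
          ‖b (n + 1) * radialMoment (block (N + 1)) (n + 1)‖ₑ ^ 2 * moment v n) := by
        rw [Finset.sum_mul]
        refine Finset.sum_le_sum fun n hn => ?_
        rw [Finset.mem_range] at hn
        have hM := le_radialMoment_block (N := N + 1) (n := n + 1) N.succ_pos (by omega)
        calc _ = (9 * ENNReal.ofReal (1 / 3) ^ 2) *
              (((n + 1 : ℕ) : ℝ≥0∞) ^ 2 * ‖b (n + 1)‖ₑ ^ 2 * moment v N) := by rw [h9, one_mul]
          _ = 9 * (((n + 1 : ℕ) : ℝ≥0∞) ^ 2 * (‖b (n + 1)‖ₑ * ENNReal.ofReal (1 / 3)) ^ 2 *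
              moment v N) := by
              generalize ((n + 1 : ℕ) : ℝ≥0∞) = x
              ring
          _ ≤ _ := by
              rw [enorm_mul]
              gcongr
              exact moment_antitone v (by omega)
    _ ≤ 9 * dirichletNorm v (genHilbert g (block (N + 1))) ^ 2 := by
        rw [← Finset.mul_sum, hL]
        gcongr
        exact (ENNReal.sum_le_tsum _).trans le_add_self
    _ ≤ 9 * (hilbertNorm v g * dirichletNorm v (block (N + 1))) ^ 2 := by gcongr
    _ ≤ 9 * (hilbertNorm v g ^ 2 * (4 * ((N + 1 : ℕ) : ℝ≥0∞) ^ 3 * moment v N)) := by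
        rw [mul_pow]; gcongr
    _ = _ := by
        generalize ((N + 1 : ℕ) : ℝ≥0∞) = x
        ring

/-- Partial sums grow at most linearly once quadratically weighted ones grow at most cubically. -/
lemma sum_range_le_of_sq_weighted {c : ℕ → ℝ≥0∞} {D : ℝ≥0∞}
    (h : ∀ N, ∑ n ∈ Finset.range (N + 1), ((n + 1 : ℕ) : ℝ≥0∞) ^ 2 * c n ≤
      36 * ((N + 1 : ℕ) : ℝ≥0∞) ^ 3 * D) (N : ℕ) :
    ∑ n ∈ Finset.range N, c n ≤ 288 * (N : ℝ≥0∞) * D := by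
  induction N using Nat.strong_induction_on with
  | _ N ih =>
    rcases Nat.eq_zero_or_pos N with rfl | hN
    · simp
    obtain ⟨K, rfl⟩ : ∃ K, N = K + 1 := ⟨N - 1, by omega⟩
    -- On the upper half `n ≥ M` the weight `(n+1)²` is at least `(K+1)²/4`, so the tail costs `4 *
    -- 36 = 144`. The lower half is the induction hypothesis, and `288 = 2 * 144` closes the
    -- recursion.
    set M := (K + 1) / 2 with hM
    have hx0 : ((K + 1 : ℕ) : ℝ≥0∞) ≠ 0 := by exact_mod_cast K.succ_ne_zero
    have hxt : ((K + 1 : ℕ) : ℝ≥0∞) ≠ ∞ := ENNReal.natCast_ne_top _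
    have htail : ∑ n ∈ Finset.Ico M (K + 1), c n ≤ 144 * ((K + 1 : ℕ) : ℝ≥0∞) * D := by
      refine (ENNReal.mul_le_mul_iff_right (pow_ne_zero 2 hx0) (ENNReal.pow_ne_top hxt)).1 ?_
      calc ((K + 1 : ℕ) : ℝ≥0∞) ^ 2 * ∑ n ∈ Finset.Ico M (K + 1), c n
          ≤ ∑ n ∈ Finset.Ico M (K + 1), 4 * (((n + 1 : ℕ) : ℝ≥0∞) ^ 2 * c n) := by
            rw [Finset.mul_sum]
            refine Finset.sum_le_sum fun n hn => ?_
            rw [Finset.mem_Ico] at hn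
            have h1 : ((K + 1 : ℕ) : ℝ≥0∞) ≤ 2 * ((n + 1 : ℕ) : ℝ≥0∞) := by
              exact_mod_cast (by omega : K + 1 ≤ 2 * (n + 1))
            calc _ ≤ (2 * ((n + 1 : ℕ) : ℝ≥0∞)) ^ 2 * c n := by gcongr
              _ = _ := by rw [mul_pow, mul_assoc]; norm_num
        _ ≤ 4 * ∑ n ∈ Finset.range (K + 1), ((n + 1 : ℕ) : ℝ≥0∞) ^ 2 * c n := by
            rw [← Finset.mul_sum]
            gcongr
            intro n hn
            rw [Finset.mem_Ico] at hn
            exact Finset.mem_range.2 hn.2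
        _ ≤ 4 * (36 * ((K + 1 : ℕ) : ℝ≥0∞) ^ 3 * D) := by gcongr; exact h K
        _ = _ := by
            generalize ((K + 1 : ℕ) : ℝ≥0∞) = x
            ring
    have hhead := ih M (by omega)
    have h2M : 2 * (M : ℝ≥0∞) ≤ ((K + 1 : ℕ) : ℝ≥0∞) := by
      exact_mod_cast (by omega : 2 * M ≤ K + 1)
    rw [← Finset.sum_range_add_sum_Ico _ (show M ≤ K + 1 by omega)]
    calc _ ≤ 288 * (M : ℝ≥0∞) * D + 144 * ((K + 1 : ℕ) : ℝ≥0∞) * D := add_le_add hhead htail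
      _ = 144 * (2 * (M : ℝ≥0∞)) * D + 144 * ((K + 1 : ℕ) : ℝ≥0∞) * D := by ring
      _ ≤ 144 * ((K + 1 : ℕ) : ℝ≥0∞) * D + 144 * ((K + 1 : ℕ) : ℝ≥0∞) * D := by gcongr
      _ = _ := by
          generalize ((K + 1 : ℕ) : ℝ≥0∞) = x
          ring

lemma tsum_ofReal_geometric {r : ℝ} (h0 : 0 ≤ r) (h1 : r < 1) :
    ∑' n : ℕ, ENNReal.ofReal (r ^ n) = ENNReal.ofReal (1 / (1 - r)) := by
  rw [← ENNReal.ofReal_tsum_of_nonneg (fun n => pow_nonneg h0 n)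
    (summable_geometric_of_lt_one h0 h1), tsum_geometric_of_lt_one h0 h1, one_div]

/-- Abel summation: linear growth of partial sums bounds the power series by `1/(1-r)`. -/
lemma tsum_mul_pow_le_of_sum_range_le {c : ℕ → ℝ≥0∞} {D : ℝ≥0∞}
    (h : ∀ N : ℕ, ∑ n ∈ Finset.range N, c n ≤ N * D) {r : ℝ} (hr : r ∈ Ioo (0 : ℝ) 1) :
    (∑' n, c n * ENNReal.ofReal (r ^ n)) * ENNReal.ofReal (1 - r) ≤ D := by
  have h1r : 0 < 1 - r := by linarith [hr.2]
  have hinv : ENNReal.ofReal (1 - r) * ENNReal.ofReal (1 / (1 - r)) = 1 := by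
    rw [← ENNReal.ofReal_mul h1r.le, mul_one_div_cancel h1r.ne', ENNReal.ofReal_one]
  -- The Cauchy product with the geometric series has the partial sums as coefficients; multiplying
  -- by `1 - r` undoes that series.
  have key : ∀ d : ℕ → ℝ≥0∞, (∑' n, d n * ENNReal.ofReal (r ^ n)) =
      ENNReal.ofReal (1 - r) * ∑' m : ℕ, (∑ n ∈ Finset.range (m + 1), d n) * ENNReal.ofReal (r ^ m) := by
    intro d
    have e : ∀ m : ℕ, (∑ n ∈ Finset.range (m + 1), d n) * ENNReal.ofReal (r ^ m) =
        ∑ kl ∈ Finset.HasAntidiagonal.antidiagonal m, (d kl.1 * ENNReal.ofReal (r ^ kl.1)) * ENNReal.ofReal (r ^ kl.2) := by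
      intro m
      rw [Finset.Nat.sum_antidiagonal_eq_sum_range_succ
        (fun k l => (d k * ENNReal.ofReal (r ^ k)) * ENNReal.ofReal (r ^ l)), Finset.sum_mul]
      refine Finset.sum_congr rfl fun k hk => ?_
      rw [Finset.mem_range] at hk
      rw [mul_assoc, ← ENNReal.ofReal_mul (pow_nonneg hr.1.le _), ← pow_add,
        Nat.add_sub_cancel' (by omega)]
    have e2 : ∑' m : ℕ, ∑ kl ∈ Finset.HasAntidiagonal.antidiagonal m,
        (d kl.1 * ENNReal.ofReal (r ^ kl.1)) * ENNReal.ofReal (r ^ kl.2) =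
        (∑' n, d n * ENNReal.ofReal (r ^ n)) * ∑' n : ℕ, ENNReal.ofReal (r ^ n) := by
      rw [← ENNReal.tsum_mul_right]
      simp_rw [← ENNReal.tsum_mul_left]
      rw [← ENNReal.tsum_prod (f := fun k l => (d k * ENNReal.ofReal (r ^ k)) * ENNReal.ofReal (r ^ l)),
        ← (Finset.HasAntidiagonal.sigmaAntidiagonalEquivProd (A := ℕ)).tsum_eq, ENNReal.tsum_sigma']
      refine tsum_congr fun m => ?_
      rw [tsum_fintype, Finset.univ_eq_attach, ← Finset.sum_attach]
      rfl
    simp_rw [e]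
    rw [e2, tsum_ofReal_geometric hr.1.le hr.2, mul_left_comm, hinv, mul_one]
  -- The case `d = 1` of `key` evaluates the majorant series `∑ (m+1) r^m`.
  have hone : ∑' n : ℕ, ENNReal.ofReal (r ^ n) =
      ENNReal.ofReal (1 - r) * ∑' m : ℕ, ((m + 1 : ℕ) : ℝ≥0∞) * ENNReal.ofReal (r ^ m) := by
    simpa using key fun _ => 1
  calc _ ≤ (ENNReal.ofReal (1 - r) * ∑' m : ℕ, ((m + 1 : ℕ) * D) * ENNReal.ofReal (r ^ m)) *
        ENNReal.ofReal (1 - r) := by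
        rw [key]
        gcongr with m
        exact h (m + 1)
    _ = D * ((ENNReal.ofReal (1 - r) * ∑' m : ℕ, ((m + 1 : ℕ) : ℝ≥0∞) * ENNReal.ofReal (r ^ m)) *
        ENNReal.ofReal (1 - r)) := by
        have : ∑' m : ℕ, (((m + 1 : ℕ) : ℝ≥0∞) * D) * ENNReal.ofReal (r ^ m) =
            D * ∑' m : ℕ, ((m + 1 : ℕ) : ℝ≥0∞) * ENNReal.ofReal (r ^ m) := by
          rw [← ENNReal.tsum_mul_left]
          refine tsum_congr fun m => ?_
          rw [mul_comm _ D, mul_assoc]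
        rw [this]; ring
    _ = D := by
        rw [← hone, tsum_ofReal_geometric hr.1.le hr.2, mul_comm (ENNReal.ofReal _), hinv, mul_one]

/-- The lower estimate for the generalized Hilbert operator. -/
theorem IsRadialWeight.besovSeminorm_le (hv : IsRadialWeight v) {g : ℂ → ℂ} (hg : IsHol g) :
    besovSeminorm g ≤ 17 * hilbertNorm v g := by
  obtain ⟨b, hb⟩ : ∃ b, HasTaylor (deriv g) b := ⟨_, hg.deriv.hasTaylor⟩
  set D := hilbertNorm v g ^ 2 with hD
  have hS := sum_range_le_of_sq_weighted (c := fun n => ‖b (n + 1)‖ₑ ^ 2)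
    (fun N => hv.sum_sq_mul_coeff_le hg hb N)
  -- The block estimates concern only `b (n+1)`; the coefficient `b 0` comes from the test function
  -- `1`. Together they give `1 + 288 = 17²`.
  have hb0 : ‖b 0‖ₑ ^ 2 ≤ D := by
    have h1 : HasTaylor (fun _ => 1) (fun n => if n = 0 then (1 : ℂ) else 0) := by
      intro z _
      simpa using hasSum_single (f := fun n : ℕ => (if n = 0 then (1 : ℂ) else 0) * z ^ n) 0
        (fun n hn => by rw [if_neg hn, zero_mul])
    have hn1 : dirichletNorm v (fun _ => 1) = 1 := by simp [dirichletNorm]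
    have hle : dirichletNorm v (genHilbert g fun _ => 1) ≤ hilbertNorm v g :=
      le_iSup₂_of_le (i := fun _ => 1)
        (j := ⟨⟨h1.isHol, by rw [hn1]; exact ENNReal.one_lt_top⟩, hn1.le⟩) le_rfl
    have hL := hv.dirichletNorm_sq (genHilbert_hasTaylor h1.isHol hb
      (setLIntegral_enorm_ne_top_of_continuous continuous_const))
    have hm : radialMoment (fun _ => 1) 0 = 1 := by simp [radialMoment]
    calc ‖b 0‖ₑ ^ 2 ≤ dirichletNorm v (genHilbert g fun _ => 1) ^ 2 := by
          rw [hL, hm, mul_one]; exact le_self_add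
      _ ≤ D := by rw [hD]; gcongr
  refine iSup₂_le fun r hr => ?_
  refine (ENNReal.pow_le_pow_left_iff two_ne_zero).1 ?_
  rw [mul_pow, hb.integralMean_sq hr.1.le hr.2, ofReal_sqrt_sq (by linarith [hr.2]), mul_pow, ← hD]
  have hmono : ∀ n : ℕ, ENNReal.ofReal (r ^ (2 * (n + 1))) ≤ ENNReal.ofReal (r ^ n) := fun n =>
    ENNReal.ofReal_le_ofReal (pow_le_pow_of_le_one hr.1.le hr.2.le (by omega))
  have hone : ENNReal.ofReal (1 - r) ≤ 1 := by
    rw [ENNReal.ofReal_le_one]; linarith [hr.1]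
  rw [tsum_eq_zero_add' ENNReal.summable, add_mul]
  calc _ ≤ D * 1 + (∑' n : ℕ, ‖b (n + 1)‖ₑ ^ 2 * ENNReal.ofReal (r ^ n)) * ENNReal.ofReal (1 - r) := by
        refine add_le_add (mul_le_mul' (by simpa using hb0) hone) (mul_le_mul_left
          (ENNReal.tsum_le_tsum fun n => mul_le_mul_right (hmono n) _) _)
    _ ≤ D * 1 + 288 * D := by
        refine add_le_add_right ?_ _
        exact tsum_mul_pow_le_of_sum_range_le (D := 288 * D)
          (fun N => (hS N).trans_eq (by ring)) hr
    _ = 17 ^ 2 * D := by ring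

/-! ### Conclusion. -/

lemma besovNorm_eq (g : ℂ → ℂ) : besovNorm g = ‖g 0‖ₑ + besovSeminorm g := rfl

lemma besovNorm_sub_const (g : ℂ → ℂ) : besovNorm (fun z => g z - g 0) = besovSeminorm g := by
  have h : deriv (fun z => g z - g 0) = deriv g := by ext z; exact deriv_sub_const _
  rw [besovNorm_eq, besovSeminorm, besovSeminorm, h, sub_self, enorm_zero, zero_add]

lemma IsRadialWeight.setLIntegral_enorm_ne_top (hv : IsRadialWeight v) (h₁ : muckenhoupt₁ v < ∞)
    (h₂ : muckenhoupt₂ v < ∞) {f : ℂ → ℂ} (hf : f ∈ dirichletSpace v) :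
    ∫⁻ t : ℝ in Ioo 0 1, ‖f t‖ₑ ≠ ∞ := by
  obtain ⟨C, hC, hrad⟩ := hv.exists_radius_bound h₁ h₂
  intro h
  have h1 := (hv.lintegral_sq_le hf.1.aemeasurable_radius).trans (mul_le_mul_right (hrad f hf.1) _)
  rw [h, ENNReal.top_pow two_ne_zero, top_le_iff] at h1
  exact ENNReal.mul_ne_top (hv.lintegral_div_vtail_ne_top h₁ h₂)
    (ENNReal.mul_ne_top hC (ENNReal.pow_ne_top hf.2.ne)) h1

end HilbertOp
end

theorem mainTheorem4 (v : ℂ → ℝ) (hv : HilbertOp.IsDoubling v)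
    (h₁ : HilbertOp.muckenhoupt₁ v < ∞) (h₂ : HilbertOp.muckenhoupt₂ v < ∞) :
    (∀ g : ℂ → ℂ, HilbertOp.IsHol g → ∀ f ∈ HilbertOp.dirichletSpace v,
      (∀ z ∈ HilbertOp.unitDisc, IntervalIntegrable
        (fun t : ℝ => f (t : ℂ) * deriv g ((t : ℂ) * z)) MeasureTheory.volume 0 1) ∧
      HilbertOp.IsHol (HilbertOp.genHilbert g f)) ∧
    (∀ g : ℂ → ℂ, HilbertOp.IsHol g →
      (HilbertOp.IsBoundedHilbert v g ↔ g ∈ HilbertOp.besovSpace)) ∧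
    (∃ c C : ℝ≥0, 0 < c ∧ 0 < C ∧ ∀ g : ℂ → ℂ, HilbertOp.IsHol g →
      c * HilbertOp.besovNorm (fun z => g z - g 0) ≤ HilbertOp.hilbertNorm v g ∧
      HilbertOp.hilbertNorm v g ≤ C * HilbertOp.besovNorm (fun z => g z - g 0)) := by
  open HilbertOp in
  have hw : IsRadialWeight v := hv.toIsRadialWeight
  have hfin := fun f hf => hw.setLIntegral_enorm_ne_top h₁ h₂ (f := f) hf
  have hhol : ∀ g, IsHol g → ∀ f ∈ dirichletSpace v, IsHol (genHilbert g f) := fun g hg f hf =>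
    (genHilbert_hasTaylor hf.1 hg.deriv.hasTaylor (hfin f hf)).isHol
  obtain ⟨C₀, hC₀, hup⟩ := hw.exists_upper_bound h₁ h₂
  lift C₀ to ℝ≥0 using hC₀
  -- The estimate is known for squares. Since `C₀ ≤ (C₀ + 1)²`, the constant `C₀ + 1` avoids a
  -- square root and is positive even if `C₀ = 0`.
  have hup' : ∀ g, IsHol g → ∀ f ∈ dirichletSpace v, dirichletNorm v (genHilbert g f) ≤
      ((C₀ + 1 : ℝ≥0) : ℝ≥0∞) * besovSeminorm g * dirichletNorm v f := by
    intro g hg f hf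
    refine (ENNReal.pow_le_pow_left_iff two_ne_zero).1 ((hup g hg f hf).trans ?_)
    rw [mul_pow, mul_pow]
    gcongr
    exact_mod_cast (le_self_add.trans (le_self_pow₀ le_add_self two_ne_zero) : C₀ ≤ (C₀ + 1) ^ 2)
  have hlow : ∀ g, IsHol g → besovSeminorm g ≤ 17 * hilbertNorm v g := fun g hg =>
    hw.besovSeminorm_le hg
  refine ⟨fun g hg f hf => ⟨fun z hz => genHilbert_integrable hf.1 hg (hfin f hf) hz,
    hhol g hg f hf⟩, fun g hg => ⟨?_, ?_⟩, 17⁻¹, C₀ + 1, by positivity, by positivity,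
    fun g hg => ⟨?_, ?_⟩⟩
  · rintro ⟨C, hC⟩
    have hH : hilbertNorm v g ≤ C := iSup₂_le fun f hf =>
      (hC f hf.1).2.trans (mul_le_of_le_one_right zero_le hf.2)
    refine ⟨hg, ?_⟩
    rw [besovNorm_eq, ENNReal.add_lt_top]
    refine ⟨enorm_lt_top, ((hlow g hg).trans (mul_le_mul_right hH _)).trans_lt ?_⟩
    exact ENNReal.mul_lt_top (by simp) ENNReal.coe_lt_top
  · rintro ⟨-, hB⟩
    have hB' : besovSeminorm g ≠ ∞ := (le_add_self.trans_lt hB).ne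
    refine ⟨(C₀ + 1) * (besovSeminorm g).toNNReal, fun f hf => ?_⟩
    have hle := hup' g hg f hf
    rw [ENNReal.coe_mul, ENNReal.coe_toNNReal hB']
    refine ⟨⟨hhol g hg f hf, hle.trans_lt ?_⟩, hle⟩
    exact ENNReal.mul_lt_top (ENNReal.mul_lt_top ENNReal.coe_lt_top hB'.lt_top) hf.2
  · rw [besovNorm_sub_const, ENNReal.coe_inv (by norm_num)]
    refine (mul_le_mul_right (hlow g hg) _).trans_eq ?_
    rw [← mul_assoc, ENNReal.coe_ofNat, ENNReal.inv_mul_cancel (by simp) (by simp), one_mul]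
  · rw [besovNorm_sub_const]
    exact iSup₂_le fun f hf => (hup' g hg f hf.1).trans (mul_le_of_le_one_right zero_le hf.2)
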